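/- All vector spaces are over $\mathbb{Z}_2$ and $\mathbb{Z}$-graded, with homological conventions. An $A_\infty$-category $\mathcal{A}$ of degree $N_{\mathcal A}\in\mathbb{Z}$ has structure maps $\mu_k:\mathcal{A}(X_0,X_1)\otimes\cdots\otimes\mathcal{A}(X_{k-1},X_k)\to\mathcal{A}(X_0,X_k)$, $k\ge 1$, of degree $-2+k(1-N_{\mathcal A})+N_{\mathcal A}$; an $A_\infty$-functor $F:\mathcal A\to\mathcal B$ has components $F_k$, $k\geq 1$, of degree $-1+k(1-N_{\mathcal A})+N_{\mathcal B}$; an $\mathcal A$–$\mathcal B$ bimodule $\mathcal M$ has structure maps $\mu^{\mathcal M}_{k|1|m}$ of degree $-1+k(1-N_{\mathcal A})+m(1-N_{\mathcal B})$; a pre-morphism of bimodules of degree $g$ has components $\nu_{k|1|m}$, $k,m\ge 0$, of degree $g+k(1-N_{\mathcal A})+m(1-N_{\mathcal B})$. Bimodules and pre-morphisms form a dg-category; a bimodule morphism is a closed pre-morphism, and it is a quasi-isomorphism if its class is an isomorphism in the homological category. $\mathcal{A}[j]$ is the $j$-fold suspension, $\mathcal A[j](X,Y)_p=\mathcal A(X,Y)_{p+j}$,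 of degree $N_{\mathcal A}-j$, and $\mathcal M[k]$ denotes a suspension of an $\mathcal A$–$\mathcal A$ bimodule, regarded as an $\mathcal A[j]$–$\mathcal A[j]$ bimodule. $\mathcal{A}_\Delta$ is the diagonal bimodule, $\mathcal{M}^\vee$ is the linear dual bimodule, $\mathcal M^\vee(Y,X)_q=\hom(\mathcal M(X,Y)_{-q},\mathbb Z_2)$, and $\mathcal A^\vee=(\mathcal A_\Delta)^\vee$. For an $\mathcal A$–$\mathcal A$ bimodule $\mathcal M$, the Hochschild complex $CC_p(\mathcal A,\mathcal M)=\bigoplus \mathcal A(X_0,\dots,X_k)\otimes\mathcal M(X_k,X_0)$ is taken in total degree $N_{\mathcal A}+p-k(1-N_{\mathcal A})$; $CC_n(\mathcal A,\mathcal M)^\vee=\hom(CC_{-n}(\mathcal A,\mathcal M),\mathbb Z_2)$ with the dual differential; $CC(\mathcal A)=CC(\mathcal A,\mathcal A_\Delta)$. To $\sigma\in CC_{N_{\mathcal A}}(\mathcal A,\mathcal M)^\vee$ one associates the pre-morphism $\Gamma T^\vee(\sigma):\mathcal A_\Delta\to\mathcal M^\vee$ of degree $-N_{\mathcal A}$,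 $$\langle\Gamma T^\vee(\sigma)(x_1,\dots,x_k,\mathbf w,y_m,\dots,y_1),\mathbf z\rangle=\sum_{0\le a\le b\le k}\sigma\big(x_{a+1}\otimes\cdots\otimes x_{b}\otimes\mu^{\mathcal M}(x_{b+1},\dots,x_k,\mathbf w,y_m,\dots,y_1,\mathbf z,x_1,\dots,x_a)\big).$$ A cochain $\sigma\in CC_{N_{\mathcal A}}(\mathcal A,\mathcal M)^\vee$ is homologically non-degenerate if it is closed and for all objects $X,X'$ and all $p\in\mathbb Z$ the map $$H_p(\mathcal A(X,X'))\to\hom\big(H_{N_{\mathcal A}-p}(\mathcal M(X',X)),\mathbb Z_2\big),\qquad [x]\mapsto\big([z]\mapsto\sigma(\mu^{\mathcal M}_{1|1|0}(x,z))\big)$$ is an isomorphism. Let $\mathcal A,\mathcal B$ be homologically unital $A_\infty$-categories with $N_{\mathcal A}=N_{\mathcal B}+j$, let $\mathbf I:\mathcal B\to\mathcal A[j]$ be an $A_\infty$-functor, let $\mathcal A^{rel}_\Delta$ be a homologically unital $\mathcal A$–$\mathcal A$ bimodule, $\mathcal A^\vee_{rel}=(\mathcal A^{rel}_\Delta)^\vee$,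 and let $i_{rel}:\mathcal B_\Delta\to\mathbf I^*\mathcal A^{rel}_\Delta[-j]$ be a $\mathcal B$–$\mathcal B$ bimodule morphism of degree $j$. Let $i:\mathcal B_\Delta\to\mathbf I^*(\mathcal A_\Delta)[j]$ be the degree-$0$ morphism with components $i_{k|1|m}=\mathbf I_{k+m+1}$. For a pre-morphism $\alpha:\mathcal A_\Delta\to\mathcal A_{rel}^\vee$ put $$\Psi_{i,i_{rel}}(\alpha)=i_{rel}^\vee\circ\mathbf I^*\alpha[j]\circ i:\ \mathcal B_\Delta\to\mathbf I^*\mathcal A_\Delta[j]\to\mathbf I^*\mathcal A^\vee_{rel}[j]=(\mathbf I^*\mathcal A^{rel}_\Delta[-j])^\vee\to\mathcal B^\vee .$$ A bimodule morphism $\phi:\mathcal A_\Delta\to\mathcal A^\vee_{rel}$ of degree $-N_{\mathcal A}$ represents (together with $i_{rel}$) a relative weak Calabi–Yau pairing on $\mathcal A$ with coefficients in $\mathcal A^{rel}_\Delta$ if both $\phi$ and $\Psi_{i,i_{rel}}(\phi)$ are quasi-isomorphisms. Let $$\mathbf I^{rel}_*:CC_\bullet(\mathcal B)\xrightarrow{(i_{rel})_*}CC_{\bullet+j}(\mathcal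 B,\mathbf I^*\mathcal A^{rel}_\Delta[-j])\xrightarrow{\mathbf I_*}CC_{\bullet+j}(\mathcal A[j],\mathcal A^{rel}_\Delta[-j])\cong CC_{\bullet-j}(\mathcal A,\mathcal A^{rel}_\Delta),$$ so that $(\mathbf I^{rel}_*)^\vee$ maps $CC_{N_{\mathcal A}}(\mathcal A,\mathcal A^{rel}_\Delta)^\vee$ to $CC_{N_{\mathcal B}}(\mathcal B)^\vee$. **Proposition.** For every bimodule morphism $\phi:\mathcal A_\Delta\to\mathcal A^\vee_{rel}$ of degree $-N_{\mathcal A}$ the following are equivalent: 1. $\phi$ represents a relative weak Calabi–Yau pairing on $\mathcal A$ with coefficients in $\mathcal A^{rel}_\Delta$; 2. every closed $\sigma\in CC_{N_{\mathcal A}}(\mathcal A,\mathcal A^{rel}_\Delta)^\vee$ with $[\Gamma T^\vee(\sigma)]=[\phi]$ is homologically non-degenerate, and $(\mathbf I^{rel}_*)^\vee\sigma\in CC_{N_{\mathcal B}}(\mathcal B)^\vee$ is homologically non-degenerate; 3. there is a closed $\sigma\in CC_{N_{\mathcal A}}(\mathcal A,\mathcal A^{rel}_\Delta)^\vee$ with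 $[\Gamma T^\vee(\sigma)]=[\phi]$ such that $\sigma$ and $(\mathbf I^{rel}_*)^\vee\sigma$ are homologically non-degenerate. -/

import Mathlib

universe u u' v v' v₂ w w' w''

/-! ## Composable strings

All vector spaces are over `ZMod 2`, so that linear means additive and there are no signs.
A graded vector space is a family indexed by `ℤ`; its elements are homogeneous, and an operation
into it returns one component in each degree `q` (zero except in the degree prescribed). -/

/-- `Str V X Y` : composable strings `x₁ ⊗ ⋯ ⊗ x_k` of homogeneous elements `x_i ∈ V(X_{i-1}, X_i)`
with `X₀ = X`, `X_k = Y`, `k ≥ 0`. -/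
inductive Str {Ob : Type u} (V : Ob → Ob → ℤ → Type v) : Ob → Ob → Type (max u v)
  | nil (X : Ob) : Str V X X
  | cons {X Y Z : Ob} (p : ℤ) (x : V X Y p) (s : Str V Y Z) : Str V X Z

namespace Str

section Basic

variable {Ob : Type u} {V : Ob → Ob → ℤ → Type v} {R : Type w}

/-- Concatenation of strings. -/
def append {X Y Z : Ob} : Str V X Y → Str V Y Z → Str V X Z
  | nil _, t => t
  | cons p x s, t => cons p x (append s t)

/-- The string `x₁ ⊗ s`, where `x₁` is the degree `d` component of the family `f`. -/
def consAt {X Y Z : Ob} (d : ℤ) (f : ∀ q, V X Y q) (s : Str V Y Z) : Str V X Z :=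
  cons d (f d) s

/-- The number of entries. -/
def length {X Y : Ob} : Str V X Y → ℕ
  | nil _ => 0
  | cons _ _ s => s.length + 1

/-- `rdeg N (x₁ ⊗ ⋯ ⊗ x_k) = |x₁| + ⋯ + |x_k| + k (1 - N)`. -/
def rdeg (N : ℤ) {X Y : Ob} : Str V X Y → ℤ
  | nil _ => 0
  | cons p _ s => (p + (1 - N)) + rdeg N s

/-- Sum of `F a b` over all ways to cut the string as `s = a ⊗ b` (with `a`, `b` possibly empty). -/
def sumSplit [AddCommMonoid R] {X Z : Ob} :
    (s : Str V X Z) → (F : ∀ Y : Ob, Str V X Y → Str V Y Z → R) → R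
  | nil X, F => F X (nil X) (nil X)
  | cons p x s, F => F _ (nil _) (cons p x s) + sumSplit s (fun Y a b => F Y (cons p x a) b)

/-- Sum of `F a b c` over all ways to cut the string as `s = a ⊗ b ⊗ c`
(with `a`, `b`, `c` possibly empty). -/
def sumSplit₃ [AddCommMonoid R] {X Z : Ob} (s : Str V X Z)
    (F : ∀ Y Y' : Ob, Str V X Y → Str V Y Y' → Str V Y' Z → R) : R :=
  s.sumSplit fun Y a r => r.sumSplit fun Y' b c => F Y Y' a b c

/-- Multilinearity over `ZMod 2` of a function of a string: additivity in every entry. -/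
def IsMultilinear [∀ X Y p, AddCommGroup (V X Y p)] [AddCommMonoid R] {X Y : Ob}
    (G : Str V X Y → R) : Prop :=
  ∀ (U W : Ob) (a : Str V X U) (p : ℤ) (x x' : V U W p) (b : Str V W Y),
    G (a.append (cons p (x + x') b)) = G (a.append (cons p x b)) + G (a.append (cons p x' b))

@[simp] theorem nil_append {X Y : Ob} (t : Str V X Y) : (nil X).append t = t := rfl

@[simp] theorem cons_append {X Y Z W : Ob} (p : ℤ) (x : V X Y p) (s : Str V Y Z) (t : Str V Z W) :
    (cons p x s).append t = cons p x (s.append t) := rfl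

@[simp] theorem append_nil {X Y : Ob} (s : Str V X Y) : s.append (nil Y) = s := by
  induction s with
  | nil => rfl
  | cons p x s ih => simp [ih]

@[simp] theorem append_assoc {X Y Z W : Ob} (s : Str V X Y) (t : Str V Y Z) (r : Str V Z W) :
    (s.append t).append r = s.append (t.append r) := by
  induction s with
  | nil => rfl
  | cons p x s ih => simp [ih]

@[simp] theorem consAt_append {X Y Z W : Ob} (d : ℤ) (f : ∀ q, V X Y q) (s : Str V Y Z)
    (t : Str V Z W) : (consAt d f s).append t = consAt d f (s.append t) := rfl

@[simp] theorem length_nil {X : Ob} : (nil X : Str V X X).length = 0 := rfl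

@[simp] theorem length_cons {X Y Z : Ob} (p : ℤ) (x : V X Y p) (s : Str V Y Z) :
    (cons p x s).length = s.length + 1 := rfl

@[simp] theorem length_append {X Y Z : Ob} (s : Str V X Y) (t : Str V Y Z) :
    (s.append t).length = s.length + t.length := by
  induction s with
  | nil => simp
  | cons p x s ih => simp [ih]; omega

@[simp] theorem rdeg_nil (N : ℤ) {X : Ob} : (nil X : Str V X X).rdeg N = 0 := rfl

@[simp] theorem rdeg_cons (N : ℤ) {X Y Z : Ob} (p : ℤ) (x : V X Y p) (s : Str V Y Z) :
    (cons p x s).rdeg N = (p + (1 - N)) + s.rdeg N := rfl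

@[simp] theorem rdeg_consAt (N : ℤ) {X Y Z : Ob} (d : ℤ) (f : ∀ q, V X Y q) (s : Str V Y Z) :
    (consAt d f s).rdeg N = (d + (1 - N)) + s.rdeg N := rfl

@[simp] theorem rdeg_append (N : ℤ) {X Y Z : Ob} (s : Str V X Y) (t : Str V Y Z) :
    (s.append t).rdeg N = s.rdeg N + t.rdeg N := by
  induction s with
  | nil => simp
  | cons p x s ih => simp [ih]; omega

variable [AddCommMonoid R]

@[simp] theorem sumSplit_nil {X : Ob} (F : ∀ Y : Ob, Str V X Y → Str V Y X → R) :
    (nil X).sumSplit F = F X (nil X) (nil X) := rfl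

@[simp] theorem sumSplit_cons {X Y Z : Ob} (p : ℤ) (x : V X Y p) (s : Str V Y Z)
    (F : ∀ W : Ob, Str V X W → Str V W Z → R) :
    (cons p x s).sumSplit F
      = F _ (nil _) (cons p x s) + s.sumSplit (fun W a b => F W (cons p x a) b) := rfl

theorem sumSplit_congr {X Z : Ob} (s : Str V X Z) {F G : ∀ Y : Ob, Str V X Y → Str V Y Z → R}
    (h : ∀ Y a b, a.append b = s → F Y a b = G Y a b) : s.sumSplit F = s.sumSplit G := by
  induction s with
  | nil => exact h _ _ _ rfl
  | cons p x s ih =>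
    simp only [sumSplit_cons]
    rw [h _ (nil _) (cons p x s) rfl]
    congr 1
    exact ih fun Y a b hab => h Y _ _ (by simp [hab])

theorem sumSplit_zero {X Z : Ob} (s : Str V X Z) :
    s.sumSplit (fun _ _ _ => (0 : R)) = 0 := by
  induction s with
  | nil => rfl
  | cons p x s ih => simp [ih]

theorem sumSplit_add {X Z : Ob} (s : Str V X Z) (F G : ∀ Y : Ob, Str V X Y → Str V Y Z → R) :
    s.sumSplit (fun Y a b => F Y a b + G Y a b) = s.sumSplit F + s.sumSplit G := by
  induction s with
  | nil => rfl
  | cons p x s ih => simp only [sumSplit_cons, ih]; abel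

theorem map_sumSplit {S : Type w'} [AddCommMonoid S] (φ : R →+ S) {X Z : Ob} (s : Str V X Z)
    (F : ∀ Y : Ob, Str V X Y → Str V Y Z → R) :
    φ (s.sumSplit F) = s.sumSplit (fun Y a b => φ (F Y a b)) := by
  induction s with
  | nil => rfl
  | cons p x s ih => simp only [sumSplit_cons, map_add, ih]

theorem sumSplit_comm {Ob' : Type u'} {V' : Ob' → Ob' → ℤ → Type v'} {X Z : Ob} {X' Z' : Ob'}
    (s : Str V X Z) (t : Str V' X' Z')
    (F : ∀ Y : Ob, Str V X Y → Str V Y Z → ∀ Y' : Ob', Str V' X' Y' → Str V' Y' Z' → R) :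
    s.sumSplit (fun Y a b => t.sumSplit (fun Y' a' b' => F Y a b Y' a' b'))
      = t.sumSplit (fun Y' a' b' => s.sumSplit (fun Y a b => F Y a b Y' a' b')) := by
  induction s with
  | nil => rfl
  | cons p x s ih => simp only [sumSplit_cons, ih, sumSplit_add]

theorem sumSplit_append_cons {X Y Z W : Ob} (s : Str V X Y) (p : ℤ) (x : V Y Z p) (t : Str V Z W)
    (F : ∀ U : Ob, Str V X U → Str V U W → R) :
    (s.append (cons p x t)).sumSplit F
      = s.sumSplit (fun U a b => F U a (b.append (cons p x t)))
        + t.sumSplit (fun U a b => F U (s.append (cons p x a)) b) := by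
  induction s with
  | nil => rfl
  | cons p' x' s ih => simp only [cons_append, sumSplit_cons, ih, add_assoc]

theorem sumSplit_assoc {X Z : Ob} (s : Str V X Z)
    (F : ∀ Y Y' : Ob, Str V X Y → Str V Y Y' → Str V Y' Z → R) :
    s.sumSplit (fun Y' r c => r.sumSplit (fun Y a b => F Y Y' a b c)) = s.sumSplit₃ F := by
  unfold sumSplit₃
  induction s with
  | nil => rfl
  | cons p x s ih =>
    simp only [sumSplit_cons, sumSplit_nil, sumSplit_add, ih, add_assoc]

theorem sumSplit₃_congr {X Z : Ob} (s : Str V X Z)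
    {F G : ∀ Y Y' : Ob, Str V X Y → Str V Y Y' → Str V Y' Z → R}
    (h : ∀ Y Y' a b c, a.append (b.append c) = s → F Y Y' a b c = G Y Y' a b c) :
    s.sumSplit₃ F = s.sumSplit₃ G := by
  refine sumSplit_congr _ fun Y a r hr => sumSplit_congr _ fun Y' b c hb => ?_
  subst hb
  exact h _ _ _ _ _ hr

theorem sumSplit₃_add {X Z : Ob} (s : Str V X Z)
    (F G : ∀ Y Y' : Ob, Str V X Y → Str V Y Y' → Str V Y' Z → R) :
    s.sumSplit₃ (fun Y Y' a b c => F Y Y' a b c + G Y Y' a b c)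
      = s.sumSplit₃ F + s.sumSplit₃ G := by
  simp only [sumSplit₃, sumSplit_add]

theorem sumSplit₃_zero {X Z : Ob} (s : Str V X Z) :
    s.sumSplit₃ (fun _ _ _ _ _ => (0 : R)) = 0 := by
  simp only [sumSplit₃, sumSplit_zero]

theorem map_sumSplit₃ {S : Type w'} [AddCommMonoid S] (φ : R →+ S) {X Z : Ob} (s : Str V X Z)
    (F : ∀ Y Y' : Ob, Str V X Y → Str V Y Y' → Str V Y' Z → R) :
    φ (s.sumSplit₃ F) = s.sumSplit₃ (fun Y Y' a b c => φ (F Y Y' a b c)) := by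
  simp only [sumSplit₃, map_sumSplit]

theorem sumSplit₃_append_cons {X Y Z W : Ob} (s : Str V X Y) (p : ℤ) (x : V Y Z p) (t : Str V Z W)
    (F : ∀ U U' : Ob, Str V X U → Str V U U' → Str V U' W → R) :
    (s.append (cons p x t)).sumSplit₃ F
      = s.sumSplit (fun U s₁ s₂ => t.sumSplit (fun U' t₁ t₂ =>
          F U U' s₁ (s₂.append (cons p x t₁)) t₂))
        + (s.sumSplit₃ (fun U U' a b c => F U U' a b (c.append (cons p x t)))
          + t.sumSplit₃ (fun U U' a b c => F U U' (s.append (cons p x a)) b c)) := by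
  simp only [sumSplit₃, sumSplit_append_cons, sumSplit_add]
  abel

variable [∀ X Y p, AddCommGroup (V X Y p)]

theorem IsMultilinear.sumSplit {X Z : Ob} {F : ∀ Y : Ob, Str V X Y → Str V Y Z → R}
    (h₁ : ∀ Y b, IsMultilinear (fun a => F Y a b)) (h₂ : ∀ Y a, IsMultilinear (fun b => F Y a b)) :
    IsMultilinear (fun s : Str V X Z => s.sumSplit F) := by
  intro U W a p x x' b
  have e₁ : ∀ Y (s : Str V X Y) (t : Str V Y U), F Y s (t.append (cons p (x + x') b))
      = F Y s (t.append (cons p x b)) + F Y s (t.append (cons p x' b)) :=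
    fun Y s t => h₂ Y s _ _ t p x x' b
  have e₂ : ∀ Y (s : Str V W Y) (t : Str V Y Z), F Y (a.append (cons p (x + x') s)) t
      = F Y (a.append (cons p x s)) t + F Y (a.append (cons p x' s)) t :=
    fun Y s t => h₁ Y t _ _ a p x x' s
  simp only [sumSplit_append_cons, e₁, e₂, sumSplit_add]
  abel

theorem IsMultilinear.add {X Y : Ob} {F G : Str V X Y → R} (hF : IsMultilinear F)
    (hG : IsMultilinear G) : IsMultilinear (fun s => F s + G s) := by
  intro U W a p x x' b
  have h₁ := hF U W a p x x' b
  have h₂ := hG U W a p x x' b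
  simp only at h₁ h₂ ⊢
  rw [h₁, h₂]
  abel

theorem IsMultilinear.appendRight {X Y Z : Ob} {G : Str V X Z → R} (hG : IsMultilinear G)
    (t : Str V Y Z) : IsMultilinear (fun s : Str V X Y => G (s.append t)) := by
  intro U W a p x x' b
  simpa using hG U W a p x x' (b.append t)

theorem IsMultilinear.appendLeft {X Y Z : Ob} {G : Str V X Z → R} (hG : IsMultilinear G)
    (t : Str V X Y) : IsMultilinear (fun s : Str V Y Z => G (t.append s)) := by
  intro U W a p x x' b
  simpa using hG U W (t.append a) p x x' b

theorem IsMultilinear.cons {X Y Z : Ob} {G : Str V X Z → R} (hG : IsMultilinear G)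
    (p : ℤ) (x : V X Y p) : IsMultilinear (fun s : Str V Y Z => G (cons p x s)) :=
  hG.appendLeft (Str.cons p x (nil Y))

theorem IsMultilinear.sumSplit₃ {X Z : Ob}
    {F : ∀ Y Y' : Ob, Str V X Y → Str V Y Y' → Str V Y' Z → R}
    (h₁ : ∀ Y Y' b c, IsMultilinear (fun a => F Y Y' a b c))
    (h₂ : ∀ Y Y' a c, IsMultilinear (fun b => F Y Y' a b c))
    (h₃ : ∀ Y Y' a b, IsMultilinear (fun c => F Y Y' a b c)) :
    IsMultilinear (fun s : Str V X Z => s.sumSplit₃ F) := by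
  refine IsMultilinear.sumSplit (fun Y r => ?_) (fun Y a => ?_)
  · intro U W a p x x' b
    have := fun Y' b' c => h₁ Y Y' b' c U W a p x x' b
    simp only at this ⊢
    simp only [this, sumSplit_add]
  · exact IsMultilinear.sumSplit (fun Y' c => h₂ Y Y' a c) (fun Y' b => h₃ Y Y' a b)

theorem IsMultilinear.map_cons_zero {R : Type w} [AddCommGroup R] {X Y : Ob} {G : Str V X Y → R}
    (hG : IsMultilinear G) {U W : Ob} (a : Str V X U) (p : ℤ) (b : Str V W Y) :
    G (a.append (Str.cons p (0 : V U W p) b)) = 0 := by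
  have h := hG U W a p 0 0 b
  rwa [add_zero, left_eq_add] at h

end Basic

section Map

variable {Ob : Type u} {V : Ob → Ob → ℤ → Type v} {R : Type w}

/-- A string in the `j`-fold suspension `V[j]`, `V[j]_p = V_{p+j}`, regarded as a string in `V`. -/
def unshift (j : ℤ) {X Y : Ob} : Str (fun X Y p => V X Y (p + j)) X Y → Str V X Y
  | nil X => nil X
  | cons p x s => cons (p + j) x (unshift j s)

@[simp] theorem unshift_nil (j : ℤ) {X : Ob} :
    unshift j (nil X : Str (fun X Y p => V X Y (p + j)) X X) = nil X := rfl

@[simp] theorem unshift_cons (j : ℤ) {X Y Z : Ob} (p : ℤ) (x : V X Y (p + j))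
    (s : Str (fun X Y p => V X Y (p + j)) Y Z) :
    unshift j (cons p x s) = cons (p + j) x (unshift j s) := rfl

@[simp] theorem unshift_append (j : ℤ) {X Y Z : Ob} (s : Str (fun X Y p => V X Y (p + j)) X Y)
    (t : Str (fun X Y p => V X Y (p + j)) Y Z) :
    unshift j (s.append t) = (unshift j s).append (unshift j t) := by
  induction s with
  | nil => rfl
  | cons p x s ih => simp [ih]

@[simp] theorem rdeg_unshift (j N : ℤ) {X Y : Ob} (s : Str (fun X Y p => V X Y (p + j)) X Y) :
    (unshift j s).rdeg N = s.rdeg (N - j) := by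
  induction s with
  | nil => rfl
  | cons p x s ih =>
    simp only [unshift_cons, rdeg_cons, ih]
    ring

theorem sumSplit_unshift [AddCommMonoid R] (j : ℤ) {X Z : Ob}
    (s : Str (fun X Y p => V X Y (p + j)) X Z) (F : ∀ Y : Ob, Str V X Y → Str V Y Z → R) :
    (unshift j s).sumSplit F = s.sumSplit (fun Y a b => F Y (unshift j a) (unshift j b)) := by
  induction s with
  | nil => rfl
  | cons p x s ih => simp [ih]

theorem sumSplit₃_unshift [AddCommMonoid R] (j : ℤ) {X Z : Ob}
    (s : Str (fun X Y p => V X Y (p + j)) X Z)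
    (F : ∀ Y Y' : Ob, Str V X Y → Str V Y Y' → Str V Y' Z → R) :
    (unshift j s).sumSplit₃ F
      = s.sumSplit₃ (fun Y Y' a b c => F Y Y' (unshift j a) (unshift j b) (unshift j c)) := by
  simp only [sumSplit₃, sumSplit_unshift]

theorem IsMultilinear.unshift [∀ X Y p, AddCommGroup (V X Y p)] [AddCommMonoid R] (j : ℤ)
    {X Y : Ob} {G : Str V X Y → R} (hG : IsMultilinear G) :
    IsMultilinear (fun s : Str (fun X Y p => V X Y (p + j)) X Y => G (Str.unshift j s)) := by
  intro U W a p x x' b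
  simpa using hG U W (Str.unshift j a) (p + j) x x' (Str.unshift j b)

theorem consAt_unshift (j : ℤ) {X Y Z : Ob} {d d' : ℤ} (h : d + j = d') (f : ∀ q, V X Y q)
    (s : Str (fun X Y p => V X Y (p + j)) Y Z) :
    unshift j (consAt (V := fun X Y p => V X Y (p + j)) d (fun q => f (q + j)) s)
      = consAt d' f (unshift j s) := by
  subst h; rfl

end Map

section Blocks

variable {Ob : Type u} {Ob' : Type u'} {V : Ob → Ob → ℤ → Type v} {V' : Ob' → Ob' → ℤ → Type v'}
  {R : Type w} [AddCommMonoid R]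

/-- Auxiliary to `sumBlocks`: the sum over all ways to cut `c ⊗ s` into consecutive blocks,
the first of which starts with the nonempty string `c`. -/
def sumBlocksAux (N N' : ℤ) (o : Ob → Ob')
    (f : ∀ X Y : Ob, Str V X Y → ∀ q : ℤ, V' (o X) (o Y) q) {X Y Z : Ob} :
    (s : Str V Y Z) → (c : Str V X Y) → (Str V' (o X) (o Z) → R) → R
  | nil _, c, G => G (consAt (c.rdeg N - 1 + N') (f _ _ c) (nil _))
  | cons p x s, c, G =>
    sumBlocksAux N N' o f s (c.append (cons p x (nil _))) G
      + sumBlocksAux N N' o f s (cons p x (nil _))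
          (fun r => G (consAt (c.rdeg N - 1 + N') (f _ _ c) r))

/-- Sum of `G (f(b₁) ⊗ ⋯ ⊗ f(b_r))` over all ways to cut the string `s` into consecutive nonempty
blocks `s = b₁ ⊗ ⋯ ⊗ b_r`, where each `f(b)` is taken in degree `|b| + k (1 - N) - 1 + N'`, `k` being
the length of `b`. -/
def sumBlocks (N N' : ℤ) (o : Ob → Ob')
    (f : ∀ X Y : Ob, Str V X Y → ∀ q : ℤ, V' (o X) (o Y) q) {X Y : Ob} :
    (s : Str V X Y) → (Str V' (o X) (o Y) → R) → R
  | nil X, G => G (nil (o X))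
  | cons p x s, G => sumBlocksAux N N' o f s (cons p x (nil _)) G

variable (N N' : ℤ) (o : Ob → Ob') (f : ∀ X Y : Ob, Str V X Y → ∀ q : ℤ, V' (o X) (o Y) q)

theorem sumBlocksAux_eq {X Y Z : Ob} (s : Str V Y Z) (c : Str V X Y)
    (G : Str V' (o X) (o Z) → R) :
    sumBlocksAux N N' o f s c G = s.sumSplit (fun _ a b => sumBlocks N N' o f b
      (fun r => G (consAt ((c.append a).rdeg N - 1 + N') (f _ _ (c.append a)) r))) := by
  induction s generalizing X with
  | nil => simp [sumBlocksAux, sumBlocks]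
  | cons p x s ih =>
    simp only [sumBlocksAux, sumSplit_cons, append_nil]
    rw [ih, add_comm]
    simp [sumBlocks]

theorem sumBlocks_nil {X : Ob} (G : Str V' (o X) (o X) → R) :
    sumBlocks N N' o f (nil X) G = G (nil (o X)) := rfl

theorem sumBlocks_cons {X Y Z : Ob} (p : ℤ) (x : V X Y p) (s : Str V Y Z)
    (G : Str V' (o X) (o Z) → R) :
    sumBlocks N N' o f (cons p x s) G = s.sumSplit (fun _ a b => sumBlocks N N' o f b
      (fun r => G (consAt ((cons p x a).rdeg N - 1 + N') (f _ _ (cons p x a)) r))) :=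
  sumBlocksAux_eq N N' o f s _ G

theorem strInduction {motive : ∀ X Y : Ob, Str V X Y → Prop}
    (nil : ∀ X, motive X X (nil X))
    (cons : ∀ X Y Z p (x : V X Y p) (s : Str V Y Z),
      (∀ W (a : Str V Y W) (b : Str V W Z), a.append b = s → motive W Z b) →
      motive X Z (cons p x s)) {X Y : Ob} (s : Str V X Y) : motive X Y s := by
  generalize hn : s.length = n
  induction n using Nat.strong_induction_on generalizing X Y with
  | _ n ih =>
    cases s with
    | nil => exact nil _
    | cons p x s =>
      refine cons _ _ _ p x s fun W a b hab => ih b.length ?_ b rfl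
      subst hab; subst hn; simp

theorem sumBlocks_congr {X Y : Ob} (s : Str V X Y) {G G' : Str V' (o X) (o Y) → R}
    (h : ∀ r, r.rdeg N' = s.rdeg N → G r = G' r) :
    sumBlocks N N' o f s G = sumBlocks N N' o f s G' := by
  induction s using strInduction with
  | nil X => exact h _ rfl
  | cons X Y Z p x s ih =>
    simp only [sumBlocks_cons]
    refine sumSplit_congr _ fun W a b hab => ih W a b hab fun r hr => h _ ?_
    subst hab; simp [hr, add_assoc]

theorem sumBlocks_zero {X Y : Ob} (s : Str V X Y) :
    sumBlocks N N' o f s (fun _ => (0 : R)) = 0 := by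
  induction s using strInduction with
  | nil X => rfl
  | cons X Y Z p x s ih =>
    rw [sumBlocks_cons]
    exact (sumSplit_congr _ fun W a b hab => ih W a b hab).trans (sumSplit_zero s)

theorem sumBlocks_add {X Y : Ob} (s : Str V X Y) (G G' : Str V' (o X) (o Y) → R) :
    sumBlocks N N' o f s (fun r => G r + G' r)
      = sumBlocks N N' o f s G + sumBlocks N N' o f s G' := by
  induction s using strInduction with
  | nil X => rfl
  | cons X Y Z p x s ih =>
    simp only [sumBlocks_cons]
    rw [← sumSplit_add]
    exact sumSplit_congr _ fun W a b hab => ih W a b hab _ _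

theorem map_sumBlocks {S : Type w'} [AddCommMonoid S] (φ : R →+ S) {X Y : Ob} (s : Str V X Y)
    (G : Str V' (o X) (o Y) → R) :
    φ (sumBlocks N N' o f s G) = sumBlocks N N' o f s (fun r => φ (G r)) := by
  induction s using strInduction with
  | nil X => rfl
  | cons X Y Z p x s ih =>
    simp only [sumBlocks_cons, map_sumSplit]
    exact sumSplit_congr _ fun W a b hab => ih W a b hab _

/-- `G` may itself be a sum over another string. -/
theorem sumBlocks_sumSplit {Ob₂ : Type w''} {V₂ : Ob₂ → Ob₂ → ℤ → Type v₂} {X Y : Ob} {X₂ Y₂ : Ob₂}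
    (s : Str V X Y) (t : Str V₂ X₂ Y₂)
    (G : Str V' (o X) (o Y) → ∀ W, Str V₂ X₂ W → Str V₂ W Y₂ → R) :
    sumBlocks N N' o f s (fun r => t.sumSplit (G r))
      = t.sumSplit (fun W a b => sumBlocks N N' o f s (fun r => G r W a b)) := by
  induction s using strInduction with
  | nil X => rfl
  | cons X Y Z p x s ih =>
    simp only [sumBlocks_cons]
    rw [← sumSplit_comm]
    exact sumSplit_congr _ fun W a b hab => ih W a b hab _

theorem sumBlocks_comm {X Y X₂ Y₂ : Ob} (s : Str V X Y) (t : Str V X₂ Y₂)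
    (G : Str V' (o X) (o Y) → Str V' (o X₂) (o Y₂) → R) :
    sumBlocks N N' o f s (fun r => sumBlocks N N' o f t (fun r' => G r r'))
      = sumBlocks N N' o f t (fun r' => sumBlocks N N' o f s (fun r => G r r')) := by
  induction s using strInduction with
  | nil X => rfl
  | cons X Y Z p x s ih =>
    simp only [sumBlocks_cons]
    rw [sumBlocks_sumSplit]
    exact sumSplit_congr _ fun W a b hab => ih W a b hab _

theorem sumBlocks_split {X Z : Ob} (s : Str V X Z)
    (G : ∀ Y' : Ob', Str V' (o X) Y' → Str V' Y' (o Z) → R) :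
    sumBlocks N N' o f s (fun r => r.sumSplit G)
      = s.sumSplit (fun Y a b => sumBlocks N N' o f a
          (fun a' => sumBlocks N N' o f b (fun b' => G (o Y) a' b'))) := by
  induction s using strInduction with
  | nil X => rfl
  | cons X Y Z p x s ih =>
    simp only [sumBlocks_cons, sumSplit_cons, consAt, sumBlocks_add, sumSplit_add, sumBlocks_nil]
    congr 1
    rw [sumSplit_congr s fun W a b hab => ih W a b hab _]
    exact (sumSplit_assoc s fun U U' a b c => sumBlocks N N' o f b fun a' =>
      sumBlocks N N' o f c fun b' =>
        G (o U') (Str.cons _ (f _ _ (Str.cons p x a) ((Str.cons p x a).rdeg N - 1 + N')) a') b').symm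

theorem sumBlocks_append_cons {X Y Y₁ Z : Ob} (s : Str V X Y) (p : ℤ) (x : V Y Y₁ p)
    (t : Str V Y₁ Z) (G : Str V' (o X) (o Z) → R) :
    sumBlocks N N' o f (s.append (cons p x t)) G
      = s.sumSplit (fun _ a b => t.sumSplit (fun _ c d => sumBlocks N N' o f a (fun a' =>
          sumBlocks N N' o f d (fun d' => G (a'.append
            (consAt ((b.append (cons p x c)).rdeg N - 1 + N')
              (f _ _ (b.append (cons p x c))) d')))))) := by
  induction s using strInduction with
  | nil X => rw [nil_append, sumBlocks_cons]; rfl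
  | cons X Y Z p' x' s ih =>
    simp only [cons_append, sumBlocks_cons, sumSplit_append_cons, sumSplit_cons]
    rw [add_comm]
    congr 1
    rw [sumSplit_congr s fun W a b hab => ih W a b hab _ _]
    rw [show (s.sumSplit fun W a b => t.sumSplit fun W' c d => a.sumSplit fun U a₁ a₂ =>
        sumBlocks N N' o f a₂ (fun r => sumBlocks N N' o f d (fun d' => G ((consAt
          ((cons p' x' a₁).rdeg N - 1 + N') (f _ _ (cons p' x' a₁)) r).append
            (consAt ((b.append (cons p x c)).rdeg N - 1 + N')
              (f _ _ (b.append (cons p x c))) d')))))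
        = s.sumSplit fun W a b => a.sumSplit fun U a₁ a₂ => t.sumSplit fun W' c d =>
        sumBlocks N N' o f a₂ (fun r => sumBlocks N N' o f d (fun d' => G ((consAt
          ((cons p' x' a₁).rdeg N - 1 + N') (f _ _ (cons p' x' a₁)) r).append
            (consAt ((b.append (cons p x c)).rdeg N - 1 + N')
              (f _ _ (b.append (cons p x c))) d')))) from
      sumSplit_congr _ fun W a b _ => sumSplit_comm _ _ _]
    rw [sumSplit_assoc s fun U U' a b c => t.sumSplit fun W' c' d =>
        sumBlocks N N' o f b (fun r => sumBlocks N N' o f d (fun d' => G ((consAt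
          ((cons p' x' a).rdeg N - 1 + N') (f _ _ (cons p' x' a)) r).append
            (consAt ((c.append (cons p x c')).rdeg N - 1 + N')
              (f _ _ (c.append (cons p x c'))) d'))))]
    rfl

variable [∀ X Y p, AddCommGroup (V X Y p)] [∀ X Y p, AddCommGroup (V' X Y p)]

/-- Replacing an entry by a sum of two families. -/
theorem IsMultilinear.map_consAt_add {X X' X'' Y : Ob'} {G : Str V' X Y → R}
    (hG : IsMultilinear G) (a : Str V' X X') (d : ℤ) (g g' : ∀ q, V' X' X'' q)
    (b : Str V' X'' Y) :
    G (a.append (Str.consAt d (g + g') b))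
      = G (a.append (Str.consAt d g b)) + G (a.append (Str.consAt d g' b)) :=
  hG _ _ a d (g d) (g' d) b

theorem IsMultilinear.sumBlocks {X Y : Ob} {G : Str V' (o X) (o Y) → R} (hG : IsMultilinear G)
    (hf : ∀ X Y, IsMultilinear (f X Y)) :
    IsMultilinear (fun s : Str V X Y => Str.sumBlocks N N' o f s G) := by
  intro U W a p x x' b
  have key : ∀ (U' W' : Ob) (a' : Str V' (o X) (o U')) (c : Str V U' U) (d : Str V W W')
      (d' : Str V' (o W') (o Y)) (e : ℤ),
      G (a'.append (Str.consAt e (f _ _ (c.append (Str.cons p (x + x') d))) d'))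
        = G (a'.append (Str.consAt e (f _ _ (c.append (Str.cons p x d))) d'))
          + G (a'.append (Str.consAt e (f _ _ (c.append (Str.cons p x' d))) d')) := by
    intro U' W' a' c d d' e
    rw [hf _ _ _ _ c p x x' d, hG.map_consAt_add]
  simp only [sumBlocks_append_cons, rdeg_append, rdeg_cons, key, sumBlocks_add, sumSplit_add]

end Blocks

end Str

open Str

/-! ## A-infinity categories and functors -/

/-- An `A_∞`-category of degree `N` (homological conventions, over `ZMod 2`). The map
`μ_k : A(X₀,X₁) ⊗ ⋯ ⊗ A(X_{k-1},X_k) → A(X₀,X_k)`, `k ≥ 1`, of degree `-2 + k (1 - N) + N` is the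
restriction of `μ` to strings of length `k`; on the empty string `μ` is `0`. -/
structure AInfCat where
  Ob : Type u
  Hom : Ob → Ob → ℤ → Type v
  [grp : ∀ X Y p, AddCommGroup (Hom X Y p)]
  [mod : ∀ X Y p, Module (ZMod 2) (Hom X Y p)]
  N : ℤ
  μ : ∀ {X Y : Ob}, Str Hom X Y → ∀ q : ℤ, Hom X Y q
  μ_nil : ∀ X q, μ (nil X) q = 0
  μ_multilinear : ∀ X Y q, IsMultilinear (fun s : Str Hom X Y => μ s q)
  μ_degree : ∀ {X Y} (s : Str Hom X Y) (q : ℤ), q ≠ s.rdeg N - 2 + N → μ s q = 0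
  rel : ∀ {X Y} (s : Str Hom X Y) (q : ℤ),
    s.sumSplit₃ (fun _ _ a b c => μ (a.append (consAt (b.rdeg N - 2 + N) (μ b) c)) q) = 0

attribute [instance] AInfCat.grp AInfCat.mod

namespace AInfCat

variable (A : AInfCat.{u, v}) {R : Type w} [AddCommMonoid R]

/-- Sum of `G (x₁ ⊗ ⋯ ⊗ μ(x_{i+1}, …, x_j) ⊗ ⋯ ⊗ x_k)` over all consecutive substrings. -/
def bar {X Y : A.Ob} (s : Str A.Hom X Y) (G : Str A.Hom X Y → R) : R :=
  s.sumSplit₃ fun _ _ a b c => G (a.append (consAt (b.rdeg A.N - 2 + A.N) (A.μ b) c))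

theorem map_bar {S : Type w'} [AddCommMonoid S] (φ : R →+ S) {X Y : A.Ob} (s : Str A.Hom X Y)
    (G : Str A.Hom X Y → R) : φ (A.bar s G) = A.bar s (fun r => φ (G r)) :=
  map_sumSplit₃ φ s _

theorem bar_add {X Y : A.Ob} (s : Str A.Hom X Y) (G G' : Str A.Hom X Y → R) :
    A.bar s (fun r => G r + G' r) = A.bar s G + A.bar s G' :=
  sumSplit₃_add s _ _

theorem bar_congr {X Y : A.Ob} (s : Str A.Hom X Y) {G G' : Str A.Hom X Y → R}
    (h : ∀ r, r.rdeg A.N = s.rdeg A.N - 1 → G r = G' r) : A.bar s G = A.bar s G' := by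
  refine sumSplit₃_congr s fun Y Y' a b c hs => h _ ?_
  subst hs; simp; ring

theorem bar_eq_zero {X Y : A.Ob} (s : Str A.Hom X Y) {G : Str A.Hom X Y → R}
    (h : ∀ r, r.rdeg A.N = s.rdeg A.N - 1 → G r = 0) : A.bar s G = 0 :=
  (A.bar_congr s h).trans (sumSplit₃_zero s)

theorem bar_multilinear {X Y : A.Ob} {G : Str A.Hom X Y → R} (hG : IsMultilinear G) :
    IsMultilinear (fun s => A.bar s G) := by
  refine IsMultilinear.sumSplit₃ (fun Y Y' b c => ?_) (fun Y Y' a c => ?_) (fun Y Y' a b => ?_)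
  · exact hG.appendRight _
  · intro U W a' p x x' b'
    have h : A.μ (a'.append (cons p (x + x') b'))
        = A.μ (a'.append (cons p x b')) + A.μ (a'.append (cons p x' b')) :=
      funext fun q => A.μ_multilinear _ _ q _ _ a' p x x' b'
    simp only [rdeg_append, rdeg_cons, h]
    exact hG.map_consAt_add a _ _ _ c
  · exact (hG.appendLeft a).cons (b.rdeg A.N - 2 + A.N) (A.μ b _)

theorem bar_nil {R : Type w} [AddCommGroup R] {X : A.Ob} {G : Str A.Hom X X → R}
    (hG : IsMultilinear G) : A.bar (nil X) G = 0 := by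
  have h : A.μ (nil X : Str A.Hom X X) = 0 := funext fun q => A.μ_nil X q
  change G ((nil X).append (cons _ (A.μ (nil X) _) (nil X))) = 0
  rw [h]
  exact hG.map_cons_zero _ _ _

theorem bar_single {R : Type w} [AddCommGroup R] {X Y : A.Ob} (p : ℤ) (x : A.Hom X Y p)
    {G : Str A.Hom X Y → R} (hG : IsMultilinear G) :
    A.bar (cons p x (nil Y)) G = G (cons (p - 1) (A.μ (cons p x (nil Y)) (p - 1)) (nil Y)) := by
  have h : ∀ X, A.μ (nil X : Str A.Hom X X) = 0 := fun X => funext fun q => A.μ_nil X q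
  have h₁ := hG.map_cons_zero (nil X) ((nil X : Str A.Hom X X).rdeg A.N - 2 + A.N) (cons p x (nil Y))
  have h₂ := hG.map_cons_zero (cons p x (nil Y)) ((nil Y : Str A.Hom Y Y).rdeg A.N - 2 + A.N) (nil Y)
  simp only [bar, sumSplit₃, sumSplit_cons, sumSplit_nil, h]
  rw [show (cons p x (nil Y)).rdeg A.N - 2 + A.N = p - 1 by simp; ring]
  refine (congrArg₂ _ (congrArg₂ _ h₁ rfl) h₂).trans ?_
  rw [add_zero, zero_add]; rfl

/-- The `j`-fold suspension `A[j]`, an `A_∞`-category of degree `N - j`. -/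
@[reducible] def susp (j : ℤ) : AInfCat.{u, v} where
  Ob := A.Ob
  Hom := fun X Y p => A.Hom X Y (p + j)
  N := A.N - j
  μ := fun s q => A.μ (unshift j s) (q + j)
  μ_nil := fun X q => A.μ_nil X _
  μ_multilinear := fun X Y q => (A.μ_multilinear X Y (q + j)).unshift j
  μ_degree := fun s q h => A.μ_degree _ _ (by rw [rdeg_unshift]; omega)
  rel := fun s q => by
    rw [← A.rel (unshift j s) (q + j), sumSplit₃_unshift]
    refine sumSplit₃_congr s fun Y Y' a b c _ => ?_
    rw [unshift_append, ← consAt_unshift j (d := b.rdeg (A.N - j) - 2 + (A.N - j))]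
    rw [rdeg_unshift]; ring

end AInfCat

/-- An `A_∞`-functor: the maps `F_k`, `k ≥ 1`, of degree `-1 + k (1 - N_A) + N_B` are the restriction
of `map` to strings of length `k`; on the empty string `map` is `0`. -/
structure AInfFunctor (A : AInfCat.{u, v}) (B : AInfCat.{u', v'}) where
  obj : A.Ob → B.Ob
  map : ∀ (X Y : A.Ob), Str A.Hom X Y → ∀ q : ℤ, B.Hom (obj X) (obj Y) q
  map_nil : ∀ X q, map X X (nil X) q = 0
  map_multilinear : ∀ X Y q, IsMultilinear (fun s : Str A.Hom X Y => map X Y s q)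
  map_degree : ∀ {X Y} (s : Str A.Hom X Y) (q : ℤ), q ≠ s.rdeg A.N - 1 + B.N → map X Y s q = 0
  rel : ∀ {X Y} (s : Str A.Hom X Y) (q : ℤ),
    sumBlocks A.N B.N obj map s (fun r => B.μ r q) = A.bar s (fun r => map X Y r q)

namespace AInfFunctor

variable {A : AInfCat.{u, v}} {B : AInfCat.{u', v'}} (F : AInfFunctor A B) {R : Type w}
  [AddCommMonoid R]

/-- Sum of `G (F(b₁) ⊗ ⋯ ⊗ F(b_r))` over all ways to cut `s` into nonempty blocks. -/
def blocks {X Y : A.Ob} (s : Str A.Hom X Y) (G : Str B.Hom (F.obj X) (F.obj Y) → R) : R :=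
  sumBlocks A.N B.N F.obj F.map s G

theorem blocks_multilinear {X Y : A.Ob} {G : Str B.Hom (F.obj X) (F.obj Y) → R}
    (hG : IsMultilinear G) : IsMultilinear (fun s => F.blocks s G) :=
  hG.sumBlocks _ _ _ _ fun X Y U W a p x x' b =>
    funext fun q => F.map_multilinear X Y q U W a p x x' b

theorem blocks_congr {X Y : A.Ob} (s : Str A.Hom X Y) {G G' : Str B.Hom (F.obj X) (F.obj Y) → R}
    (h : ∀ r, r.rdeg B.N = s.rdeg A.N → G r = G' r) : F.blocks s G = F.blocks s G' :=
  sumBlocks_congr _ _ _ _ s h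

theorem blocks_add {X Y : A.Ob} (s : Str A.Hom X Y) (G G' : Str B.Hom (F.obj X) (F.obj Y) → R) :
    F.blocks s (fun r => G r + G' r) = F.blocks s G + F.blocks s G' :=
  sumBlocks_add _ _ _ _ s G G'

theorem blocks_zero {X Y : A.Ob} (s : Str A.Hom X Y) : F.blocks s (fun _ => (0 : R)) = 0 :=
  sumBlocks_zero _ _ _ _ s

theorem map_blocks {S : Type w'} [AddCommMonoid S] (φ : R →+ S) {X Y : A.Ob} (s : Str A.Hom X Y)
    (G : Str B.Hom (F.obj X) (F.obj Y) → R) :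
    φ (F.blocks s G) = F.blocks s (fun r => φ (G r)) :=
  map_sumBlocks _ _ _ _ φ s G

theorem blocks_comm {X Y X' Y' : A.Ob} (s : Str A.Hom X Y) (t : Str A.Hom X' Y')
    (G : Str B.Hom (F.obj X) (F.obj Y) → Str B.Hom (F.obj X') (F.obj Y') → R) :
    F.blocks s (fun r => F.blocks t (fun r' => G r r'))
      = F.blocks t (fun r' => F.blocks s (fun r => G r r')) :=
  sumBlocks_comm _ _ _ _ s t G

/-- The induced map on strings is compatible with the differentials of the bar constructions. -/
theorem blocks_bar {R : Type w} [AddCommGroup R] {X Y : A.Ob} (s : Str A.Hom X Y)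
    {G : Str B.Hom (F.obj X) (F.obj Y) → R} (hG : IsMultilinear G) :
    F.blocks s (fun r => B.bar r G) = A.bar s (fun r => F.blocks r G) := by
  have slot : ∀ (U W : A.Ob) (a : Str B.Hom (F.obj X) (F.obj U)) (m : Str A.Hom U W)
      (c : Str B.Hom (F.obj W) (F.obj Y)),
      F.blocks m (fun m' => G (a.append (consAt (m'.rdeg B.N - 2 + B.N) (B.μ m') c)))
        = A.bar m (fun m' => G (a.append (consAt (m'.rdeg A.N - 1 + B.N) (F.map _ _ m') c))) := by
    intro U W a m c
    let φ : B.Hom (F.obj U) (F.obj W) (m.rdeg A.N - 2 + B.N) →+ R :=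
      AddMonoidHom.mk' (fun g => G (a.append (cons _ g c)))
        (fun g g' => hG _ _ a _ g g' c)
    calc _ = F.blocks m (fun m' => φ (B.μ m' _)) := F.blocks_congr m fun r hr => by
            rw [hr]; rfl
      _ = A.bar m (fun m' => φ (F.map _ _ m' _)) := by
            rw [← map_blocks, ← A.map_bar]; exact congrArg φ (F.rel m _)
      _ = _ := A.bar_congr m fun r hr => by
            rw [hr, show m.rdeg A.N - 1 - 1 + B.N = m.rdeg A.N - 2 + B.N by ring]; rfl
  -- both sides are sums over all ways to cut `s` into five pieces
  let H : ∀ U₁ U₂ U₃ U₄ : A.Ob, Str A.Hom X U₁ → Str A.Hom U₁ U₂ → Str A.Hom U₂ U₃ →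
      Str A.Hom U₃ U₄ → Str A.Hom U₄ Y → R := fun U₁ U₂ U₃ U₄ a m₁ m₂ m₃ c =>
    F.blocks a fun a' => F.blocks c fun c' => G (a'.append
      (consAt ((m₁.append (consAt (m₂.rdeg A.N - 2 + A.N) (A.μ m₂) m₃)).rdeg A.N - 1 + B.N)
        (F.map _ _ (m₁.append (consAt (m₂.rdeg A.N - 2 + A.N) (A.μ m₂) m₃))) c'))
  have hL : F.blocks s (fun r => B.bar r G) = s.sumSplit fun U₁ a r => r.sumSplit fun U₄ m c =>
      m.sumSplit fun U₂ m₁ r' => r'.sumSplit fun U₃ m₂ m₃ => H U₁ U₂ U₃ U₄ a m₁ m₂ m₃ c := by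
    unfold AInfCat.bar sumSplit₃ blocks
    rw [sumBlocks_split]
    refine sumSplit_congr _ fun U₁ a r _ => ?_
    simp only [sumBlocks_split]
    rw [sumBlocks_sumSplit]
    refine sumSplit_congr _ fun U₄ m c _ => ?_
    have h₁ : ∀ a' : Str B.Hom (F.obj X) (F.obj U₁),
        (sumBlocks A.N B.N F.obj F.map m fun m' => sumBlocks A.N B.N F.obj F.map c fun c' =>
          G (a'.append (consAt (m'.rdeg B.N - 2 + B.N) (B.μ m') c')))
        = m.sumSplit₃ fun U₂ U₃ m₁ m₂ m₃ => F.blocks c fun c' => G (a'.append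
          (consAt ((m₁.append (consAt (m₂.rdeg A.N - 2 + A.N) (A.μ m₂) m₃)).rdeg A.N - 1 + B.N)
          (F.map _ _ (m₁.append (consAt (m₂.rdeg A.N - 2 + A.N) (A.μ m₂) m₃))) c')) := by
      intro a'
      rw [sumBlocks_comm]
      refine (congrArg _ (funext fun c' => slot _ _ a' m c')).trans ?_
      simp only [AInfCat.bar, sumSplit₃, sumBlocks_sumSplit]
      rfl
    simp only [h₁, sumSplit₃, sumBlocks_sumSplit]
    rfl
  have hR : A.bar s (fun r => F.blocks r G) = s.sumSplit fun V a r => r.sumSplit fun V' b c =>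
      a.sumSplit fun U₁ a m₁ => c.sumSplit fun U₄ m₃ c => H U₁ V V' U₄ a m₁ b m₃ c := by
    unfold AInfCat.bar sumSplit₃ blocks
    refine sumSplit_congr _ fun V a r _ => sumSplit_congr _ fun V' b c _ => ?_
    exact sumBlocks_append_cons _ _ _ _ _ _ _ _ _
  rw [hL, hR]
  have e₁ : ∀ (U₁ : A.Ob) (a : Str A.Hom X U₁) (r : Str A.Hom U₁ Y),
      (r.sumSplit fun U₄ m c => m.sumSplit fun U₂ m₁ r' => r'.sumSplit fun U₃ m₂ m₃ =>
        H U₁ U₂ U₃ U₄ a m₁ m₂ m₃ c)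
      = r.sumSplit fun U₂ m₁ r => r.sumSplit fun U₃ m₂ r => r.sumSplit fun U₄ m₃ c =>
        H U₁ U₂ U₃ U₄ a m₁ m₂ m₃ c := by
    intro U₁ a r
    refine (sumSplit_assoc r fun U₂ U₄ m₁ r' c => r'.sumSplit fun U₃ m₂ m₃ =>
      H U₁ U₂ U₃ U₄ a m₁ m₂ m₃ c).trans ?_
    refine sumSplit_congr _ fun U₂ m₁ r' _ => ?_
    exact sumSplit_assoc r' fun U₃ U₄ m₂ m₃ c => H U₁ U₂ U₃ U₄ a m₁ m₂ m₃ c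
  simp only [e₁]
  have e₂ : ∀ (V : A.Ob) (a : Str A.Hom X V) (r : Str A.Hom V Y),
      (r.sumSplit fun V' b c => a.sumSplit fun U₁ a m₁ => c.sumSplit fun U₄ m₃ c =>
        H U₁ V V' U₄ a m₁ b m₃ c)
      = a.sumSplit fun U₁ a m₁ => r.sumSplit fun V' b c => c.sumSplit fun U₄ m₃ c =>
        H U₁ V V' U₄ a m₁ b m₃ c :=
    fun V a r => sumSplit_comm _ _ _
  simp only [e₂]
  exact (sumSplit_assoc s fun U₁ U₂ a m₁ r => r.sumSplit fun V' b c => c.sumSplit fun U₄ m₃ c =>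
    H U₁ U₂ V' U₄ a m₁ b m₃ c).symm

end AInfFunctor

/-! ## Bimodules and pre-morphisms -/

/-- Families of multilinear maps of degree `g`
`A(X₀,…,X_k) ⊗ V(X_k,Y_m) ⊗ B(Y_m,…,Y₀) → W(X₀,Y₀)`, `k, m ≥ 0`, meaning that
the `(k,m)` map has degree `g + k (1 - N_A) + m (1 - N_B)`. -/
structure Multi (A : AInfCat.{u, v}) (B : AInfCat.{u', v'}) (V : A.Ob → B.Ob → ℤ → Type w)
    (W : A.Ob → B.Ob → ℤ → Type w') [∀ X Y p, AddCommGroup (V X Y p)]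
    [∀ X Y p, AddCommGroup (W X Y p)] (g : ℤ) where
  app : ∀ {X X' : A.Ob} {Y' Y : B.Ob}, Str A.Hom X X' → ∀ p : ℤ, V X' Y' p → Str B.Hom Y' Y →
    ∀ q : ℤ, W X Y q
  left : ∀ {X X' Y' Y} (p : ℤ) (v : V X' Y' p) (t : Str B.Hom Y' Y) (q : ℤ),
    IsMultilinear (fun s : Str A.Hom X X' => app s p v t q)
  mid : ∀ {X X' Y' Y} (s : Str A.Hom X X') (p : ℤ) (v v' : V X' Y' p) (t : Str B.Hom Y' Y) (q : ℤ),
    app s p (v + v') t q = app s p v t q + app s p v' t q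
  right : ∀ {X X' Y' Y} (s : Str A.Hom X X') (p : ℤ) (v : V X' Y' p) (q : ℤ),
    IsMultilinear (fun t : Str B.Hom Y' Y => app s p v t q)
  degree : ∀ {X X' Y' Y} (s : Str A.Hom X X') (p : ℤ) (v : V X' Y' p) (t : Str B.Hom Y' Y) (q : ℤ),
    q ≠ s.rdeg A.N + p + t.rdeg B.N + g → app s p v t q = 0

namespace Multi

section

variable {A : AInfCat.{u, v}} {B : AInfCat.{u', v'}} {U : A.Ob → B.Ob → ℤ → Type w''}
  {V : A.Ob → B.Ob → ℤ → Type w} {W : A.Ob → B.Ob → ℤ → Type w'}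
  [∀ X Y p, AddCommGroup (U X Y p)] [∀ X Y p, AddCommGroup (V X Y p)]
  [∀ X Y p, AddCommGroup (W X Y p)] {g g' : ℤ}

/-- The same maps, with an equal degree. -/
def cast (f : Multi A B V W g) (h : g = g') : Multi A B V W g' where
  app := f.app
  left := f.left
  mid := f.mid
  right := f.right
  degree := fun s p v t q hq => f.degree s p v t q (by rw [h]; exact hq)

/-- The value at the degree `d` component of a family. -/
def appAt (f : Multi A B V W g) {X X' : A.Ob} {Y' Y : B.Ob} (s : Str A.Hom X X') (d : ℤ)
    (v : ∀ d, V X' Y' d) (t : Str B.Hom Y' Y) (q : ℤ) : W X Y q :=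
  f.app s d (v d) t q

/-- `f.app s d · t q` as a homomorphism. -/
def appHom (f : Multi A B V W g) {X X' : A.Ob} {Y' Y : B.Ob} (s : Str A.Hom X X') (d : ℤ)
    (t : Str B.Hom Y' Y) (q : ℤ) : V X' Y' d →+ W X Y q :=
  AddMonoidHom.mk' (fun v => f.app s d v t q) (fun v v' => f.mid s d v v' t q)

@[simp] theorem appHom_apply (f : Multi A B V W g) {X X' : A.Ob} {Y' Y : B.Ob}
    (s : Str A.Hom X X') (d : ℤ) (t : Str B.Hom Y' Y) (q : ℤ) (v : V X' Y' d) :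
    f.appHom s d t q v = f.app s d v t q := rfl

theorem app_zero (f : Multi A B V W g) {X X' : A.Ob} {Y' Y : B.Ob}
    (s : Str A.Hom X X') (d : ℤ) (t : Str B.Hom Y' Y) (q : ℤ) :
    f.app s d (0 : V X' Y' d) t q = 0 := (f.appHom s d t q).map_zero

/-- `∑ h(x₁, …, f(x_i, …, x_k, v, y_m, …, y_{i'}), …, y₁)`. -/
def compApp (f : Multi A B U V g) (h : Multi A B V W g') {X X' : A.Ob} {Y' Y : B.Ob}
    (s : Str A.Hom X X') (p : ℤ) (v : U X' Y' p) (t : Str B.Hom Y' Y) (q : ℤ) : W X Y q :=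
  s.sumSplit fun _ s₁ s₂ => t.sumSplit fun _ t₁ t₂ =>
    h.appAt s₁ (s₂.rdeg A.N + p + t₁.rdeg B.N + g) (f.app s₂ p v t₁) t₂ q

/-- `∑ f(x₁, …, μ(x_i, …, x_j), …, x_k, v, y_m, …, y₁)
  + ∑ f(x₁, …, x_k, v, y_m, …, μ(y_j, …, y_i), …, y₁)`. -/
def barApp (f : Multi A B V W g) {X X' : A.Ob} {Y' Y : B.Ob}
    (s : Str A.Hom X X') (p : ℤ) (v : V X' Y' p) (t : Str B.Hom Y' Y) (q : ℤ) : W X Y q :=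
  A.bar s (fun s' => f.app s' p v t q) + B.bar t (fun t' => f.app s p v t' q)

/-- The composition `h ∘ f` of families of multilinear maps. -/
def comp (f : Multi A B U V g) (h : Multi A B V W g') : Multi A B U W (g + g') where
  app := fun s p v t q => f.compApp h s p v t q
  left := fun {X X' Y' Y} p v t q => by
    refine IsMultilinear.sumSplit (fun Z s₂ => ?_) (fun Z s₁ => ?_)
    · intro P Q a r x x' b
      rw [← sumSplit_add]
      exact sumSplit_congr _ fun _ t₁ t₂ _ => h.left _ _ t₂ q P Q a r x x' b
    · intro P Q a r x x' b
      rw [← sumSplit_add]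
      refine sumSplit_congr _ fun _ t₁ t₂ _ => ?_
      simp only [rdeg_append, rdeg_cons]
      exact (congrArg (fun z => h.app s₁ _ z t₂ q) (f.left p v t₁ _ P Q a r x x' b)).trans
        (h.mid _ _ _ _ _ _)
  mid := fun s p v v' t q => by
    simp only [compApp]
    rw [← sumSplit_add]
    refine sumSplit_congr _ fun _ s₁ s₂ _ => ?_
    rw [← sumSplit_add]
    refine sumSplit_congr _ fun _ t₁ t₂ _ => ?_
    exact (congrArg (fun z => h.app s₁ _ z t₂ q) (f.mid s₂ p v v' t₁ _)).trans (h.mid _ _ _ _ _ _)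
  right := fun {X X' Y' Y} s p v q => by
    intro P Q a r x x' b
    simp only [compApp]
    rw [← sumSplit_add]
    refine sumSplit_congr _ fun _ s₁ s₂ _ => ?_
    refine IsMultilinear.sumSplit (fun Z t₂ => ?_) (fun Z t₁ => ?_) P Q a r x x' b
    · intro P Q a r x x' b
      simp only [rdeg_append, rdeg_cons]
      exact (congrArg (fun z => h.app s₁ _ z t₂ q) (f.right s₂ p v _ P Q a r x x' b)).trans
        (h.mid _ _ _ _ _ _)
    · exact h.right s₁ _ _ q
  degree := fun s p v t q hq => by
    simp only [compApp]
    rw [← sumSplit_zero s]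
    refine sumSplit_congr _ fun _ s₁ s₂ hs => ?_
    rw [← sumSplit_zero t]
    refine sumSplit_congr _ fun _ t₁ t₂ ht => ?_
    subst hs; subst ht
    refine h.degree _ _ _ _ _ fun e => hq ?_
    rw [e, rdeg_append, rdeg_append]; ring

/-- The family with only nonzero member the identity `V(X,Y) → V(X,Y)` at `k = m = 0`. -/
def id (A : AInfCat.{u, v}) (B : AInfCat.{u', v'}) (V : A.Ob → B.Ob → ℤ → Type w)
    [∀ X Y p, AddCommGroup (V X Y p)] : Multi A B V V 0 where
  app := fun s p v t => match s, t with
    | nil _, nil _ => Pi.single p v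
    | _, _ => 0
  left := fun p v t q => by
    intro P Q a r x x' b
    cases a <;> cases t <;> simp
  mid := fun s p v v' t q => by
    cases s <;> cases t <;> simp [Pi.single_add]
  right := fun s p v q => by
    intro P Q a r x x' b
    cases a <;> cases s <;> simp
  degree := fun s p v t q hq => by
    cases s <;> cases t <;> simp
    exact Pi.single_eq_of_ne (by simpa using hq) _

/-- Composition of every map with isomorphisms `e : W(X,Y)_q → W'(X,Y)_q`. -/
def relabel {W' : A.Ob → B.Ob → ℤ → Type w'} [∀ X Y p, AddCommGroup (W' X Y p)]
    (f : Multi A B V W g) (e : ∀ X Y q, W X Y q ≃+ W' X Y q) : Multi A B V W' g where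
  app := fun s p v t q => e _ _ q (f.app s p v t q)
  left := fun p v t q P Q a r x x' b => by
    simp only [f.left p v t q P Q a r x x' b, map_add]
  mid := fun s p v v' t q => by simp only [f.mid, map_add]
  right := fun s p v q P Q a r x x' b => by
    simp only [f.right s p v q P Q a r x x' b, map_add]
  degree := fun s p v t q hq => by simp only [f.degree s p v t q hq, map_zero]

/-- The same maps, on suspensions: `V[k]` and `W[k]` are graded bimodules over `A[j]`, `B[j]`. -/
def shift (f : Multi A B V W g) (j k : ℤ) :
    Multi (A.susp j) (B.susp j) (fun X Y p => V X Y (p + k)) (fun X Y p => W X Y (p + k)) g where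
  app := fun s p v t q => f.app (unshift j s) (p + k) v (unshift j t) (q + k)
  left := fun p v t q => (f.left (p + k) v (unshift j t) (q + k)).unshift j
  mid := fun s p v v' t q => f.mid _ _ v v' _ _
  right := fun s p v q => (f.right (unshift j s) (p + k) v (q + k)).unshift j
  degree := fun s p v t q hq => f.degree _ _ _ _ _ (by
    rw [rdeg_unshift, rdeg_unshift]
    intro e; apply hq; change q = s.rdeg (A.N - j) + p + t.rdeg (B.N - j) + g; omega)

theorem shift_compApp (f : Multi A B U V g) (h : Multi A B V W g') (j k : ℤ)
    {X X' : (A.susp j).Ob} {Y' Y : (B.susp j).Ob} (s : Str (A.susp j).Hom X X') (p : ℤ)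
    (v : U X' Y' (p + k)) (t : Str (B.susp j).Hom Y' Y) (q : ℤ) :
    (f.shift j k).compApp (h.shift j k) s p v t q
      = f.compApp h (unshift j s) (p + k) v (unshift j t) (q + k) := by
  simp only [compApp]
  refine Eq.trans ?_ (sumSplit_unshift j s _).symm
  refine sumSplit_congr _ fun _ s₁ s₂ _ => ?_
  refine Eq.trans ?_ (sumSplit_unshift j t _).symm
  refine sumSplit_congr _ fun _ t₁ t₂ _ => ?_
  have e : s₂.rdeg (A.susp j).N + p + t₁.rdeg (B.susp j).N + g + k
      = (unshift j s₂).rdeg A.N + (p + k) + (unshift j t₁).rdeg B.N + g := by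
    rw [rdeg_unshift, rdeg_unshift]; change s₂.rdeg (A.N - j) + p + t₁.rdeg (B.N - j) + g + k = _
    ring
  rw [← e]; rfl

end

end Multi

theorem AInfCat.bar_unshift (A : AInfCat.{u, v}) {R : Type w} [AddCommMonoid R] (j : ℤ) {X Y : A.Ob}
    (s : Str (A.susp j).Hom X Y) (G : Str A.Hom X Y → R) :
    (A.susp j).bar s (fun r => G (unshift j r)) = A.bar (unshift j s) G := by
  unfold AInfCat.bar
  refine Eq.trans ?_ (sumSplit₃_unshift j s _).symm
  refine sumSplit₃_congr s fun Y Y' a b c _ => ?_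
  refine congrArg G ?_
  have h := consAt_unshift j (d := b.rdeg (A.N - j) - 2 + (A.N - j))
    (d' := (unshift j b).rdeg A.N - 2 + A.N) (by rw [rdeg_unshift]; ring) (A.μ (unshift j b)) c
  rw [unshift_append, ← h]

theorem Multi.shift_barApp {A : AInfCat.{u, v}} {B : AInfCat.{u', v'}}
    {V : A.Ob → B.Ob → ℤ → Type w} {W : A.Ob → B.Ob → ℤ → Type w'}
    [∀ X Y p, AddCommGroup (V X Y p)] [∀ X Y p, AddCommGroup (W X Y p)] {g : ℤ}
    (f : Multi A B V W g) (j k : ℤ) {X X' : (A.susp j).Ob} {Y' Y : (B.susp j).Ob}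
    (s : Str (A.susp j).Hom X X') (p : ℤ) (v : V X' Y' (p + k)) (t : Str (B.susp j).Hom Y' Y)
    (q : ℤ) : (f.shift j k).barApp s p v t q
      = f.barApp (unshift j s) (p + k) v (unshift j t) (q + k) := by
  unfold Multi.barApp
  rw [← A.bar_unshift, ← B.bar_unshift]
  rfl

/-- An `A`–`B` bimodule: graded vector spaces with structure maps
`μ_{k|1|m}` of degree `-1 + k (1 - N_A) + m (1 - N_B)` satisfying the `A_∞` relations. -/
structure Bimodule (A : AInfCat.{u, v}) (B : AInfCat.{u', v'}) where
  V : A.Ob → B.Ob → ℤ → Type w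
  [grp : ∀ X Y p, AddCommGroup (V X Y p)]
  [mod : ∀ X Y p, Module (ZMod 2) (V X Y p)]
  μ : Multi A B V V (-1)
  rel : ∀ {X X' : A.Ob} {Y' Y : B.Ob} (s : Str A.Hom X X') (p : ℤ) (v : V X' Y' p)
    (t : Str B.Hom Y' Y) (q : ℤ), μ.compApp μ s p v t q + μ.barApp s p v t q = 0

attribute [instance] Bimodule.grp Bimodule.mod

/-- Pre-morphisms of bimodules of degree `g`. -/
abbrev PreMor {A : AInfCat.{u, v}} {B : AInfCat.{u', v'}} (K : Bimodule.{u, u', v, v', w} A B)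
    (L : Bimodule.{u, u', v, v', w'} A B) (g : ℤ) :=
  Multi A B K.V L.V g

namespace PreMor

variable {A : AInfCat.{u, v}} {B : AInfCat.{u', v'}} {K : Bimodule.{u, u', v, v', w} A B}
  {L : Bimodule.{u, u', v, v', w'} A B} {g : ℤ}

/-- The differential `μ₁(ν) = μ^L ∘ ν + ν ∘ μ^K + ν ∘ (μ^A, μ^B)` of the dg-category of bimodules. -/
def diffApp (ν : PreMor K L g) {X X' : A.Ob} {Y' Y : B.Ob} (s : Str A.Hom X X') (p : ℤ)
    (v : K.V X' Y' p) (t : Str B.Hom Y' Y) (q : ℤ) : L.V X Y q :=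
  ν.compApp L.μ s p v t q + K.μ.compApp ν s p v t q + ν.barApp s p v t q

/-- Bimodule morphisms are the closed pre-morphisms. -/
def IsClosed (ν : PreMor K L g) : Prop :=
  ∀ {X X' : A.Ob} {Y' Y : B.Ob} (s : Str A.Hom X X') (p : ℤ) (v : K.V X' Y' p)
    (t : Str B.Hom Y' Y) (q : ℤ), ν.diffApp s p v t q = 0

/-- `[ν] = [ν']`: the difference is the differential of a pre-morphism of degree `g + 1`. -/
def Homologous (ν ν' : PreMor K L g) : Prop :=
  ∃ η : PreMor K L (g + 1), ∀ {X X' : A.Ob} {Y' Y : B.Ob} (s : Str A.Hom X X') (p : ℤ)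
    (v : K.V X' Y' p) (t : Str B.Hom Y' Y) (q : ℤ),
    ν.app s p v t q - ν'.app s p v t q = PreMor.diffApp η s p v t q

/-- A quasi-isomorphism of bimodules is a bimodule morphism whose class is an isomorphism
in the homological category of the dg-category of bimodules. -/
def IsQuasiIso (ν : PreMor K L g) : Prop :=
  IsClosed ν ∧ ∃ ψ : PreMor L K (-g), IsClosed ψ ∧
    Homologous (K := K) (L := K) ((ν.comp ψ).cast (add_neg_cancel g)) (Multi.id A B K.V) ∧
    Homologous (K := L) (L := L) ((ψ.comp ν).cast (neg_add_cancel g)) (Multi.id A B L.V)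

end PreMor

/-! ## Constructions of bimodules -/

/-- The diagonal bimodule `A_Δ`. -/
@[reducible] def AInfCat.diag (A : AInfCat.{u, v}) : Bimodule.{u, u, v, v, v} A A where
  V := A.Hom
  μ :=
    { app := fun s p x t q => A.μ (s.append (cons p x t)) q
      left := fun p x t q => (A.μ_multilinear _ _ q).appendRight _
      mid := fun s p x x' t q => A.μ_multilinear _ _ q _ _ s p x x' t
      right := fun s p x q => ((A.μ_multilinear _ _ q).appendLeft s).cons p x
      degree := fun s p x t q hq => A.μ_degree _ _ (by
        simp only [rdeg_append, rdeg_cons]; intro e; apply hq; rw [e]; ring) }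
  rel := fun s p x t q => by
    rw [← A.rel (s.append (cons p x t)) q, sumSplit₃_append_cons]
    refine congrArg₂ _ ?_ (congrArg₂ _ ?_ ?_)
    · refine sumSplit_congr _ fun _ s₁ s₂ _ => sumSplit_congr _ fun _ t₁ t₂ _ => ?_
      have e : (s₂.append (cons p x t₁)).rdeg A.N - 2 + A.N
          = s₂.rdeg A.N + p + t₁.rdeg A.N + -1 := by
        simp only [rdeg_append, rdeg_cons]; ring
      rw [e]; rfl
    · refine sumSplit₃_congr s fun _ _ a b c _ => ?_
      exact congrArg (fun r => A.μ r q) (append_assoc _ _ _)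
    · refine sumSplit₃_congr t fun _ _ a b c _ => ?_
      exact congrArg (fun r => A.μ r q) (append_assoc s (cons p x a) _).symm

section Pullback

variable {A : AInfCat.{u, v}} {B : AInfCat.{u', v'}} (F : AInfFunctor A B)
  {U : B.Ob → B.Ob → ℤ → Type w''} {V : B.Ob → B.Ob → ℤ → Type w} {W : B.Ob → B.Ob → ℤ → Type w'}
  [∀ X Y p, AddCommGroup (U X Y p)] [∀ X Y p, AddCommGroup (V X Y p)]
  [∀ X Y p, AddCommGroup (W X Y p)] {g g' : ℤ}

/-- The pullback `F^*` of families of multilinear maps. -/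
def Multi.pullback (f : Multi B B V W g) :
    Multi A A (fun X Y p => V (F.obj X) (F.obj Y) p) (fun X Y p => W (F.obj X) (F.obj Y) p) g where
  app := fun s p v t q => F.blocks s fun s' => F.blocks t fun t' => f.app s' p v t' q
  left := fun p v t q => by
    refine F.blocks_multilinear fun P Q a r x x' b => ?_
    rw [← F.blocks_add]
    exact F.blocks_congr t fun t' _ => f.left p v t' q P Q a r x x' b
  mid := fun s p v v' t q => by simp only [f.mid, F.blocks_add]
  right := fun s p v q P Q a r x x' b => by
    rw [← F.blocks_add]
    exact F.blocks_congr s fun s' _ => F.blocks_multilinear (f.right s' p v q) P Q a r x x' b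
  degree := fun s p v t q hq => by
    rw [← F.blocks_zero s]
    refine F.blocks_congr s fun s' hs => ?_
    rw [← F.blocks_zero t]
    refine F.blocks_congr t fun t' ht => f.degree _ _ _ _ _ ?_
    rw [hs, ht]; exact hq

theorem Multi.pullback_compApp (f : Multi B B U V g) (h : Multi B B V W g') {X X' Y' Y : A.Ob}
    (s : Str A.Hom X X') (p : ℤ) (v : U (F.obj X') (F.obj Y') p) (t : Str A.Hom Y' Y) (q : ℤ) :
    (f.pullback F).compApp (h.pullback F) s p v t q
      = F.blocks s fun s' => F.blocks t fun t' => f.compApp h s' p v t' q := by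
  have hR : (F.blocks s fun s' => F.blocks t fun t' => f.compApp h s' p v t' q)
      = s.sumSplit fun _ s₁ s₂ => t.sumSplit fun _ t₁ t₂ => F.blocks s₁ fun s₁' =>
        F.blocks s₂ fun s₂' => F.blocks t₁ fun t₁' => F.blocks t₂ fun t₂' =>
        h.appAt s₁' (s₂'.rdeg B.N + p + t₁'.rdeg B.N + g) (f.app s₂' p v t₁') t₂' q := by
    unfold compApp AInfFunctor.blocks
    simp only [sumBlocks_sumSplit, sumBlocks_split]
  rw [hR]
  refine sumSplit_congr _ fun _ s₁ s₂ _ => sumSplit_congr _ fun _ t₁ t₂ _ => ?_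
  refine F.blocks_congr s₁ fun s₁' _ => ?_
  have hX : (F.blocks s₂ fun s₂' => F.blocks t₁ fun t₁' => F.blocks t₂ fun t₂' =>
        h.appAt s₁' (s₂'.rdeg B.N + p + t₁'.rdeg B.N + g) (f.app s₂' p v t₁') t₂' q)
      = F.blocks s₂ fun s₂' => F.blocks t₂ fun t₂' => F.blocks t₁ fun t₁' =>
        h.appHom s₁' (s₂.rdeg A.N + p + t₁.rdeg A.N + g) t₂' q (f.app s₂' p v t₁' _) := by
    refine F.blocks_congr s₂ fun s₂' h₂ => ?_
    rw [F.blocks_comm]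
    refine F.blocks_congr t₂ fun t₂' _ => F.blocks_congr t₁ fun t₁' h₁ => ?_
    rw [h₁, h₂]; rfl
  rw [hX, F.blocks_comm]
  refine F.blocks_congr t₂ fun t₂' _ => ?_
  simp only [← F.map_blocks]
  rfl

theorem Multi.pullback_barApp (f : Multi B B V W g) {X X' Y' Y : A.Ob}
    (s : Str A.Hom X X') (p : ℤ) (v : V (F.obj X') (F.obj Y') p) (t : Str A.Hom Y' Y) (q : ℤ) :
    (f.pullback F).barApp s p v t q
      = F.blocks s fun s' => F.blocks t fun t' => f.barApp s' p v t' q := by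
  unfold barApp
  simp only [F.blocks_add]
  refine congrArg₂ _ ?_ ?_
  · refine (F.blocks_bar s (G := fun s' => F.blocks t fun t' => f.app s' p v t' q) ?_).symm.trans ?_
    · intro P Q a r x x' b
      rw [← F.blocks_add]
      exact F.blocks_congr t fun t' _ => f.left p v t' q P Q a r x x' b
    · refine F.blocks_congr s fun s' _ => ?_
      simp only [AInfCat.bar, sumSplit₃, AInfFunctor.blocks, sumBlocks_sumSplit]
  · have h₁ : ∀ s' : Str B.Hom (F.obj X) (F.obj X'), (F.blocks t fun t' => B.bar t' fun t' => f.app s' p v t' q)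
        = A.bar t fun t' => F.blocks t' fun t' => f.app s' p v t' q :=
      fun s' => F.blocks_bar t (f.right s' p v q)
    simp only [h₁]
    simp only [AInfCat.bar, sumSplit₃, AInfFunctor.blocks, sumBlocks_sumSplit]
    rfl

/-- The pullback bimodule `F^* M`. -/
@[reducible] def Bimodule.pullback (M : Bimodule.{u', u', v', v', w} B B) : Bimodule.{u, u, v, v, w} A A where
  V := fun X Y p => M.V (F.obj X) (F.obj Y) p
  μ := M.μ.pullback F
  rel := fun s p v t q => by
    rw [Multi.pullback_compApp, Multi.pullback_barApp, ← F.blocks_add]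
    simp only [← F.blocks_add, M.rel, F.blocks_zero]

end Pullback

/-- `M[k]` regarded as an `A[j]`–`B[j]` bimodule. -/
@[reducible] def Bimodule.shift {A : AInfCat.{u, v}} {B : AInfCat.{u', v'}}
    (M : Bimodule.{u, u', v, v', w} A B) (j k : ℤ) :
    Bimodule.{u, u', v, v', w} (A.susp j) (B.susp j) where
  V := fun X Y p => M.V X Y (p + k)
  μ := M.μ.shift j k
  rel := fun s p v t q => by
    rw [Multi.shift_compApp, Multi.shift_barApp]
    exact M.rel _ _ _ _ _

section Dual

variable {A : AInfCat.{u, v}} {B : AInfCat.{u', v'}}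

/-- The graded dual `(V^∨(Y,X))_q = Hom(V(X,Y)_{-q}, ZMod 2)`. -/
abbrev dualV (V : A.Ob → B.Ob → ℤ → Type w) [∀ X Y p, AddCommGroup (V X Y p)]
    [∀ X Y p, Module (ZMod 2) (V X Y p)] (Y : B.Ob) (X : A.Ob) (q : ℤ) : Type w :=
  Module.Dual (ZMod 2) (V X Y (-q))

variable {U : A.Ob → B.Ob → ℤ → Type w''} {V : A.Ob → B.Ob → ℤ → Type w}
  {W : A.Ob → B.Ob → ℤ → Type w'} [∀ X Y p, AddCommGroup (U X Y p)]
  [∀ X Y p, AddCommGroup (V X Y p)] [∀ X Y p, AddCommGroup (W X Y p)]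
  [∀ X Y p, Module (ZMod 2) (U X Y p)] [∀ X Y p, Module (ZMod 2) (V X Y p)]
  [∀ X Y p, Module (ZMod 2) (W X Y p)] {g g' : ℤ}

/-- The dual of a family of multilinear maps:
`⟨f^∨(y₁, …, y_m, φ, x_k, …, x₁), v⟩ = ⟨φ, f(x_k, …, x₁, v, y₁, …, y_m)⟩`. -/
def Multi.dual (f : Multi A B V W g) : Multi B A (dualV W) (dualV V) g where
  app := fun t p φ s q => φ ∘ₗ (f.appHom s (-q) t (-p)).toZModLinearMap 2
  left := fun p φ s q P Q a r x x' b => LinearMap.ext fun v => by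
    change φ (f.app _ _ _ _ _) = φ (f.app _ _ _ _ _) + φ (f.app _ _ _ _ _)
    rw [← map_add]
    exact congrArg φ (f.right s (-q) v (-p) P Q a r x x' b)
  mid := fun t p φ φ' s q => rfl
  right := fun t p φ q P Q a r x x' b => LinearMap.ext fun v => by
    change φ (f.app _ _ _ _ _) = φ (f.app _ _ _ _ _) + φ (f.app _ _ _ _ _)
    rw [← map_add]
    exact congrArg φ (f.left (-q) v t (-p) P Q a r x x' b)
  degree := fun t p φ s q hq => LinearMap.ext fun v => by
    change φ (f.app _ _ _ _ _) = 0
    rw [f.degree _ _ _ _ _ (by intro e; apply hq; omega), map_zero]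

theorem Multi.dual_app (f : Multi A B V W g) {X X' : A.Ob} {Y Y' : B.Ob} (t : Str B.Hom Y Y')
    (p : ℤ) (φ : dualV W Y' X p) (s : Str A.Hom X X') (q : ℤ) (v : V X' Y (-q)) :
    (f.dual.app t p φ s q : Module.Dual _ _) v = φ (f.app s (-q) v t (-p)) := rfl

theorem Multi.dual_compApp (f : Multi A B U V g) (h : Multi A B V W g') {X X' : A.Ob} {Y Y' : B.Ob}
    (t : Str B.Hom Y Y') (p : ℤ) (φ : dualV W Y' X p) (s : Str A.Hom X X') (q : ℤ)
    (v : U X' Y (-q)) :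
    (h.dual.compApp f.dual t p φ s q : Module.Dual _ _) v = φ (f.compApp h s (-q) v t (-p)) := by
  let ev : Module.Dual (ZMod 2) (U X' Y (-q)) →+ ZMod 2 :=
    AddMonoidHom.mk' (fun ψ => ψ v) (fun _ _ => rfl)
  change ev (h.dual.compApp f.dual t p φ s q) = φ.toAddMonoidHom (f.compApp h s (-q) v t (-p))
  unfold compApp
  simp only [map_sumSplit]
  rw [sumSplit_comm]
  refine sumSplit_congr _ fun _ s₁ s₂ _ => sumSplit_congr _ fun _ t₁ t₂ _ => ?_
  change φ (h.app s₁ (-(t₂.rdeg B.N + p + s₁.rdeg A.N + g')) (f.app s₂ (-q) v t₁ _) t₂ (-p))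
    = φ (h.app s₁ (s₂.rdeg A.N + -q + t₁.rdeg B.N + g) (f.app s₂ (-q) v t₁ _) t₂ (-p))
  by_cases e : -(t₂.rdeg B.N + p + s₁.rdeg A.N + g') = s₂.rdeg A.N + -q + t₁.rdeg B.N + g
  · rw [e]
  · rw [f.degree s₂ (-q) v t₁ _ e, app_zero, h.degree s₁ _ _ t₂ (-p) (by omega)]

theorem Multi.dual_barApp (f : Multi A B V W g) {X X' : A.Ob} {Y Y' : B.Ob}
    (t : Str B.Hom Y Y') (p : ℤ) (φ : dualV W Y' X p) (s : Str A.Hom X X') (q : ℤ)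
    (v : V X' Y (-q)) :
    (f.dual.barApp t p φ s q : Module.Dual _ _) v = φ (f.barApp s (-q) v t (-p)) := by
  let ev : Module.Dual (ZMod 2) (V X' Y (-q)) →+ ZMod 2 :=
    AddMonoidHom.mk' (fun ψ => ψ v) (fun _ _ => rfl)
  change ev (f.dual.barApp t p φ s q) = φ.toAddMonoidHom (f.barApp s (-q) v t (-p))
  unfold barApp
  rw [map_add, map_add, add_comm, AInfCat.map_bar, AInfCat.map_bar, AInfCat.map_bar,
    AInfCat.map_bar]
  rfl

/-- The linear dual of a bimodule. -/
@[reducible] def Bimodule.dual (M : Bimodule.{u, u', v, v', w} A B) : Bimodule.{u', u, v', v, w} B A where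
  V := dualV M.V
  μ := M.μ.dual
  rel := fun t p φ s q => LinearMap.ext fun v => by
    change (M.μ.dual.compApp M.μ.dual t p φ s q : Module.Dual _ _) v
      + (M.μ.dual.barApp t p φ s q : Module.Dual _ _) v = 0
    rw [Multi.dual_compApp, Multi.dual_barApp, ← map_add, M.rel, map_zero]

end Dual

/-! ## Homology and homological unitality -/

namespace Bimodule

variable {A : AInfCat.{u, v}} {B : AInfCat.{u', v'}} (M : Bimodule.{u, u', v, v', w} A B)

/-- The component `M(X,Y)_p → M(X,Y)_q` of the differential `μ_{0|1|0}`, zero unless `q = p - 1`. -/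
def d (X : A.Ob) (Y : B.Ob) (p q : ℤ) : M.V X Y p →ₗ[ZMod 2] M.V X Y q :=
  (M.μ.appHom (nil X) p (nil Y) q).toZModLinearMap 2

/-- Cycles of degree `p` in `M(X,Y)`. -/
def cycles (X : A.Ob) (Y : B.Ob) (p : ℤ) : Submodule (ZMod 2) (M.V X Y p) :=
  LinearMap.ker (M.d X Y p (p - 1))

/-- Boundaries of degree `p` in `M(X,Y)`. -/
def boundaries (X : A.Ob) (Y : B.Ob) (p : ℤ) : Submodule (ZMod 2) (M.V X Y p) :=
  LinearMap.range (M.d X Y (p + 1) p)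

/-- The homology `H_p(M(X,Y))`. -/
abbrev H (X : A.Ob) (Y : B.Ob) (p : ℤ) : Type w :=
  M.cycles X Y p ⧸ (M.boundaries X Y p).submoduleOf (M.cycles X Y p)

end Bimodule

/-- `e ∈ A(X,X)_N` is a cycle whose class is a two-sided identity of `X` in the homological
category `H(A)`. -/
def AInfCat.IsHUnit (A : AInfCat.{u, v}) {X : A.Ob} (e : A.Hom X X A.N) : Prop :=
  e ∈ A.diag.cycles X X A.N ∧
  (∀ (Y : A.Ob) (p : ℤ), ∀ x ∈ A.diag.cycles X Y p,
    A.μ (cons A.N e (cons p x (nil Y))) p - x ∈ A.diag.boundaries X Y p) ∧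
  (∀ (Y : A.Ob) (p : ℤ), ∀ x ∈ A.diag.cycles Y X p,
    A.μ (cons p x (cons A.N e (nil X))) p - x ∈ A.diag.boundaries Y X p)

/-- Homological unitality of an `A_∞`-category. -/
def AInfCat.IsHUnital (A : AInfCat.{u, v}) : Prop :=
  ∀ X : A.Ob, ∃ e : A.Hom X X A.N, A.IsHUnit e

/-- Homological unitality of a bimodule: homology units act as the identity on homology,
on the left and on the right. -/
def Bimodule.IsHUnital {A : AInfCat.{u, v}} {B : AInfCat.{u', v'}}
    (M : Bimodule.{u, u', v, v', w} A B) : Prop :=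
  (∀ (X : A.Ob) (e : A.Hom X X A.N), A.IsHUnit e → ∀ (Y : B.Ob) (p : ℤ), ∀ z ∈ M.cycles X Y p,
    M.μ.app (cons A.N e (nil X)) p z (nil Y) p - z ∈ M.boundaries X Y p) ∧
  (∀ (Y : B.Ob) (e : B.Hom Y Y B.N), B.IsHUnit e → ∀ (X : A.Ob) (p : ℤ), ∀ z ∈ M.cycles X Y p,
    M.μ.app (nil X) p z (cons B.N e (nil Y)) p - z ∈ M.boundaries X Y p)

/-! ## Duals of Hochschild complexes -/

/-- `CC_n(A,M)^∨ = Hom(CC_{-n}(A,M), ZMod 2)`, where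
`CC_p(A,M) = ⨁ (A(X₀,…,X_k) ⊗ M(X_k,X₀))` in total degree `N + p - k (1 - N)`.
A linear functional on this direct sum of tensor products is a family of multilinear functionals
`σ(x₁ ⊗ ⋯ ⊗ x_k ⊗ z)` on composable `x₁, …, x_k` and `z ∈ M(X_k,X₀)` that vanishes unless
`|x₁| + ⋯ + |x_k| + |z| = N - n - k (1 - N)`. -/
structure HochDual (A : AInfCat.{u, v}) (M : Bimodule.{u, u, v, v, w} A A) (n : ℤ) where
  app : ∀ {X Y : A.Ob}, Str A.Hom X Y → ∀ p : ℤ, M.V Y X p → ZMod 2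
  left : ∀ {X Y : A.Ob} (p : ℤ) (z : M.V Y X p),
    IsMultilinear (fun s : Str A.Hom X Y => app s p z)
  right : ∀ {X Y : A.Ob} (s : Str A.Hom X Y) (p : ℤ) (z z' : M.V Y X p),
    app s p (z + z') = app s p z + app s p z'
  degree : ∀ {X Y : A.Ob} (s : Str A.Hom X Y) (p : ℤ) (z : M.V Y X p),
    s.rdeg A.N + p ≠ A.N - n → app s p z = 0

namespace HochDual

section

variable {A : AInfCat.{u, v}} {M : Bimodule.{u, u, v, v, w} A A} {n n' : ℤ}

/-- The same functional, with an equal degree. -/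
def cast (σ : HochDual A M n) (h : n = n') : HochDual A M n' where
  app := σ.app
  left := σ.left
  right := σ.right
  degree := fun s p z hp => σ.degree s p z (by rw [h]; exact hp)

/-- `σ(s ⊗ ·)` as a homomorphism. -/
def appHom (σ : HochDual A M n) {X Y : A.Ob} (s : Str A.Hom X Y) (p : ℤ) : M.V Y X p →+ ZMod 2 :=
  AddMonoidHom.mk' (σ.app s p) (σ.right s p)

theorem app_zero (σ : HochDual A M n) {X Y : A.Ob} (s : Str A.Hom X Y) (p : ℤ) :
    σ.app s p (0 : M.V Y X p) = 0 := (σ.appHom s p).map_zero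

/-- `σ(s ⊗ z)` for `z` the degree `d` component of a family. -/
def appAt (σ : HochDual A M n) {X Y : A.Ob} (s : Str A.Hom X Y) (d : ℤ) (z : ∀ d, M.V Y X d) :
    ZMod 2 := σ.app s d (z d)

/-- `σ` is closed: `σ(∂(x₁ ⊗ ⋯ ⊗ x_k ⊗ z)) = 0`, with the Hochschild differential
`∂(x₁ ⊗ ⋯ ⊗ x_k ⊗ z) = ∑ x₁ ⊗ ⋯ ⊗ μ(x_i, …, x_j) ⊗ ⋯ ⊗ x_k ⊗ z
  + ∑ x_{j+1} ⊗ ⋯ ⊗ x_{i-1} ⊗ μ^M(x_i, …, x_k, z, x₁, …, x_j)`. -/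
def IsClosed (σ : HochDual A M n) : Prop :=
  ∀ {X Y : A.Ob} (s : Str A.Hom X Y) (p : ℤ) (z : M.V Y X p),
    A.bar s (fun r => σ.app r p z)
      + s.sumSplit₃ (fun _ _ s₁ s₂ s₃ =>
          σ.appAt s₂ (s₃.rdeg A.N + p + s₁.rdeg A.N - 1) (M.μ.app s₃ p z s₁)) = 0

/-- `σ(μ^M_{1|1|0}(x,z))` for `x ∈ A(X,X')_p`, `z ∈ M(X',X)_{N-p}`. -/
def pair (σ : HochDual A M n) (X X' : A.Ob) (p : ℤ) :
    A.Hom X X' p →ₗ[ZMod 2] Module.Dual (ZMod 2) (M.V X' X (A.N - p)) :=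
  AddMonoidHom.toZModLinearMap 2 <| AddMonoidHom.mk'
    (fun x => ((σ.appHom (nil X) 0).comp
      (M.μ.appHom (cons p x (nil X')) (A.N - p) (nil X) 0)).toZModLinearMap 2)
    (fun x x' => LinearMap.ext fun z => by
      change σ.app _ _ (M.μ.app _ _ _ _ _) = σ.app _ _ (M.μ.app _ _ _ _ _)
        + σ.app _ _ (M.μ.app _ _ _ _ _)
      rw [← σ.right]
      exact congrArg _ (M.μ.left (A.N - p) z (nil X) 0 _ _ (nil X) p x x' (nil X')))

theorem pair_apply (σ : HochDual A M n) (X X' : A.Ob) (p : ℤ) (x : A.Hom X X' p)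
    (z : M.V X' X (A.N - p)) :
    σ.pair X X' p x z = σ.app (nil X) 0 (M.μ.app (cons p x (nil X')) (A.N - p) z (nil X) 0) := rfl

theorem IsClosed.d_eq_zero {σ : HochDual A M n} (hσ : σ.IsClosed) (X : A.Ob) (v : M.V X X 1) :
    σ.app (nil X) 0 (M.d X X 1 0 v) = 0 := by
  have h := hσ (nil X) 1 v
  rw [A.bar_nil (σ.left 1 v), zero_add] at h
  exact h

theorem _root_.Bimodule.leibniz (M : Bimodule.{u, u, v, v, w} A A) (X X' : A.Ob) (p r : ℤ)
    (x : A.Hom X X' p) (z : M.V X' X r) (e q : ℤ) (he : e = p + (1 - A.N) + r - 1) :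
    M.d X X e q (M.μ.app (cons p x (nil X')) r z (nil X) e)
      + M.μ.app (cons p x (nil X')) (r - 1) (M.d X' X r (r - 1) z) (nil X) q
      + M.μ.app (cons (p - 1) (A.diag.d X X' p (p - 1) x) (nil X')) r z (nil X) q = 0 := by
  have h := M.rel (cons p x (nil X')) r z (nil X) q
  unfold Multi.barApp at h
  rw [A.bar_single p x (M.μ.left r z (nil X) q), A.bar_nil (M.μ.right _ r z q), add_zero] at h
  refine Eq.trans ?_ h
  refine congrArg₂ _ ?_ rfl
  have h₁ : (cons p x (nil X')).rdeg A.N + r + (nil X : Str A.Hom X X).rdeg A.N + -1 = e := by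
    rw [he]; simp; ring
  have h₂ : (nil X' : Str A.Hom X' X').rdeg A.N + r + (nil X : Str A.Hom X X).rdeg A.N + -1
      = r - 1 := by simp; ring
  simp only [Multi.compApp, sumSplit_cons, sumSplit_nil, h₁, h₂]
  rfl

theorem IsClosed.pair_boundary_left {σ : HochDual A M n} (hσ : σ.IsClosed) (X X' : A.Ob) (p : ℤ)
    (x : A.Hom X X' p) (hx : x ∈ A.diag.boundaries X X' p) (z : M.V X' X (A.N - p))
    (hz : z ∈ M.cycles X' X (A.N - p)) : σ.pair X X' p x z = 0 := by
  obtain ⟨x', rfl⟩ := hx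
  have h := M.leibniz X X' (p + 1) (A.N - p) x' z 1 0 (by ring)
  have hz' : M.d X' X (A.N - p) (A.N - p - 1) z = 0 := hz
  rw [hz', M.μ.app_zero, add_zero] at h
  have h' := congrArg (σ.appHom (nil X) 0) h
  rw [map_add, map_zero] at h'
  have h₀ := hσ.d_eq_zero X (M.μ.app (cons (p + 1) x' (nil X')) (A.N - p) z (nil X) 1)
  change σ.app _ _ _ + σ.app _ _ _ = 0 at h'
  rw [h₀, zero_add] at h'
  rw [σ.pair_apply]
  have e : p + 1 - 1 = p := by ring
  rw [← h']
  clear h' h₀ h hz hz'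
  have key : ∀ p', p' = p → σ.app (nil X) 0 (M.μ.app (cons p (A.diag.d X X' (p + 1) p x') (nil X'))
      (A.N - p) z (nil X) 0) = σ.app (nil X) 0 (M.μ.app
        (cons p' (A.diag.d X X' (p + 1) p' x') (nil X')) (A.N - p) z (nil X) 0) := by
    rintro p' rfl; rfl
  exact key _ e

theorem IsClosed.pair_boundary_right {σ : HochDual A M n} (hσ : σ.IsClosed) (X X' : A.Ob) (p : ℤ)
    (x : A.Hom X X' p) (hx : x ∈ A.diag.cycles X X' p) (z : M.V X' X (A.N - p))
    (hz : z ∈ M.boundaries X' X (A.N - p)) : σ.pair X X' p x z = 0 := by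
  obtain ⟨z', rfl⟩ := hz
  have h := M.leibniz X X' p (A.N - p + 1) x z' 1 0 (by ring)
  have hx' : A.diag.d X X' p (p - 1) x = 0 := hx
  have h₃ := (M.μ.left (A.N - p + 1) z' (nil X) 0).map_cons_zero (nil X) (p - 1) (nil X')
  rw [nil_append] at h₃
  rw [hx', h₃, add_zero] at h
  have h' := congrArg (σ.appHom (nil X) 0) h
  rw [map_add, map_zero] at h'
  have h₀ := hσ.d_eq_zero X (M.μ.app (cons p x (nil X')) (A.N - p + 1) z' (nil X) 1)
  change σ.app _ _ _ + σ.app _ _ _ = 0 at h'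
  rw [h₀, zero_add] at h'
  rw [σ.pair_apply, ← h']
  have key : ∀ r, r = A.N - p → σ.app (nil X) 0 (M.μ.app (cons p x (nil X'))
      (A.N - p) (M.d X' X (A.N - p + 1) (A.N - p) z') (nil X) 0) = σ.app (nil X) 0 (M.μ.app
        (cons p x (nil X')) r (M.d X' X (A.N - p + 1) r z') (nil X) 0) := by
    rintro r rfl; rfl
  exact key _ (by ring)

/-- The map `H_p(A(X,X')) → Hom(H_{N-p}(M(X',X)), ZMod 2)`, `[x] ↦ ([z] ↦ σ([μ_{1|1|0}(x,z)]))`. -/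
def homologyPairing (σ : HochDual A M n) (hσ : σ.IsClosed) (X X' : A.Ob) (p : ℤ) :
    A.diag.H X X' p →ₗ[ZMod 2] Module.Dual (ZMod 2) (M.H X' X (A.N - p)) :=
  Submodule.liftQ _
    (AddMonoidHom.toZModLinearMap 2 <| AddMonoidHom.mk'
      (fun x : A.diag.cycles X X' p => Submodule.liftQ _
        ((σ.pair X X' p x.1).comp (M.cycles X' X (A.N - p)).subtype)
        (fun z hz => hσ.pair_boundary_right X X' p x.1 x.2 z.1 hz))
      (fun x x' => Submodule.linearMap_qext _ (LinearMap.ext fun z => by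
        change σ.pair X X' p (x.1 + x'.1) z.1 = σ.pair X X' p x.1 z.1 + σ.pair X X' p x'.1 z.1
        rw [map_add]; rfl)))
    (fun x hx => Submodule.linearMap_qext _ (LinearMap.ext fun z =>
      hσ.pair_boundary_left X X' p x.1 hx z.1 z.2))

/-- Homological non-degeneracy of a dual Hochschild chain: it is closed, and the maps
`H_p(A(X,X')) → Hom(H_{N-p}(M(X',X)), ZMod 2)` are isomorphisms. -/
def IsHomNondegenerate (σ : HochDual A M A.N) : Prop :=
  ∃ hσ : σ.IsClosed, ∀ (X X' : A.Ob) (p : ℤ), Function.Bijective (σ.homologyPairing hσ X X' p)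

end

end HochDual

/-- `₂CC_n(A,M)^∨ = Hom(₂CC_{-n}(A,M), ZMod 2)`, where `₂CC(A,M) = A_Δ ⊗_{A–A} M` is the two-pointed
Hochschild chain complex: families of multilinear functionals
`α(w ⊗ y_m ⊗ ⋯ ⊗ y₁ ⊗ z ⊗ x₁ ⊗ ⋯ ⊗ x_k)`, written `app (x₁ ⊗ ⋯ ⊗ x_k) |w| w (y_m ⊗ ⋯ ⊗ y₁) |z| z`,
vanishing unless `∑ |x_i| + ∑ |y_i| + |w| + |z| + (k + m) (1 - N) - 2 N = -n`. -/
structure TwoHochDual (A : AInfCat.{u, v}) (M : Bimodule.{u, u, v, v, w} A A) (n : ℤ) where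
  app : ∀ {X X' Y' Y : A.Ob}, Str A.Hom X X' → ∀ p : ℤ, A.Hom X' Y' p → Str A.Hom Y' Y →
    ∀ r : ℤ, M.V Y X r → ZMod 2
  multilinear₁ : ∀ {X X' Y' Y : A.Ob} (p : ℤ) (w : A.Hom X' Y' p) (t : Str A.Hom Y' Y) (r : ℤ)
    (z : M.V Y X r), IsMultilinear (fun s : Str A.Hom X X' => app s p w t r z)
  multilinear₂ : ∀ {X X' Y' Y : A.Ob} (s : Str A.Hom X X') (p : ℤ) (w w' : A.Hom X' Y' p)
    (t : Str A.Hom Y' Y) (r : ℤ) (z : M.V Y X r),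
    app s p (w + w') t r z = app s p w t r z + app s p w' t r z
  multilinear₃ : ∀ {X X' Y' Y : A.Ob} (s : Str A.Hom X X') (p : ℤ) (w : A.Hom X' Y' p) (r : ℤ)
    (z : M.V Y X r), IsMultilinear (fun t : Str A.Hom Y' Y => app s p w t r z)
  multilinear₄ : ∀ {X X' Y' Y : A.Ob} (s : Str A.Hom X X') (p : ℤ) (w : A.Hom X' Y' p)
    (t : Str A.Hom Y' Y) (r : ℤ) (z z' : M.V Y X r),
    app s p w t r (z + z') = app s p w t r z + app s p w t r z'
  degree : ∀ {X X' Y' Y : A.Ob} (s : Str A.Hom X X') (p : ℤ) (w : A.Hom X' Y' p)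
    (t : Str A.Hom Y' Y) (r : ℤ) (z : M.V Y X r),
    s.rdeg A.N + p + t.rdeg A.N + r - 2 * A.N ≠ -n → app s p w t r z = 0

namespace HochDual

variable {A : AInfCat.{u, v}} {M : Bimodule.{u, u, v, v, w} A A} {n : ℤ}

/-- The map `T^∨ : CC_n(A,M)^∨ → ₂CC_n(A,M)^∨` dual to
`T(w ⊗ y_m ⊗ ⋯ ⊗ y₁ ⊗ z ⊗ x₁ ⊗ ⋯ ⊗ x_k)
  = ∑ x_{j+1} ⊗ ⋯ ⊗ x_{k-i} ⊗ μ^M(x_{k-i+1}, …, x_k, w, y_m, …, y₁, z, x₁, …, x_j)`. -/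
def Tdual (σ : HochDual A M n) : TwoHochDual A M n where
  app := fun s p w t r z => s.sumSplit₃ fun _ _ s₁ s₂ s₃ =>
    σ.appAt s₂ ((s₃.append (cons p w t)).rdeg A.N + r + s₁.rdeg A.N - 1)
      (M.μ.app (s₃.append (cons p w t)) r z s₁)
  multilinear₁ := fun p w t r z => by
    refine IsMultilinear.sumSplit₃ (fun _ _ s₂ s₃ => ?_) (fun _ _ s₁ s₃ => ?_) (fun _ _ s₁ s₂ => ?_)
    · intro P Q a e x x' b
      simp only [rdeg_append, rdeg_cons]
      exact (congrArg (σ.app s₂ _) (M.μ.right _ r z _ P Q a e x x' b)).trans (σ.right _ _ _ _)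
    · exact σ.left _ _
    · intro P Q a e x x' b
      simp only [rdeg_append, rdeg_cons]
      exact (congrArg (σ.app s₂ _) ((M.μ.left r z s₁ _).appendRight (cons p w t) P Q a e x x' b)).trans
        (σ.right _ _ _ _)
  multilinear₂ := fun s p w w' t r z => by
    rw [← sumSplit₃_add]
    refine sumSplit₃_congr s fun _ _ s₁ s₂ s₃ _ => ?_
    simp only [rdeg_append, rdeg_cons]
    exact (congrArg (σ.app s₂ _) (M.μ.left r z s₁ _ _ _ s₃ p w w' t)).trans (σ.right _ _ _ _)
  multilinear₃ := fun s p w r z P Q a e x x' b => by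
    rw [← sumSplit₃_add]
    refine sumSplit₃_congr s fun _ _ s₁ s₂ s₃ _ => ?_
    simp only [rdeg_append, rdeg_cons]
    exact (congrArg (σ.app s₂ _) ((((M.μ.left r z s₁ _).appendLeft s₃).cons p w)
      P Q a e x x' b)).trans (σ.right _ _ _ _)
  multilinear₄ := fun s p w t r z z' => by
    rw [← sumSplit₃_add]
    refine sumSplit₃_congr s fun _ _ s₁ s₂ s₃ _ => ?_
    exact (congrArg (σ.app s₂ _) (M.μ.mid _ r z z' s₁ _)).trans (σ.right _ _ _ _)
  degree := fun s p w t r z h => by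
    rw [← sumSplit₃_zero s]
    refine sumSplit₃_congr s fun _ _ s₁ s₂ s₃ hs => σ.degree _ _ _ ?_
    subst hs
    simp only [rdeg_append, rdeg_cons] at h ⊢
    omega

/-- The map `(ν_*)^∨ : CC_n(A,M')^∨ → CC_{n+g}(A,M)^∨` dual to the map
`ν_*(x₁ ⊗ ⋯ ⊗ x_k ⊗ z) = ∑ x_{j+1} ⊗ ⋯ ⊗ x_{k-i} ⊗ ν(x_{k-i+1}, …, x_k, z, x₁, …, x_j)`
induced by a pre-morphism `ν : M → M'` of degree `g`. -/
def mapDual {M' : Bimodule.{u, u, v, v, w'} A A} {g : ℤ} (ν : PreMor M M' g)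
    (σ : HochDual A M' n) : HochDual A M (n + g) where
  app := fun s p z => s.sumSplit₃ fun _ _ s₁ s₂ s₃ =>
    σ.appAt s₂ (s₃.rdeg A.N + p + s₁.rdeg A.N + g) (ν.app s₃ p z s₁)
  left := fun p z => by
    refine IsMultilinear.sumSplit₃ (fun _ _ s₂ s₃ => ?_) (fun _ _ s₁ s₃ => ?_) (fun _ _ s₁ s₂ => ?_)
    · intro P Q a e x x' b
      simp only [rdeg_append, rdeg_cons]
      exact (congrArg (σ.app s₂ _) (ν.right _ p z _ P Q a e x x' b)).trans (σ.right _ _ _ _)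
    · exact σ.left _ _
    · intro P Q a e x x' b
      simp only [rdeg_append, rdeg_cons]
      exact (congrArg (σ.app s₂ _) (ν.left p z s₁ _ P Q a e x x' b)).trans (σ.right _ _ _ _)
  right := fun s p z z' => by
    rw [← sumSplit₃_add]
    refine sumSplit₃_congr s fun _ _ s₁ s₂ s₃ _ => ?_
    exact (congrArg (σ.app s₂ _) (ν.mid _ p z z' s₁ _)).trans (σ.right _ _ _ _)
  degree := fun s p z h => by
    rw [← sumSplit₃_zero s]
    refine sumSplit₃_congr s fun _ _ s₁ s₂ s₃ hs => σ.degree _ _ _ ?_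
    subst hs
    simp only [rdeg_append] at h
    omega

/-- The map `(F_*)^∨ : CC_n(B,M)^∨ → CC_{n + N_A - N_B}(A,F^*M)^∨` dual to the map
`F_*(x₁ ⊗ ⋯ ⊗ x_k ⊗ z) = ∑ F(x₁, …, x_{p₁}) ⊗ ⋯ ⊗ F(x_{k-p_s+1}, …, x_k) ⊗ z`. -/
def pullbackDual {B : AInfCat.{u', v'}} (F : AInfFunctor A B)
    {M : Bimodule.{u', u', v', v', w} B B} (σ : HochDual B M n) :
    HochDual A (M.pullback F) (n + A.N - B.N) where
  app := fun s p z => F.blocks s fun s' => σ.app s' p z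
  left := fun p z => F.blocks_multilinear (σ.left p z)
  right := fun s p z z' => by simp only [σ.right, F.blocks_add]
  degree := fun s p z h => by
    rw [← F.blocks_zero s]
    exact F.blocks_congr s fun s' hs => σ.degree _ _ _ (by rw [hs]; omega)

/-- The dual of the identification `CC_p(A[j],M[k]) = CC_{p+k-j}(A,M)`. -/
def shiftDual (σ : HochDual A M n) (j k : ℤ) :
    HochDual (A.susp j) (M.shift j k) (n + k - j) where
  app := fun s p z => σ.app (unshift j s) (p + k) z
  left := fun p z => (σ.left (p + k) z).unshift j
  right := fun s p z z' => σ.right _ _ _ _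
  degree := fun s p z h => σ.degree _ _ _ (by
    change s.rdeg (A.N - j) + p ≠ (A.N - j) - (n + k - j) at h
    rw [rdeg_unshift]; omega)

end HochDual

/-- The isomorphism `Γ : ₂CC_n(A,M)^∨ ≅ ₂CC^{n-2N}(A,M^∨)`, where `₂CC^g(A,M^∨)` is the space of
pre-morphisms `A_Δ → M^∨` of degree `g`:
`⟨Γ(α)(x₁, …, x_k, w, y_m, …, y₁), z⟩ = α(w ⊗ y_m ⊗ ⋯ ⊗ y₁ ⊗ z ⊗ x₁ ⊗ ⋯ ⊗ x_k)`. -/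
def TwoHochDual.Γ {A : AInfCat.{u, v}} {M : Bimodule.{u, u, v, v, w} A A} {n : ℤ}
    (α : TwoHochDual A M n) : PreMor A.diag M.dual (n - 2 * A.N) where
  app := fun s p w t q => (AddMonoidHom.mk' (fun z => α.app s p w t (-q) z)
    (fun z z' => α.multilinear₄ s p w t (-q) z z')).toZModLinearMap 2
  left := fun p w t q P Q a e x x' b => LinearMap.ext fun z =>
    α.multilinear₁ p w t (-q) z P Q a e x x' b
  mid := fun s p w w' t q => LinearMap.ext fun z => α.multilinear₂ s p w w' t (-q) z
  right := fun s p w q P Q a e x x' b => LinearMap.ext fun z =>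
    α.multilinear₃ s p w (-q) z P Q a e x x' b
  degree := fun s p w t q h => LinearMap.ext fun z => α.degree s p w t (-q) z (by omega)

/-- `Γ ∘ T^∨` on `CC_N(A,M)^∨`, with values in pre-morphisms `A_Δ → M^∨` of degree `-N`. -/
def HochDual.toPreMor {A : AInfCat.{u, v}} {M : Bimodule.{u, u, v, v, w} A A}
    (σ : HochDual A M A.N) : PreMor A.diag M.dual (-A.N) :=
  σ.Tdual.Γ.cast (by ring)

/-! ## Relative weak Calabi–Yau pairings -/

section Relative

variable {A : AInfCat.{u, v}} {B : AInfCat.{u', v'}} {j : ℤ}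

/-- The bimodule morphism `i : B_Δ → I^* (A_Δ)[j]` of degree `0`,
`i(y₁, …, y_k, z, y'_m, …, y'₁) = I(y₁, …, y_k, z, y'_m, …, y'₁)`. -/
def diagMor (hN : A.N = B.N + j) (I : AInfFunctor B (A.susp j)) :
    PreMor B.diag ((A.diag.shift j j).pullback I) 0 where
  app := fun s p z t q => I.map _ _ (s.append (cons p z t)) q
  left := fun p z t q => (I.map_multilinear _ _ q).appendRight _
  mid := fun s p z z' t q => I.map_multilinear _ _ q _ _ s p z z' t
  right := fun s p z q => ((I.map_multilinear _ _ q).appendLeft s).cons p z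
  degree := fun s p z t q h => I.map_degree _ _ (by
    simp only [rdeg_append, rdeg_cons]; omega)

/-- Duals of equal graded pieces are identified. -/
def dualCongr {V : ℤ → Type w} [∀ p, AddCommGroup (V p)] [∀ p, Module (ZMod 2) (V p)] {a b : ℤ}
    (h : a = b) : Module.Dual (ZMod 2) (V a) ≃+ Module.Dual (ZMod 2) (V b) :=
  match h with
  | rfl => AddEquiv.refl _

variable {Arel : Bimodule.{u, u, v, v, w} A A}

/-- `Ψ_{i,i_rel}(α) : B_Δ → I^* A_Δ[j] → I^* A_rel^∨[j] = (I^* A^rel_Δ[-j])^∨ → B^∨`, the composition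
`i_rel^∨ ∘ I^* α[j] ∘ i`. -/
def Psi (hN : A.N = B.N + j) (I : AInfFunctor B (A.susp j))
    (irel : PreMor B.diag ((Arel.shift j (-j)).pullback I) j) {g : ℤ}
    (α : PreMor A.diag Arel.dual g) : PreMor B.diag B.diag.dual (g + j) :=
  ((((diagMor hN I).comp ((Multi.shift α j j).pullback I)).relabel
    (W' := ((Arel.shift j (-j)).pullback I).dual.V)
    (fun X Y q => dualCongr (V := fun p => Arel.V (I.obj Y) (I.obj X) p)
      (show -(q + j) = -q + -j by ring))).comp (Multi.dual irel)).cast (by ring)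

/-- The bimodule morphism `φ : A_Δ → A_rel^∨` of degree `-N_A` represents, together with `i_rel`, a
relative weak Calabi–Yau pairing on `A` with coefficients in `A^rel_Δ`. -/
def IsRelWeakCYPairing (hN : A.N = B.N + j) (I : AInfFunctor B (A.susp j))
    (irel : PreMor B.diag ((Arel.shift j (-j)).pullback I) j)
    (φ : PreMor A.diag Arel.dual (-A.N)) : Prop :=
  PreMor.IsQuasiIso φ ∧ PreMor.IsQuasiIso (Psi hN I irel φ)

/-- The map `(I^rel_*)^∨ : CC_{N_A}(A,A^rel_Δ)^∨ → CC_{N_B}(B)^∨` dual to the composition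
`CC(B) → CC(B, I^*A^rel_Δ[-j]) → CC(A[j], A^rel_Δ[-j]) = CC(A, A^rel_Δ)` of the maps
`(i_rel)_*` and `I_*`. -/
def IrelDual (I : AInfFunctor B (A.susp j))
    (irel : PreMor B.diag ((Arel.shift j (-j)).pullback I) j)
    (σ : HochDual A Arel A.N) : HochDual B B.diag B.N :=
  (((σ.shiftDual j (-j)).pullbackDual I).mapDual irel).cast (by
    change A.N + -j - j + B.N - (A.N - j) + j = B.N; ring)

end Relative

/-! Both conditions are visible on homology. Over a field, a closed pre-morphism of bimodules is
invertible up to homotopy as soon as its component `ν_{0|1|0}` is an isomorphism on homology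
(`PreMor.isQuasiIso_iff`). The homology of a dual complex is the dual of the homology, so a morphism
`φ : A_Δ → M^∨` of degree `-N` is a quasi-isomorphism exactly when the pairing `⟨φ_{0|1|0}(x), z⟩`
between `H_p(A(X,Y))` and `H_{N-p}(M(Y,X))` is perfect
(`PreMor.isLinQuasiIso_iff_isPerfectPairing`). If `φ` is homologous to `ΓT^∨(σ)`, this pairing is
`σ(μ_{1|1|0}(x,z))`, since on empty strings `T^∨` has a single term (`HochDual.ev_toPreMor`). Hence
`φ` is a quasi-isomorphism iff `σ` is homologically non-degenerate.

For `Ψ(φ)` the pairing on homology is `⟨φ(I₁x), i_rel z⟩ = σ(μ(I₁x, i_rel z))`, whereas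
`(I^rel_*)^∨σ` pairs `x` and `z` to `σ(i_rel(μ₂(x,z)))`. Since `i_rel` is closed, the two arguments
of `σ` differ by a boundary, which the closed functional `σ` annihilates (`ev_Psi_eq_IrelDual_app`).
So for each closed `σ` representing `[φ]`, condition 1 is equivalent to non-degeneracy of both `σ`
and `(I^rel_*)^∨σ` (`isRelWeakCYPairing_iff`).

What remains is that such a `σ` exists (`HochDual.exists_homologous_toPreMor`), and this is where
homological unitality enters: the cone of `ΓT^∨` is acyclic (`HochDual.cone_acyclic`). The
approximate inverse of `ΓT^∨` evaluates a pre-morphism at a homology unit `e`. Multiplication by `e`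
is only homotopic to the identity, and the homotopies supply the correction terms. This inverts the
differential of the cone up to terms of higher weight in a filtration by string lengths, and the
errors are removed by successive approximation (`exists_preimage_of_filtration`). The same scheme,
with a contraction of the cone of `ν_{0|1|0}` as the first approximation, gives the criterion for
quasi-isomorphisms. -/

/-! ## The bar differential -/

namespace AInfCat

variable (A : AInfCat.{u, v}) {R : Type w}

theorem bar_sumSplit_comm [AddCommMonoid R] {Ob' : Type u'} {V' : Ob' → Ob' → ℤ → Type v'}
    {X Z : A.Ob} {X' Z' : Ob'} (s : Str A.Hom X Z) (t : Str V' X' Z')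
    (F : Str A.Hom X Z → ∀ Y, Str V' X' Y → Str V' Y Z' → R) :
    A.bar s (fun r => t.sumSplit (F r)) = t.sumSplit (fun Y a b => A.bar s (fun r => F r Y a b)) := by
  unfold bar sumSplit₃
  rw [← sumSplit_comm]
  exact sumSplit_congr _ fun U a r _ => sumSplit_comm _ _ _

theorem bar_comm [AddCommMonoid R] (B : AInfCat.{u', v'})
    {X Z : A.Ob} {X' Z' : B.Ob} (s : Str A.Hom X Z) (t : Str B.Hom X' Z')
    (F : Str A.Hom X Z → Str B.Hom X' Z' → R) :
    A.bar s (fun r => B.bar t (F r)) = B.bar t (fun r' => A.bar s (fun r => F r r')) := by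
  refine (A.bar_sumSplit_comm s t fun r U a q => q.sumSplit fun U' b c =>
    F r (a.append (consAt (b.rdeg B.N - 2 + B.N) (B.μ b) c))).trans ?_
  exact sumSplit_congr t fun U a q _ => A.bar_sumSplit_comm s q fun r U' b c =>
    F r (a.append (consAt (b.rdeg B.N - 2 + B.N) (B.μ b) c))

/-- The bar differential is a coderivation. -/
theorem bar_sumSplit [AddCommMonoid R] {X Z : A.Ob} (s : Str A.Hom X Z)
    (F : ∀ Y, Str A.Hom X Y → Str A.Hom Y Z → R) :
    A.bar s (fun r => r.sumSplit F)
      = s.sumSplit (fun Y a b => A.bar a (fun a' => F Y a' b) + A.bar b (fun b' => F Y a b')) := by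
  unfold bar sumSplit₃ consAt
  -- The inserted value of `μ` is a single entry, so each cut passes to its left or to its right;
  -- the two cases are the two summands on the right-hand side.
  simp only [sumSplit_append_cons, sumSplit_add]
  rw [add_comm]
  refine congrArg₂ _ ?_ ?_
  · refine Eq.trans ?_ (sumSplit_assoc s fun U Y a r b => r.sumSplit fun U' m c =>
      F Y (a.append (cons _ (A.μ m (m.rdeg A.N - 2 + A.N)) c)) b).symm
    refine sumSplit_congr _ fun U a r _ => ?_
    exact (sumSplit_assoc r fun U' Y m c b =>
      F Y (a.append (cons _ (A.μ m (m.rdeg A.N - 2 + A.N)) c)) b).symm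
  · refine Eq.trans ?_ (sumSplit_assoc s fun Y U a b r => r.sumSplit fun U' m c =>
      F Y a (b.append (cons _ (A.μ m (m.rdeg A.N - 2 + A.N)) c)))
    exact sumSplit_congr _ fun U a r _ => sumSplit_comm _ _ _

theorem bar_sumSplit₃ [AddCommMonoid R] {X Z : A.Ob} (s : Str A.Hom X Z)
    (F : ∀ Y Y', Str A.Hom X Y → Str A.Hom Y Y' → Str A.Hom Y' Z → R) :
    A.bar s (fun r => r.sumSplit₃ F)
      = s.sumSplit₃ (fun Y Y' a b c => A.bar a (fun a' => F Y Y' a' b c)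
        + A.bar b (fun b' => F Y Y' a b' c) + A.bar c (fun c' => F Y Y' a b c')) := by
  unfold sumSplit₃
  rw [bar_sumSplit]
  refine sumSplit_congr _ fun Y a r _ => ?_
  rw [bar_sumSplit, bar_sumSplit_comm, ← sumSplit_add]
  exact sumSplit_congr _ fun Y' b c _ => (add_assoc _ _ _).symm

/-- The differential of the string `s ⊗ x ⊗ t`. -/
theorem bar_append_cons [AddCommMonoid R] {X Y Z W : A.Ob} (s : Str A.Hom X Y) (p : ℤ)
    (x : A.Hom Y Z p) (t : Str A.Hom Z W) (G : Str A.Hom X W → R) :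
    A.bar (s.append (cons p x t)) G
      = s.sumSplit (fun _ s₁ s₂ => t.sumSplit (fun _ t₁ t₂ => G (s₁.append
          (consAt ((s₂.append (cons p x t₁)).rdeg A.N - 2 + A.N)
            (A.μ (s₂.append (cons p x t₁))) t₂))))
        + (A.bar s (fun s' => G (s'.append (cons p x t)))
          + A.bar t (fun t' => G (s.append (cons p x t')))) := by
  unfold bar
  rw [sumSplit₃_append_cons]
  simp only [append_assoc, consAt_append, cons_append]

/-- The square of the bar differential vanishes. Two nested applications of `μ` add up to zero by
the A-infinity relation for the outer block; two disjoint applications arise in both orders and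
cancel in characteristic two. -/
theorem bar_bar [AddCommGroup R] [Module (ZMod 2) R] {X Z : A.Ob} (s : Str A.Hom X Z)
    {G : Str A.Hom X Z → R} (hG : IsMultilinear G) : A.bar s (fun r => A.bar r G) = 0 := by
  have inner : ∀ (Y Y' : A.Ob) (a : Str A.Hom X Y) (m : Str A.Hom Y Y') (c : Str A.Hom Y' Z),
      m.sumSplit₃ (fun _ _ m₁ m₂ m₃ => G (a.append
        (consAt ((m₁.append (consAt (m₂.rdeg A.N - 2 + A.N) (A.μ m₂) m₃)).rdeg A.N - 2 + A.N)
          (A.μ (m₁.append (consAt (m₂.rdeg A.N - 2 + A.N) (A.μ m₂) m₃))) c))) = 0 := by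
    intro Y Y' a m c
    let φ : A.Hom Y Y' (m.rdeg A.N - 3 + A.N) →+ R :=
      AddMonoidHom.mk' (fun g => G (a.append (cons _ g c))) (fun g g' => hG _ _ a _ g g' c)
    have h := congrArg φ (A.rel m (m.rdeg A.N - 3 + A.N))
    rw [map_zero, map_sumSplit₃] at h
    refine Eq.trans (sumSplit₃_congr m fun _ _ m₁ m₂ m₃ hm => ?_) h
    have e : (m₁.append (consAt (m₂.rdeg A.N - 2 + A.N) (A.μ m₂) m₃)).rdeg A.N - 2 + A.N
        = m.rdeg A.N - 3 + A.N := by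
      subst hm; simp; ring
    rw [e]; rfl
  have hL : A.bar s (fun r => A.bar r G)
      = s.sumSplit₃ (fun _ _ a b c => A.bar a (fun a' =>
          G (a'.append (consAt (b.rdeg A.N - 2 + A.N) (A.μ b) c))))
        + s.sumSplit₃ (fun _ _ a b c => A.bar c (fun c' =>
          G (a.append (consAt (b.rdeg A.N - 2 + A.N) (A.μ b) c')))) := by
    have h₀ : s.sumSplit₃ (fun Y Y' b m c => b.sumSplit fun U s₁ s₂ => c.sumSplit fun U' t₁ t₂ =>
        G (s₁.append (consAt ((s₂.append (consAt (m.rdeg A.N - 2 + A.N) (A.μ m) t₁)).rdeg A.N - 2 + A.N)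
          (A.μ (s₂.append (consAt (m.rdeg A.N - 2 + A.N) (A.μ m) t₁))) t₂))) = 0 := by
      -- Choosing the inner block and then enlarging it, or the outer block and then a block inside
      -- it, enumerates the same cuts into five pieces.
      have e₁ : s.sumSplit₃ (fun Y Y' b m c => b.sumSplit fun U s₁ s₂ => c.sumSplit fun U' t₁ t₂ =>
        G (s₁.append (consAt ((s₂.append (consAt (m.rdeg A.N - 2 + A.N) (A.μ m) t₁)).rdeg A.N - 2 + A.N)
          (A.μ (s₂.append (consAt (m.rdeg A.N - 2 + A.N) (A.μ m) t₁))) t₂)))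
        = s.sumSplit₃ (fun U U' s₁ k t₂ => k.sumSplit₃ fun Y Y' s₂ m t₁ =>
        G (s₁.append (consAt ((s₂.append (consAt (m.rdeg A.N - 2 + A.N) (A.μ m) t₁)).rdeg A.N - 2 + A.N)
          (A.μ (s₂.append (consAt (m.rdeg A.N - 2 + A.N) (A.μ m) t₁))) t₂))) := by
        unfold sumSplit₃
        have a₁ : ∀ (Y : A.Ob) (b : Str A.Hom X Y) (r : Str A.Hom Y Z)
            (H : ∀ U Y' U', Str A.Hom X U → Str A.Hom U Y → Str A.Hom Y Y' → Str A.Hom Y' U' →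
              Str A.Hom U' Z → R),
            (r.sumSplit fun Y' m c => b.sumSplit fun U s₁ s₂ => c.sumSplit fun U' t₁ t₂ =>
              H U Y' U' s₁ s₂ m t₁ t₂)
            = b.sumSplit fun U s₁ s₂ => r.sumSplit fun Y' m c => c.sumSplit fun U' t₁ t₂ =>
              H U Y' U' s₁ s₂ m t₁ t₂ := fun Y b r H => sumSplit_comm _ _ _
        have a₂ := sumSplit_assoc s fun U Y s₁ s₂ r => r.sumSplit fun Y' m c =>
          c.sumSplit fun U' t₁ t₂ =>
          G (s₁.append (consAt ((s₂.append (consAt (m.rdeg A.N - 2 + A.N) (A.μ m) t₁)).rdeg A.N - 2 + A.N)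
          (A.μ (s₂.append (consAt (m.rdeg A.N - 2 + A.N) (A.μ m) t₁))) t₂))
        refine (sumSplit_congr s fun Y b r _ => a₁ Y b r _).trans (a₂.trans ?_)
        refine sumSplit_congr s fun U s₁ r _ => ?_
        have a₃ := sumSplit_assoc r fun Y U' s₂ k t₂ => k.sumSplit fun Y' m t₁ =>
          G (s₁.append (consAt ((s₂.append (consAt (m.rdeg A.N - 2 + A.N) (A.μ m) t₁)).rdeg A.N - 2 + A.N)
          (A.μ (s₂.append (consAt (m.rdeg A.N - 2 + A.N) (A.μ m) t₁))) t₂))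
        refine Eq.trans ?_ a₃.symm
        refine sumSplit_congr r fun Y s₂ k _ => ?_
        exact (sumSplit_assoc k fun Y' U' m t₁ t₂ =>
          G (s₁.append (consAt ((s₂.append (consAt (m.rdeg A.N - 2 + A.N) (A.μ m) t₁)).rdeg A.N - 2 + A.N)
          (A.μ (s₂.append (consAt (m.rdeg A.N - 2 + A.N) (A.μ m) t₁))) t₂))).symm
      rw [e₁]
      exact (sumSplit₃_congr s fun _ _ a m c _ => inner _ _ a m c).trans (sumSplit₃_zero s)
    have h₁ : A.bar s (fun r => A.bar r G) = s.sumSplit₃ (fun Y Y' b m c =>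
        A.bar (b.append (cons _ (A.μ m (m.rdeg A.N - 2 + A.N)) c)) G) := rfl
    rw [h₁]
    simp only [bar_append_cons, sumSplit₃_add]
    exact (congrArg₂ _ h₀ rfl).trans (zero_add _)
  rw [hL]
  -- Disjoint blocks: the second application of `μ` is to the left or to the right of the first.
  -- Exchanging the names of the two blocks identifies the two sums.
  have e₂ : s.sumSplit₃ (fun _ _ a b c => A.bar a (fun a' =>
        G (a'.append (consAt (b.rdeg A.N - 2 + A.N) (A.μ b) c))))
      = s.sumSplit₃ (fun _ _ a b c => A.bar c (fun c' =>
          G (a.append (consAt (b.rdeg A.N - 2 + A.N) (A.μ b) c')))) := by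
    unfold bar sumSplit₃
    let H : ∀ U₁ U₂ U₃ U₄ : A.Ob, Str A.Hom X U₁ → Str A.Hom U₁ U₂ → Str A.Hom U₂ U₃ →
      Str A.Hom U₃ U₄ → Str A.Hom U₄ Z → R := fun _ _ _ _ a m b n c =>
        G (a.append (consAt (m.rdeg A.N - 2 + A.N) (A.μ m)
          (b.append (consAt (n.rdeg A.N - 2 + A.N) (A.μ n) c))))
    have l₁ : (s.sumSplit fun Y a r => r.sumSplit fun Y' b c => a.sumSplit fun U a₁ r' =>
          r'.sumSplit fun U' m a₂ => G ((a₁.append (consAt (m.rdeg A.N - 2 + A.N) (A.μ m) a₂)).append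
            (consAt (b.rdeg A.N - 2 + A.N) (A.μ b) c)))
        = s.sumSplit fun U a₁ r => r.sumSplit fun U' m r => r.sumSplit fun Y a₂ r =>
          r.sumSplit fun Y' b c => H U U' Y Y' a₁ m a₂ b c := by
      simp only [append_assoc, consAt_append]
      refine (sumSplit_congr s fun Y a r _ => sumSplit_comm r a _).trans ?_
      refine (sumSplit_assoc s fun U Y a₁ r' r => r.sumSplit fun Y' b c =>
        r'.sumSplit fun U' m a₂ => H U U' Y Y' a₁ m a₂ b c).trans ?_
      refine sumSplit_congr s fun U a₁ r _ => ?_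
      refine (sumSplit_congr r fun Y a r _ => sumSplit_comm r a _).trans ?_
      exact sumSplit_assoc r fun U' Y m a₂ r => r.sumSplit fun Y' b c => H U U' Y Y' a₁ m a₂ b c
    rw [l₁]
  rw [e₂, ZModModule.add_self]

end AInfCat

/-! ### Cut sums in which a single term survives -/

namespace Str

variable {Ob : Type u} {V : Ob → Ob → ℤ → Type v} {R : Type w} [AddCommMonoid R]

/-- Isolates leading terms for filtrations by length: a map that vanishes on shorter strings sees
only the extreme cut. -/
theorem sumSplit_eq_right {X Z : Ob} (s : Str V X Z) (F : ∀ Y, Str V X Y → Str V Y Z → R)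
    (h : ∀ Y a b, a.append b = s → b.length < s.length → F Y a b = 0) :
    s.sumSplit F = F X (nil X) s := by
  cases s with
  | nil => rfl
  | cons p x s =>
    rw [sumSplit_cons]
    refine (congrArg₂ _ rfl ((sumSplit_congr s fun Y a b hab => h Y _ b ?_ ?_).trans
      (sumSplit_zero s))).trans (add_zero _)
    · simp [hab]
    · subst hab; simp

theorem sumSplit_eq_left {X Z : Ob} (s : Str V X Z) (F : ∀ Y, Str V X Y → Str V Y Z → R)
    (h : ∀ Y a b, a.append b = s → a.length < s.length → F Y a b = 0) :
    s.sumSplit F = F Z s (nil Z) := by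
  induction s with
  | nil => rfl
  | cons p x s ih =>
    rw [sumSplit_cons, h _ (nil _) (cons p x s) rfl (by simp), zero_add]
    exact ih _ fun Y a b hab hl => h Y _ b (by simp [hab]) (by simpa using hl)

theorem IsMultilinear.zero [∀ X Y p, AddCommGroup (V X Y p)] {X Y : Ob} :
    IsMultilinear (fun _ : Str V X Y => (0 : R)) :=
  fun _ _ _ _ _ _ _ => (add_zero 0).symm

theorem IsMultilinear.map {R' : Type w'} [AddCommMonoid R'] [∀ X Y p, AddCommGroup (V X Y p)]
    {X Y : Ob} {G : Str V X Y → R} (hG : IsMultilinear G) (φ : R →+ R') :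
    IsMultilinear (fun s : Str V X Y => φ (G s)) := fun U W a p x x' b => by
  simp only [hG U W a p x x' b, map_add]

end Str

/-! ### The additive group of families of multilinear maps -/

namespace Multi

variable {A : AInfCat.{u, v}} {B : AInfCat.{u', v'}} {U : A.Ob → B.Ob → ℤ → Type w''}
  {V : A.Ob → B.Ob → ℤ → Type w} {W : A.Ob → B.Ob → ℤ → Type w'} {W' : A.Ob → B.Ob → ℤ → Type v₂}
  [∀ X Y p, AddCommGroup (U X Y p)] [∀ X Y p, AddCommGroup (V X Y p)]
  [∀ X Y p, AddCommGroup (W X Y p)] [∀ X Y p, AddCommGroup (W' X Y p)] {g g' g'' : ℤ}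

@[ext] theorem ext {f h : Multi A B V W g}
    (e : ∀ {X X' Y' Y} (s : Str A.Hom X X') (p : ℤ) (v : V X' Y' p) (t : Str B.Hom Y' Y) (q : ℤ),
      f.app s p v t q = h.app s p v t q) : f = h := by
  have : @f.app = @h.app := by
    funext X X' Y' Y s p v t q; exact e s p v t q
  cases f; cases h; congr

instance : Zero (Multi A B V W g) where
  zero := ⟨fun _ _ _ _ _ => 0, fun _ _ _ _ => .zero, fun _ _ _ _ _ _ => (add_zero 0).symm,
    fun _ _ _ _ => .zero, fun _ _ _ _ _ _ => rfl⟩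

instance : Add (Multi A B V W g) where
  add f h := ⟨fun s p v t q => f.app s p v t q + h.app s p v t q,
    fun p v t q => (f.left p v t q).add (h.left p v t q),
    fun s p v v' t q => by rw [f.mid, h.mid]; abel,
    fun s p v q => (f.right s p v q).add (h.right s p v q),
    fun s p v t q hq => by rw [f.degree s p v t q hq, h.degree s p v t q hq, add_zero]⟩

instance : Neg (Multi A B V W g) where
  neg f := ⟨fun s p v t q => - f.app s p v t q,
    fun p v t q => (f.left p v t q).map (-AddMonoidHom.id _),
    fun s p v v' t q => by rw [f.mid, neg_add],
    fun s p v q => (f.right s p v q).map (-AddMonoidHom.id _),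
    fun s p v t q hq => by rw [f.degree s p v t q hq, neg_zero]⟩

instance : AddCommGroup (Multi A B V W g) where
  add_assoc f h k := Multi.ext fun _ _ _ _ _ => add_assoc _ _ _
  zero_add f := Multi.ext fun _ _ _ _ _ => zero_add _
  add_zero f := Multi.ext fun _ _ _ _ _ => add_zero _
  nsmul := nsmulRec
  zsmul := zsmulRec
  neg_add_cancel f := Multi.ext fun _ _ _ _ _ => neg_add_cancel _
  add_comm f h := Multi.ext fun _ _ _ _ _ => add_comm _ _

variable {X X' : A.Ob} {Y' Y : B.Ob} (s : Str A.Hom X X') (p : ℤ) (t : Str B.Hom Y' Y) (q : ℤ)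

@[simp] theorem add_apply (f h : Multi A B V W g) (v : V X' Y' p) :
    (f + h).app s p v t q = f.app s p v t q + h.app s p v t q := rfl

/-- Evaluation as a homomorphism. -/
def evalHom (v : V X' Y' p) : Multi A B V W g →+ W X Y q :=
  AddMonoidHom.mk' (fun f => f.app s p v t q) (fun _ _ => rfl)

theorem sum_apply {ι : Type*} (S : Finset ι) (f : ι → Multi A B V W g) (v : V X' Y' p) :
    (∑ i ∈ S, f i).app s p v t q = ∑ i ∈ S, (f i).app s p v t q :=
  map_sum (evalHom (W := W) (g := g) s p t q v) f S

@[simp] theorem sub_apply (f h : Multi A B V W g) (v : V X' Y' p) :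
    (f - h).app s p v t q = f.app s p v t q - h.app s p v t q :=
  map_sub (evalHom (W := W) (g := g) s p t q v) f h

/-! ### The algebra of families of multilinear maps -/

theorem add_compApp (f f' : Multi A B U V g) (h : Multi A B V W g') (v : U X' Y' p) :
    (f + f').compApp h s p v t q = f.compApp h s p v t q + f'.compApp h s p v t q := by
  simp only [compApp, appAt, ← sumSplit_add, ← h.mid]
  rfl

theorem compApp_add (f : Multi A B U V g) (h h' : Multi A B V W g') (v : U X' Y' p) :
    f.compApp (h + h') s p v t q = f.compApp h s p v t q + f.compApp h' s p v t q := by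
  simp only [compApp, ← sumSplit_add]
  rfl

theorem cast_compApp (f : Multi A B U V g) (e : g = g'') (h : Multi A B V W g') (v : U X' Y' p) :
    (f.cast e).compApp h s p v t q = f.compApp h s p v t q := by
  subst e; rfl

theorem compApp_cast (f : Multi A B U V g) (h : Multi A B V W g') (e : g' = g'') (v : U X' Y' p) :
    f.compApp (h.cast e) s p v t q = f.compApp h s p v t q := rfl

theorem compApp_of_app_eq_zero (f : Multi A B U V g) (h : Multi A B V W g') (v : U X' Y' p)
    (hh : ∀ {X X' Y' Y} (s : Str A.Hom X X') (p : ℤ) (v : V X' Y' p) (t : Str B.Hom Y' Y),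
      h.app s p v t q = 0) : f.compApp h s p v t q = 0 := by
  simp only [compApp, appAt, hh, sumSplit_zero]

theorem compApp_of_left_eq_zero (f : Multi A B U V g) (h : Multi A B V W g') (v : U X' Y' p)
    (hf : ∀ {X X' Y' Y} (s : Str A.Hom X X') (p : ℤ) (v : U X' Y' p) (t : Str B.Hom Y' Y) (q : ℤ),
      f.app s p v t q = 0) : f.compApp h s p v t q = 0 := by
  simp only [compApp, appAt, hf, app_zero, sumSplit_zero]

theorem add_barApp (f f' : Multi A B V W g) (v : V X' Y' p) :
    (f + f').barApp s p v t q = f.barApp s p v t q + f'.barApp s p v t q := by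
  simp only [barApp, add_apply, AInfCat.bar_add]
  abel

/-- Associativity of composition: both sides run over the cuts of `s` and of `t` into three pieces,
the innermost pieces going to `f`, the next ones to `h` and the outermost ones to `k`. -/
theorem comp_compApp (f : Multi A B U V g) (h : Multi A B V W g') (k : Multi A B W W' g'')
    (v : U X' Y' p) : (f.comp h).compApp k s p v t q = f.compApp (h.comp k) s p v t q := by
  have e₁ : ∀ {X X' Y' Y} (s : Str A.Hom X X') (p : ℤ) (v : U X' Y' p) (t : Str B.Hom Y' Y) (d : ℤ),
      (f.comp h).app s p v t d = s.sumSplit fun _ s₁ s₂ => t.sumSplit fun _ t₁ t₂ =>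
        h.app s₁ (s₂.rdeg A.N + p + t₁.rdeg B.N + g)
          (f.app s₂ p v t₁ (s₂.rdeg A.N + p + t₁.rdeg B.N + g)) t₂ d := fun _ _ _ _ _ => rfl
  have e₂ : ∀ {X X' Y' Y} (s : Str A.Hom X X') (p : ℤ) (v : V X' Y' p) (t : Str B.Hom Y' Y) (d : ℤ),
      (h.comp k).app s p v t d = s.sumSplit fun _ s₁ s₂ => t.sumSplit fun _ t₁ t₂ =>
        k.app s₁ (s₂.rdeg A.N + p + t₁.rdeg B.N + g')
          (h.app s₂ p v t₁ (s₂.rdeg A.N + p + t₁.rdeg B.N + g')) t₂ d := fun _ _ _ _ _ => rfl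
  unfold compApp appAt
  simp only [e₁, e₂]
  have l : ∀ {X₀ : A.Ob} {Y₀ : B.Ob} (s₁ : Str A.Hom X X₀) (s₂ : Str A.Hom X₀ X')
      (t₁ : Str B.Hom Y' Y₀) (t₂ : Str B.Hom Y₀ Y) (d : ℤ),
      k.app s₁ d (s₂.sumSplit fun _ a b => t₁.sumSplit fun _ a' b' =>
        h.app a (b.rdeg A.N + p + a'.rdeg B.N + g)
          (f.app b p v a' (b.rdeg A.N + p + a'.rdeg B.N + g)) b' d) t₂ q
      = s₂.sumSplit fun _ a b => t₁.sumSplit fun _ a' b' =>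
        k.app s₁ d (h.app a (b.rdeg A.N + p + a'.rdeg B.N + g)
          (f.app b p v a' (b.rdeg A.N + p + a'.rdeg B.N + g)) b' d) t₂ q := by
    intro X₀ Y₀ s₁ s₂ t₁ t₂ d
    change k.appHom s₁ d t₂ q _ = _
    simp only [map_sumSplit]
    rfl
  simp only [l]
  -- The intermediate degree is computed from the total lengths on one side and step by step on the
  -- other; the two expressions agree because `rdeg` is additive under concatenation.
  have e₃ : ∀ {X₀ : A.Ob} (s₁ : Str A.Hom X X₀) (s₂ : Str A.Hom X₀ X'),
      (t.sumSplit fun _ t₁ t₂ => s₂.sumSplit fun _ a b => t₁.sumSplit fun _ a' b' =>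
        k.app s₁ (s₂.rdeg A.N + p + t₁.rdeg B.N + (g + g'))
          (h.app a (b.rdeg A.N + p + a'.rdeg B.N + g)
          (f.app b p v a' (b.rdeg A.N + p + a'.rdeg B.N + g)) b'
          (s₂.rdeg A.N + p + t₁.rdeg B.N + (g + g'))) t₂ q)
      = s₂.sumSplit fun _ a b => t.sumSplit fun _ a' r => r.sumSplit fun _ b' t₂ =>
        k.app s₁ (a.rdeg A.N + (b.rdeg A.N + p + a'.rdeg B.N + g) + b'.rdeg B.N + g')
          (h.app a (b.rdeg A.N + p + a'.rdeg B.N + g)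
          (f.app b p v a' (b.rdeg A.N + p + a'.rdeg B.N + g)) b'
          (a.rdeg A.N + (b.rdeg A.N + p + a'.rdeg B.N + g) + b'.rdeg B.N + g')) t₂ q := by
    intro X₀ s₁ s₂
    rw [sumSplit_comm]
    refine sumSplit_congr _ fun _ a b hab => ?_
    refine Eq.trans ?_ (sumSplit_assoc t fun _ _ a' b' t₂ =>
        k.app s₁ (a.rdeg A.N + (b.rdeg A.N + p + a'.rdeg B.N + g) + b'.rdeg B.N + g')
          (h.app a (b.rdeg A.N + p + a'.rdeg B.N + g)
          (f.app b p v a' (b.rdeg A.N + p + a'.rdeg B.N + g)) b'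
          (a.rdeg A.N + (b.rdeg A.N + p + a'.rdeg B.N + g) + b'.rdeg B.N + g')) t₂ q)
    refine sumSplit_congr _ fun _ t₁ t₂ ht => sumSplit_congr _ fun _ a' b' hab' => ?_
    have : s₂.rdeg A.N + p + t₁.rdeg B.N + (g + g')
        = a.rdeg A.N + (b.rdeg A.N + p + a'.rdeg B.N + g) + b'.rdeg B.N + g' := by
      subst hab; subst hab'; simp; ring
    rw [this]
  simp only [e₃]
  refine (sumSplit_assoc s fun _ _ s₁ a b => t.sumSplit fun _ a' r => r.sumSplit fun _ b' t₂ =>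
        k.app s₁ (a.rdeg A.N + (b.rdeg A.N + p + a'.rdeg B.N + g) + b'.rdeg B.N + g')
          (h.app a (b.rdeg A.N + p + a'.rdeg B.N + g)
          (f.app b p v a' (b.rdeg A.N + p + a'.rdeg B.N + g)) b'
          (a.rdeg A.N + (b.rdeg A.N + p + a'.rdeg B.N + g) + b'.rdeg B.N + g')) t₂ q).symm.trans ?_
  refine sumSplit_congr _ fun _ r b _ => ?_
  rw [sumSplit_comm]

/-- `f ∘ (μ^A, μ^B)` as a family of multilinear maps. -/
def bar (f : Multi A B V W g) : Multi A B V W (g + -1) where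
  app := fun s p v t q => f.barApp s p v t q
  left := fun {X X' Y' Y} p v t q => by
    refine (A.bar_multilinear (f.left p v t q)).add ?_
    intro P Q a r x x' b
    rw [← B.bar_add]
    exact B.bar_congr t fun t' _ => f.left p v t' q P Q a r x x' b
  mid := fun s p v v' t q => by
    simp only [barApp, f.mid, AInfCat.bar_add]
    abel
  right := fun {X X' Y' Y} s p v q => by
    refine IsMultilinear.add ?_ (B.bar_multilinear (f.right s p v q))
    intro P Q a r x x' b
    rw [← A.bar_add]
    exact A.bar_congr s fun s' _ => f.right s' p v q P Q a r x x' b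
  degree := fun s p v t q hq => by
    unfold barApp
    rw [A.bar_eq_zero s fun r hr => f.degree _ _ _ _ _ (by omega),
      B.bar_eq_zero t fun r hr => f.degree _ _ _ _ _ (by omega), add_zero]

/-- Since the bar differential is a coderivation, the block to which `μ` is applied lies either
among the arguments of `f` or among those of `h`. The former lowers by one the degree at which the
output of `f` is read. -/
theorem comp_barApp (f : Multi A B U V g) (h : Multi A B V W g') (v : U X' Y' p) :
    (f.comp h).barApp s p v t q
      = f.bar.compApp h s p v t q + f.compApp h.bar s p v t q := by
  have e₁ : ∀ {X X' Y' Y} (s : Str A.Hom X X') (p : ℤ) (v : U X' Y' p) (t : Str B.Hom Y' Y) (d : ℤ),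
      (f.comp h).app s p v t d = s.sumSplit fun _ s₁ s₂ => t.sumSplit fun _ t₁ t₂ =>
        h.app s₁ (s₂.rdeg A.N + p + t₁.rdeg B.N + g)
          (f.app s₂ p v t₁ (s₂.rdeg A.N + p + t₁.rdeg B.N + g)) t₂ d := fun _ _ _ _ _ => rfl
  have hs : A.bar s (fun s' => (f.comp h).app s' p v t q)
      = s.sumSplit fun _ s₁ s₂ => t.sumSplit fun _ t₁ t₂ =>
        A.bar s₁ (fun s' => h.app s' (s₂.rdeg A.N + p + t₁.rdeg B.N + g)
          (f.app s₂ p v t₁ (s₂.rdeg A.N + p + t₁.rdeg B.N + g)) t₂ q)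
        + h.app s₁ (s₂.rdeg A.N + p + t₁.rdeg B.N + (g + -1))
          (A.bar s₂ fun s' => f.app s' p v t₁ (s₂.rdeg A.N + p + t₁.rdeg B.N + (g + -1))) t₂ q := by
    simp only [e₁]
    rw [A.bar_sumSplit]
    refine sumSplit_congr _ fun _ s₁ s₂ _ => ?_
    rw [A.bar_sumSplit_comm, A.bar_sumSplit_comm, ← sumSplit_add]
    refine sumSplit_congr _ fun _ t₁ t₂ _ => congrArg₂ _ rfl ?_
    refine Eq.trans ?_ (A.map_bar (h.appHom s₁ _ t₂ q) s₂ _).symm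
    refine A.bar_congr s₂ fun r hr => ?_
    rw [hr, show s₂.rdeg A.N - 1 + p + t₁.rdeg B.N + g
      = s₂.rdeg A.N + p + t₁.rdeg B.N + (g + -1) by ring]
    rfl
  have ht : B.bar t (fun t' => (f.comp h).app s p v t' q)
      = s.sumSplit fun _ s₁ s₂ => t.sumSplit fun _ t₁ t₂ =>
        h.app s₁ (s₂.rdeg A.N + p + t₁.rdeg B.N + (g + -1))
          (B.bar t₁ fun t' => f.app s₂ p v t' (s₂.rdeg A.N + p + t₁.rdeg B.N + (g + -1))) t₂ q
        + B.bar t₂ (fun t' => h.app s₁ (s₂.rdeg A.N + p + t₁.rdeg B.N + g)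
          (f.app s₂ p v t₁ (s₂.rdeg A.N + p + t₁.rdeg B.N + g)) t' q) := by
    simp only [e₁]
    rw [B.bar_sumSplit_comm]
    refine sumSplit_congr _ fun _ s₁ s₂ _ => ?_
    rw [B.bar_sumSplit]
    refine sumSplit_congr _ fun _ t₁ t₂ _ => congrArg₂ _ ?_ rfl
    refine Eq.trans ?_ (B.map_bar (h.appHom s₁ _ t₂ q) t₁ _).symm
    refine B.bar_congr t₁ fun r hr => ?_
    rw [hr, show s₂.rdeg A.N + p + (t₁.rdeg B.N - 1) + g
      = s₂.rdeg A.N + p + t₁.rdeg B.N + (g + -1) by ring]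
    rfl
  refine (congrArg₂ _ hs ht).trans ?_
  unfold compApp
  simp only [← sumSplit_add]
  refine sumSplit_congr _ fun _ s₁ s₂ _ => sumSplit_congr _ fun _ t₁ t₂ _ => ?_
  have : f.bar.app s₂ p v t₁ = fun d => A.bar s₂ (fun s' => f.app s' p v t₁ d)
    + B.bar t₁ (fun t' => f.app s₂ p v t' d) := rfl
  rw [this]
  unfold appAt
  rw [h.mid]
  change _ = _ + (A.bar s₁ _ + B.bar t₂ _)
  abel

/-- Two differentials on the same side vanish by `AInfCat.bar_bar`; one on each side commute, and
the mixed term appears twice. -/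
theorem bar_barApp [∀ X Y p, Module (ZMod 2) (W X Y p)] (f : Multi A B V W g) (v : V X' Y' p) :
    f.bar.barApp s p v t q = 0 := by
  have e : ∀ {X X' Y' Y} (s : Str A.Hom X X') (p : ℤ) (v : V X' Y' p) (t : Str B.Hom Y' Y) (d : ℤ),
      f.bar.app s p v t d = A.bar s (fun s' => f.app s' p v t d)
        + B.bar t (fun t' => f.app s p v t' d) := fun _ _ _ _ _ => rfl
  unfold barApp
  simp only [e, AInfCat.bar_add]
  rw [A.bar_bar s (f.left p v t q), B.bar_bar t (f.right s p v q), A.bar_comm, zero_add, add_zero,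
    ZModModule.add_self]

theorem id_compApp (f : Multi A B V W g) (v : V X' Y' p) :
    (id A B V).compApp f s p v t q = f.app s p v t q := by
  unfold compApp
  rw [sumSplit_eq_left]
  · rw [sumSplit_eq_right]
    · change f.app s _ ((Pi.single p v : ∀ q, V X' Y' q) _) t q = _
      have : (nil X' : Str A.Hom X' X').rdeg A.N + p + (nil Y' : Str B.Hom Y' Y').rdeg B.N + 0 = p := by
        simp
      rw [this, Pi.single_eq_same]
    · intro Y a b hab hl
      cases a with
      | nil => subst hab; simp at hl
      | cons => exact f.app_zero _ _ _ _
  · intro Z a b hab hl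
    cases b with
    | nil => subst hab; simp at hl
    | cons => exact (sumSplit_congr _ fun _ _ _ _ => f.app_zero _ _ _ _).trans (sumSplit_zero t)

theorem compApp_id (f : Multi A B V W g) (v : V X' Y' p) :
    f.compApp (id A B W) s p v t q = f.app s p v t q := by
  unfold compApp
  rw [sumSplit_eq_right]
  · rw [sumSplit_eq_left]
    · change (Pi.single _ (f.app s p v t _) : ∀ q, W X Y q) q = _
      -- The composition reads `f` only in its prescribed degree; in all other degrees `f` vanishes
      -- anyway.
      by_cases hq : q = s.rdeg A.N + p + t.rdeg B.N + g
      · subst hq; rw [Pi.single_eq_same]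
      · rw [Pi.single_eq_of_ne hq, f.degree s p v t q hq]
    · intro Z a b hab hl
      cases b with
      | nil => subst hab; simp at hl
      | cons => rfl
  · intro Z a b hab hl
    cases a with
    | nil => subst hab; simp at hl
    | cons => exact sumSplit_zero t

end Multi

/-! ### The dg-category of bimodules -/

namespace PreMor

variable {A : AInfCat.{u, v}} {B : AInfCat.{u', v'}} {K : Bimodule.{u, u', v, v', w} A B}
  {L : Bimodule.{u, u', v, v', w'} A B} {M : Bimodule.{u, u', v, v', w''} A B} {g g' : ℤ}

/-- The differential as a pre-morphism. -/
def diff (ν : PreMor K L g) : PreMor K L (g + -1) :=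
  ν.comp L.μ + (K.μ.comp ν).cast (add_comm _ _) + ν.bar

theorem diff_apply (ν : PreMor K L g) {X X' : A.Ob} {Y' Y : B.Ob} (s : Str A.Hom X X') (p : ℤ)
    (v : K.V X' Y' p) (t : Str B.Hom Y' Y) (q : ℤ) :
    (diff ν).app s p v t q = diffApp ν s p v t q := rfl

theorem diff_add (ν ν' : PreMor K L g) : diff (ν + ν') = diff ν + diff ν' := by
  ext X X' Y' Y s p v t q
  change (ν + ν').compApp L.μ s p v t q + K.μ.compApp (ν + ν') s p v t q
    + (ν + ν').barApp s p v t q = (ν.compApp L.μ s p v t q + K.μ.compApp ν s p v t q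
    + ν.barApp s p v t q) + (ν'.compApp L.μ s p v t q + K.μ.compApp ν' s p v t q
    + ν'.barApp s p v t q)
  rw [Multi.add_compApp, Multi.compApp_add, Multi.add_barApp]
  abel

theorem isClosed_iff {ν : PreMor K L g} : IsClosed ν ↔ diff ν = 0 :=
  ⟨fun h => Multi.ext fun s p v t q => h s p v t q, fun h _ _ _ _ s p v t q => by
    rw [← diff_apply, h]; rfl⟩

theorem diffApp_cast (ν : PreMor K L g) (e : g = g') {X X' : A.Ob} {Y' Y : B.Ob}
    (s : Str A.Hom X X') (p : ℤ) (v : K.V X' Y' p) (t : Str B.Hom Y' Y) (q : ℤ) :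
    diffApp (K := K) (L := L) (ν.cast e) s p v t q = diffApp ν s p v t q := by
  subst e; rfl

theorem isClosed_cast {ν : PreMor K L g} (e : g = g') :
    IsClosed (K := K) (L := L) (ν.cast e) ↔ IsClosed ν := by
  subst e; rfl

theorem mu_bar_app (K : Bimodule.{u, u', v, v', w} A B) {X X' : A.Ob} {Y' Y : B.Ob}
    (s : Str A.Hom X X') (p : ℤ) (v : K.V X' Y' p) (t : Str B.Hom Y' Y) (q : ℤ) :
    K.μ.compApp K.μ s p v t q = K.μ.barApp s p v t q :=
  (eq_neg_of_add_eq_zero_left (K.rel s p v t q)).trans (ZModModule.neg_eq_self _)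

/-- The bimodule relation in characteristic two, in the form that trades terms quadratic in `μ` for
bar terms. This is what makes differentials square to zero below. -/
theorem mu_comp_mu (K : Bimodule.{u, u', v, v', w} A B) : K.μ.comp K.μ = K.μ.bar :=
  Multi.ext fun s p v t q => mu_bar_app K s p v t q

/-- The Leibniz rule. -/
theorem diffApp_comp (f : PreMor K L g) (h : PreMor L M g') {X X' : A.Ob} {Y' Y : B.Ob}
    (s : Str A.Hom X X') (p : ℤ) (v : K.V X' Y' p) (t : Str B.Hom Y' Y) (q : ℤ) :
    diffApp (K := K) (L := M) (f.comp h) s p v t q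
      = (diff f).compApp h s p v t q + f.compApp (diff h) s p v t q := by
  -- The structure map of the middle bimodule `L` enters through both `d f` and `d h`, and these
  -- contributions cancel.
  have e₁ : f.compApp (L.μ.comp h) s p v t q + f.compApp (L.μ.comp h) s p v t q = 0 :=
    ZModModule.add_self _
  have e₂ : (diff f).compApp h s p v t q = (f.comp L.μ).compApp h s p v t q
      + (K.μ.comp f).compApp h s p v t q + f.bar.compApp h s p v t q := by
    unfold diff
    rw [Multi.add_compApp, Multi.add_compApp, Multi.cast_compApp]
  have e₃ : f.compApp (diff h) s p v t q = f.compApp (h.comp M.μ) s p v t q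
      + f.compApp (L.μ.comp h) s p v t q + f.compApp h.bar s p v t q := by
    unfold diff
    rw [Multi.compApp_add, Multi.compApp_add, Multi.compApp_cast]
  unfold diffApp
  rw [e₂, e₃, Multi.comp_barApp, Multi.comp_compApp, Multi.comp_compApp, Multi.comp_compApp]
  calc _ = f.compApp (h.comp M.μ) s p v t q + K.μ.compApp (f.comp h) s p v t q
        + (f.bar.compApp h s p v t q + f.compApp h.bar s p v t q)
        + (f.compApp (L.μ.comp h) s p v t q + f.compApp (L.μ.comp h) s p v t q) := by
          rw [e₁, add_zero]
    _ = _ := by abel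

theorem IsClosed.comp {f : PreMor K L g} {h : PreMor L M g'} (hf : IsClosed f) (hh : IsClosed h) :
    IsClosed (K := K) (L := M) (f.comp h) := by
  intro X X' Y' Y s p v t q
  rw [diffApp_comp, Multi.compApp_of_left_eq_zero _ _ _ _ _ _ _ fun s p v t q => hf s p v t q,
    Multi.compApp_of_app_eq_zero _ _ _ _ _ _ _ fun s p v t => hh s p v t q, add_zero]

/-- After expansion every term occurs twice. The terms with `μ^L ∘ μ^L` and `μ^K ∘ μ^K` find their
partners among the bar terms by `mu_comp_mu`. -/
theorem diffApp_diff (ν : PreMor K L g) {X X' : A.Ob} {Y' Y : B.Ob}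
    (s : Str A.Hom X X') (p : ℤ) (v : K.V X' Y' p) (t : Str B.Hom Y' Y) (q : ℤ) :
    diffApp (diff ν) s p v t q = 0 := by
  have e₁ : (diff ν).compApp L.μ s p v t q = ν.compApp (L.μ.comp L.μ) s p v t q
      + K.μ.compApp (ν.comp L.μ) s p v t q + ν.bar.compApp L.μ s p v t q := by
    unfold diff
    rw [Multi.add_compApp, Multi.add_compApp, Multi.cast_compApp, Multi.comp_compApp,
      Multi.comp_compApp]
  have e₂ : K.μ.compApp (diff ν) s p v t q = K.μ.compApp (ν.comp L.μ) s p v t q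
      + (K.μ.comp K.μ).compApp ν s p v t q + K.μ.compApp ν.bar s p v t q := by
    unfold diff
    rw [Multi.compApp_add, Multi.compApp_add, Multi.compApp_cast, Multi.comp_compApp]
  have e₃ : (diff ν).barApp s p v t q = (ν.bar.compApp L.μ s p v t q
      + ν.compApp L.μ.bar s p v t q) + (K.μ.bar.compApp ν s p v t q
      + K.μ.compApp ν.bar s p v t q) + ν.bar.barApp s p v t q := by
    unfold diff
    rw [Multi.add_barApp, Multi.add_barApp, Multi.comp_barApp]
    exact congrArg₂ _ (congrArg₂ _ rfl (Multi.comp_barApp _ _ _ _ _ _ _)) rfl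
  unfold diffApp
  rw [e₁, e₂, e₃, Multi.bar_barApp, mu_comp_mu, mu_comp_mu]
  have h := fun x : L.V X Y q => ZModModule.add_self x
  calc _ = (ν.compApp L.μ.bar s p v t q + ν.compApp L.μ.bar s p v t q)
        + (K.μ.compApp (ν.comp L.μ) s p v t q + K.μ.compApp (ν.comp L.μ) s p v t q)
        + (ν.bar.compApp L.μ s p v t q + ν.bar.compApp L.μ s p v t q)
        + (K.μ.bar.compApp ν s p v t q + K.μ.bar.compApp ν s p v t q)
        + (K.μ.compApp ν.bar s p v t q + K.μ.compApp ν.bar s p v t q) := by abel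
    _ = 0 := by simp only [h]

end PreMor

/-! ### The dual Hochschild complex and its functoriality -/

namespace HochDual

variable {A : AInfCat.{u, v}} {M : Bimodule.{u, u, v, v, w} A A}
  {M' : Bimodule.{u, u, v, v, w'} A A} {M'' : Bimodule.{u, u, v, v, w''} A A} {n n' g g' : ℤ}

@[ext] theorem ext {σ τ : HochDual A M n}
    (e : ∀ {X Y} (s : Str A.Hom X Y) (p : ℤ) (z : M.V Y X p), σ.app s p z = τ.app s p z) :
    σ = τ := by
  have : @σ.app = @τ.app := by
    funext X Y s p z; exact e s p z
  cases σ; cases τ; congr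

instance : Zero (HochDual A M n) where
  zero := ⟨fun _ _ _ => 0, fun _ _ => .zero, fun _ _ _ _ => rfl, fun _ _ _ _ => rfl⟩

instance : Add (HochDual A M n) where
  add σ τ := ⟨fun s p z => σ.app s p z + τ.app s p z,
    fun p z => (σ.left p z).add (τ.left p z),
    fun s p z z' => by rw [σ.right, τ.right]; abel,
    fun s p z h => by rw [σ.degree s p z h, τ.degree s p z h, add_zero]⟩

instance : Neg (HochDual A M n) where
  neg σ := σ

instance : AddCommGroup (HochDual A M n) where
  add_assoc _ _ _ := ext fun _ _ _ => add_assoc _ _ _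
  zero_add _ := ext fun _ _ _ => zero_add _
  add_zero _ := ext fun _ _ _ => add_zero _
  nsmul := nsmulRec
  zsmul := zsmulRec
  neg_add_cancel _ := ext fun _ _ _ => ZModModule.add_self _
  add_comm _ _ := ext fun _ _ _ => add_comm _ _

variable {X Y : A.Ob} (s : Str A.Hom X Y) (p : ℤ)

@[simp] theorem add_apply (σ τ : HochDual A M n) (z : M.V Y X p) :
    (σ + τ).app s p z = σ.app s p z + τ.app s p z := rfl

/-- Evaluation as a homomorphism. -/
def evalHom (z : M.V Y X p) : HochDual A M n →+ ZMod 2 :=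
  AddMonoidHom.mk' (fun σ => σ.app s p z) (fun _ _ => rfl)

theorem sum_apply {ι : Type*} (S : Finset ι) (f : ι → HochDual A M n) (z : M.V Y X p) :
    (∑ i ∈ S, f i).app s p z = ∑ i ∈ S, (f i).app s p z :=
  map_sum (evalHom (n := n) s p z) f S

/-- `σ ∘ ν` for a family of multilinear maps `ν`. -/
def mapApp (ν : PreMor M M' g) (σ : HochDual A M' n) (z : M.V Y X p) : ZMod 2 :=
  s.sumSplit₃ fun _ _ s₁ s₂ s₃ =>
    σ.appAt s₂ (s₃.rdeg A.N + p + s₁.rdeg A.N + g) (ν.app s₃ p z s₁)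

theorem mapDual_apply (ν : PreMor M M' g) (σ : HochDual A M' n) (z : M.V Y X p) :
    (mapDual ν σ).app s p z = mapApp s p ν σ z := rfl

theorem mapApp_add_left (ν ν' : PreMor M M' g) (σ : HochDual A M' n) (z : M.V Y X p) :
    mapApp s p (ν + ν') σ z = mapApp s p ν σ z + mapApp s p ν' σ z := by
  unfold mapApp appAt
  rw [← sumSplit₃_add]
  exact sumSplit₃_congr s fun _ _ _ _ _ _ => σ.right _ _ _ _

theorem mapApp_add (ν : PreMor M M' g) (σ σ' : HochDual A M' n) (z : M.V Y X p) :
    mapApp s p ν (σ + σ') z = mapApp s p ν σ z + mapApp s p ν σ' z := by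
  unfold mapApp
  rw [← sumSplit₃_add]
  rfl

theorem mapApp_cast_left (ν : PreMor M M' g) (e : g = g') (σ : HochDual A M' n) (z : M.V Y X p) :
    mapApp (M := M) (M' := M') s p (ν.cast e) σ z = mapApp s p ν σ z := by
  subst e; rfl

theorem mapApp_of_left_eq_zero (ν : PreMor M M' g) (σ : HochDual A M' n) (z : M.V Y X p)
    (hν : ∀ {X X' Y' Y} (s : Str A.Hom X X') (p : ℤ) (v : M.V X' Y' p) (t : Str A.Hom Y' Y) (q : ℤ),
      ν.app s p v t q = 0) : mapApp s p ν σ z = 0 := by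
  unfold mapApp appAt
  simp only [hν, σ.app_zero, sumSplit₃_zero]

theorem mapApp_of_eq_zero (ν : PreMor M M' g) (σ : HochDual A M' n) (z : M.V Y X p)
    (hσ : ∀ {X Y} (s : Str A.Hom X Y) (p : ℤ) (z : M'.V Y X p), σ.app s p z = 0) :
    mapApp s p ν σ z = 0 := by
  unfold mapApp appAt
  simp only [hσ, sumSplit₃_zero]

/-- Both sides are sums over cuts `s = c ⊗ d ⊗ s₂ ⊗ a ⊗ b`. In the cyclic word, `f` takes `b, z, c`,
then `h` takes `a`, the output of `f`, and `d`, and `σ` is evaluated on `s₂` and the result. -/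
theorem mapApp_comp (f : PreMor M M' g) (h : PreMor M' M'' g') (σ : HochDual A M'' n)
    (z : M.V Y X p) :
    mapApp (M := M) (M' := M'') s p (f.comp h) σ z = mapApp s p f (mapDual h σ) z := by
  have e₁ : ∀ {X X' Y' Y} (s : Str A.Hom X X') (p : ℤ) (v : M.V X' Y' p) (t : Str A.Hom Y' Y)
      (d : ℤ), (f.comp h).app s p v t d = s.sumSplit fun _ s₁ s₂ => t.sumSplit fun _ t₁ t₂ =>
        h.app s₁ (s₂.rdeg A.N + p + t₁.rdeg A.N + g)
          (f.app s₂ p v t₁ (s₂.rdeg A.N + p + t₁.rdeg A.N + g)) t₂ d := fun _ _ _ _ _ => rfl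
  let H : ∀ U₁ U₂ U₃ U₄ : A.Ob, Str A.Hom X U₁ → Str A.Hom U₁ U₂ → Str A.Hom U₂ U₃ →
      Str A.Hom U₃ U₄ → Str A.Hom U₄ Y → ZMod 2 := fun U₁ U₂ U₃ U₄ c d s₂ a b =>
    σ.app s₂ (a.rdeg A.N + (b.rdeg A.N + p + c.rdeg A.N + g) + d.rdeg A.N + g')
      (h.app a (b.rdeg A.N + p + c.rdeg A.N + g)
        (f.app b p z c (b.rdeg A.N + p + c.rdeg A.N + g)) d
        (a.rdeg A.N + (b.rdeg A.N + p + c.rdeg A.N + g) + d.rdeg A.N + g'))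
  have hR : mapApp s p f (mapDual h σ) z = s.sumSplit fun U₁ c r => r.sumSplit fun U₂ d r =>
      r.sumSplit fun U₃ s₂ r => r.sumSplit fun U₄ a b => H U₁ U₂ U₃ U₄ c d s₂ a b := by
    refine sumSplit_congr s fun U₁ c r _ => ?_
    refine (sumSplit_assoc r fun U₂ U₄ d r' b => r'.sumSplit fun U₃ s₂ a =>
      H U₁ U₂ U₃ U₄ c d s₂ a b).trans ?_
    refine sumSplit_congr r fun U₂ d r _ => ?_
    exact sumSplit_assoc r fun U₃ U₄ s₂ a b => H U₁ U₂ U₃ U₄ c d s₂ a b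
  rw [hR]
  have hL : mapApp (M := M) (M' := M'') s p (f.comp h) σ z = s.sumSplit fun U₂ s₁ r =>
      r.sumSplit fun U₃ s₂ s₃ => s₁.sumSplit fun U₁ c d => s₃.sumSplit fun U₄ a b =>
        H U₁ U₂ U₃ U₄ c d s₂ a b := by
    refine sumSplit₃_congr s fun U₂ U₃ s₁ s₂ s₃ _ => ?_
    unfold appAt
    rw [e₁, sumSplit_comm]
    refine (map_sumSplit (σ.appHom s₂ _) s₁ _).trans ?_
    refine sumSplit_congr s₁ fun _ c d hcd => ?_
    refine (map_sumSplit (σ.appHom s₂ _) s₃ _).trans ?_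
    refine sumSplit_congr s₃ fun _ a b hab => ?_
    have : s₃.rdeg A.N + p + s₁.rdeg A.N + (g + g')
        = a.rdeg A.N + (b.rdeg A.N + p + c.rdeg A.N + g) + d.rdeg A.N + g' := by
      subst hcd; subst hab; simp; ring
    rw [this]; rfl
  rw [hL]
  refine (sumSplit_congr s fun U₂ s₁ r _ => sumSplit_comm r s₁ _).trans ?_
  exact sumSplit_assoc s fun U₁ U₂ c d r => r.sumSplit fun U₃ s₂ s₃ => s₃.sumSplit fun U₄ a b =>
    H U₁ U₂ U₃ U₄ c d s₂ a b

/-- The part of the dual Hochschild differential that involves only `μ^A`. -/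
def barDual (σ : HochDual A M n) : HochDual A M (n + -1) where
  app := fun s p z => A.bar s (fun r => σ.app r p z)
  left := fun p z => A.bar_multilinear (σ.left p z)
  right := fun s p z z' => by simp only [σ.right, AInfCat.bar_add]
  degree := fun s p z h => A.bar_eq_zero s fun r hr => σ.degree _ _ _ (by omega)

/-- The block to which `μ` is applied lies in one of the three pieces of `s`. The outer pieces are
arguments of `ν` and give `ν.bar`; the middle one is an argument of `σ` and gives `σ.barDual`. -/
theorem bar_mapApp (ν : PreMor M M' g) (σ : HochDual A M' n) (z : M.V Y X p) :
    A.bar s (fun r => mapApp r p ν σ z)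
      = mapApp (M := M) (M' := M') s p ν.bar σ z + mapApp s p ν σ.barDual z := by
  unfold mapApp
  rw [A.bar_sumSplit₃, ← sumSplit₃_add]
  refine sumSplit₃_congr s fun _ _ s₁ s₂ s₃ _ => ?_
  have e : ∀ d, ν.bar.app s₃ p z s₁ d = A.bar s₃ (fun r => ν.app r p z s₁ d)
    + A.bar s₁ (fun r => ν.app s₃ p z r d) := fun _ => rfl
  unfold appAt
  rw [e, σ.right]
  have h₁ : A.bar s₁ (fun a' => σ.app s₂ (s₃.rdeg A.N + p + a'.rdeg A.N + g)
      (ν.app s₃ p z a' (s₃.rdeg A.N + p + a'.rdeg A.N + g)))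
      = σ.app s₂ (s₃.rdeg A.N + p + s₁.rdeg A.N + (g + -1))
        (A.bar s₁ fun r => ν.app s₃ p z r (s₃.rdeg A.N + p + s₁.rdeg A.N + (g + -1))) := by
    refine Eq.trans ?_ (A.map_bar (σ.appHom s₂ _) s₁ _).symm
    refine A.bar_congr s₁ fun r hr => ?_
    rw [hr, show s₃.rdeg A.N + p + (s₁.rdeg A.N - 1) + g
      = s₃.rdeg A.N + p + s₁.rdeg A.N + (g + -1) by ring]
    rfl
  have h₃ : A.bar s₃ (fun a' => σ.app s₂ (a'.rdeg A.N + p + s₁.rdeg A.N + g)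
      (ν.app a' p z s₁ (a'.rdeg A.N + p + s₁.rdeg A.N + g)))
      = σ.app s₂ (s₃.rdeg A.N + p + s₁.rdeg A.N + (g + -1))
        (A.bar s₃ fun r => ν.app r p z s₁ (s₃.rdeg A.N + p + s₁.rdeg A.N + (g + -1))) := by
    refine Eq.trans ?_ (A.map_bar (σ.appHom s₂ _) s₃ _).symm
    refine A.bar_congr s₃ fun r hr => ?_
    rw [hr, show s₃.rdeg A.N - 1 + p + s₁.rdeg A.N + g
      = s₃.rdeg A.N + p + s₁.rdeg A.N + (g + -1) by ring]
    rfl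
  rw [h₁, h₃]
  have h₂ : ∀ d z', σ.barDual.app s₂ d z' = A.bar s₂ (fun r => σ.app r d z') := fun _ _ => rfl
  rw [h₂]
  abel

/-- The dual Hochschild differential. -/
def diff (σ : HochDual A M n) : HochDual A M (n + -1) :=
  σ.barDual + mapDual M.μ σ

theorem diff_apply (σ : HochDual A M n) (z : M.V Y X p) :
    σ.diff.app s p z = A.bar s (fun r => σ.app r p z) + mapApp s p M.μ σ z := rfl

theorem diff_add (σ τ : HochDual A M n) : (σ + τ).diff = σ.diff + τ.diff := by
  ext X Y s p z
  simp only [diff_apply, add_apply, AInfCat.bar_add, mapApp_add]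
  abel

theorem isClosed_iff {σ : HochDual A M n} : σ.IsClosed ↔ σ.diff = 0 := by
  constructor
  · intro h
    ext X Y s p z
    exact h s p z
  · intro h X Y s p z
    exact (congrArg (fun τ : HochDual A M (n + -1) => τ.app s p z) h :)

/-- Compatibility of `ν_*` with differentials up to the differential of `ν`. Composition of `ν` with
the structure map of `M'` is part of both terms on the right and cancels. -/
theorem diff_mapDual (ν : PreMor M M' g) (σ : HochDual A M' n) (z : M.V Y X p) :
    (mapDual ν σ).diff.app s p z
      = mapApp (M := M) (M' := M') s p (PreMor.diff ν) σ z + mapApp s p ν σ.diff z := by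
  rw [diff_apply]
  simp only [mapDual_apply, bar_mapApp]
  unfold diff PreMor.diff
  rw [mapApp_add, mapApp_add_left, mapApp_add_left, mapApp_cast_left, mapApp_comp, mapApp_comp]
  have h := ZModModule.add_self (mapApp s p ν (mapDual M'.μ σ) z)
  calc _ = mapApp (M := M) (M' := M') s p ν.bar σ z + mapApp s p ν σ.barDual z
      + mapApp s p M.μ (mapDual ν σ) z
      + (mapApp s p ν (mapDual M'.μ σ) z + mapApp s p ν (mapDual M'.μ σ) z) := by rw [h, add_zero]
    _ = _ := by abel

/-- An instance of `diff_mapDual` with `ν` the structure map of `M`: as a pre-morphism, its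
differential reduces to `M.μ.bar`, since the two composites `μ ∘ μ` cancel. -/
theorem diff_diff (σ : HochDual A M n) : σ.diff.diff = 0 := by
  ext X Y s p z
  have h₁ : σ.diff.diff.app s p z = (mapDual M.μ σ).diff.app s p z
      + (A.bar s (fun r => A.bar r fun r => σ.app r p z) + mapApp s p M.μ σ.barDual z) := by
    have e : σ.diff = mapDual M.μ σ + σ.barDual := add_comm _ _
    rw [e, diff_add]
    rfl
  have h₂ : mapApp (M := M) (M' := M) s p (PreMor.diff (K := M) (L := M) M.μ) σ z
      = mapApp (M := M) (M' := M) s p M.μ.bar σ z := by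
    unfold PreMor.diff
    rw [mapApp_add_left, mapApp_add_left, mapApp_cast_left, ZModModule.add_self, zero_add]
  rw [h₁, A.bar_bar s (σ.left p z), diff_mapDual, h₂]
  unfold diff
  rw [mapApp_add, ← mapApp_comp, PreMor.mu_comp_mu]
  have := fun x : ZMod 2 => ZModModule.add_self x
  calc _ = (mapApp (M := M) (M' := M) s p M.μ.bar σ z + mapApp (M := M) (M' := M) s p M.μ.bar σ z)
      + (mapApp s p M.μ σ.barDual z + mapApp s p M.μ σ.barDual z) := by abel
    _ = 0 := by rw [this, this, add_zero]

theorem IsClosed.mapDual {ν : PreMor M M' g} {σ : HochDual A M' n} (hσ : σ.IsClosed)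
    (hν : PreMor.IsClosed ν) : (mapDual ν σ).IsClosed := by
  rw [isClosed_iff]
  ext X Y s p z
  rw [diff_mapDual, PreMor.isClosed_iff.1 hν, isClosed_iff.1 hσ,
    mapApp_of_left_eq_zero _ _ _ _ _ fun _ _ _ _ _ => rfl,
    mapApp_of_eq_zero _ _ _ _ _ fun _ _ _ => rfl]
  rfl

end HochDual

/-! ## Linear algebra -/

theorem eq_of_add_eq_zero_of_charTwo {G : Type*} [AddCommGroup G] [Module (ZMod 2) G] {x y : G}
    (h : x + y = 0) : x = y :=
  (eq_neg_of_add_eq_zero_left h).trans (ZModModule.neg_eq_self _)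

/-- Over a field the map onto the range has a linear section, and the section extends linearly to
all of `W`. -/
theorem LinearMap.exists_generalizedInverse {k V W : Type*} [Field k] [AddCommGroup V]
    [AddCommGroup W] [Module k V] [Module k W] (T : V →ₗ[k] W) :
    ∃ ρ : W →ₗ[k] V, ∀ x, T (ρ (T x)) = T x := by
  obtain ⟨r, hr⟩ := T.rangeRestrict.exists_rightInverse_of_surjective T.range_rangeRestrict
  obtain ⟨ρ, hρ⟩ := r.exists_extend
  refine ⟨ρ, fun x => ?_⟩
  have h₁ : ρ (T x) = r (T.rangeRestrict x) := LinearMap.congr_fun hρ (T.rangeRestrict x)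
  have h₂ : T.rangeRestrict (r (T.rangeRestrict x)) = T.rangeRestrict x :=
    LinearMap.congr_fun hr (T.rangeRestrict x)
  rw [h₁]
  exact congrArg Subtype.val h₂

/-- Over a field, an endomorphism of a complex that vanishes on homology is null-homotopic. -/
theorem exists_homotopy_of_map_cycles_le_boundaries {k : Type*} [Field k] {C : ℤ → Type*}
    [∀ p, AddCommGroup (C p)] [∀ p, Module k (C p)] (d : ∀ p q, C p →ₗ[k] C q)
    (hdd : ∀ p x, d p (p - 1) (d (p + 1) p x) = 0) (f : ∀ p, C p →ₗ[k] C p)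
    (hfd : ∀ p x, f p (d (p + 1) p x) = d (p + 1) p (f (p + 1) x))
    (hf : ∀ p x, d p (p - 1) x = 0 → ∃ y, d (p + 1) p y = f p x) :
    ∃ H : ∀ p q, C p →ₗ[k] C q, ∀ p x, d (p + 1) p (H p (p + 1) x) + H (p - 1) p (d p (p - 1) x) = f p x := by
  choose r hr using fun p q => (d q p).exists_generalizedInverse
  -- `c p` maps into the cycles: it removes from `x` the chosen preimage of `d x`.
  let c : ∀ p, C p →ₗ[k] C p := fun p => LinearMap.id - r (p - 1) p ∘ₗ d p (p - 1)
  -- The cycle `c x` is the sum of the boundary `d r c x` and a cycle representing its homology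
  -- class. On the boundary part `f` is applied after choosing a preimage; on the remaining cycle
  -- `f` takes a boundary as its value, and a preimage is chosen afterwards. Thus `d K x = f (c x)`,
  -- and `K d x = f (r d x)` supplies the rest of `f x`.
  let K : ∀ p q, C p →ₗ[k] C q := fun p q =>
    f q ∘ₗ r p q ∘ₗ d q p ∘ₗ r p q ∘ₗ c p + r p q ∘ₗ f p ∘ₗ (c p - d q p ∘ₗ r p q ∘ₗ c p)
  have hK : ∀ p q x, K p q x = f q (r p q (d q p (r p q (c p x))))
    + r p q (f p (c p x - d q p (r p q (c p x)))) := fun p q x => rfl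
  have hc : ∀ p x, c p x = x - r (p - 1) p (d p (p - 1) x) := fun p x => rfl
  have hdc : ∀ p x, d p (p - 1) (c p x) = 0 := fun p x => by
    rw [hc, map_sub, hr, sub_self]
  have hdd' : ∀ p x, d (p - 1) (p - 1 - 1) (d p (p - 1) x) = 0 := fun p x => by
    have := fun p' (h : p' = p - 1 + 1) (x : C p') => (by
      subst h; exact hdd (p - 1) x : d (p - 1) (p - 1 - 1) (d p' (p - 1) x) = 0)
    exact this p (by ring) x
  refine ⟨K, fun p x => ?_⟩
  rw [hK, hK, map_add, ← hfd, hr]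
  have h₁ : c (p - 1) (d p (p - 1) x) = d p (p - 1) x := by
    rw [hc, hdd', map_zero, sub_zero]
  rw [h₁, hr, sub_self, map_zero, map_zero, add_zero]
  obtain ⟨y, hy⟩ := hf p (c p x - d (p + 1) p (r p (p + 1) (c p x)))
    (by rw [map_sub, hdc, hdd, sub_zero])
  rw [← hy, hr, hy, ← map_add, ← map_add, hc]
  congr 1
  abel

/-! ## Convergence -/

/-- Solving `D₁ u = f` by successive approximation. -/
theorem exists_preimage_of_filtration {E₁ E₀ E₂ : Type*} [AddCommGroup E₁] [AddCommGroup E₀]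
    [AddCommGroup E₂] (D₁ : E₁ →+ E₀) (D₀ : E₀ →+ E₂) (hD : ∀ x, D₀ (D₁ x) = 0)
    (F₁ : ℕ → AddSubgroup E₁) (F₀ : ℕ → AddSubgroup E₀) (P : E₀ → E₁)
    (hF : ∀ x, x ∈ F₀ 0) (hanti : ∀ k, F₀ (k + 1) ≤ F₀ k) (hsep : ∀ x, (∀ k, x ∈ F₀ k) → x = 0)
    (hDF : ∀ k, ∀ x ∈ F₁ k, D₁ x ∈ F₀ k) (hP : ∀ k, ∀ f ∈ F₀ (k + 1), P f ∈ F₁ k)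
    (hstep : ∀ k, ∀ f ∈ F₀ k, D₀ f = 0 → f - D₁ (P f) ∈ F₀ (k + 1))
    (hcomplete : ∀ p : ℕ → E₁, (∀ k, p (k + 1) ∈ F₁ k) →
      ∃ u, ∀ n, u - ∑ k ∈ Finset.range (n + 1), p k ∈ F₁ n)
    (f : E₀) (hf : D₀ f = 0) : ∃ u, D₁ u = f := by
  -- `a n` is the error left after `n` corrections; each correction `P (a n)` moves the error one
  -- filtration step further.
  let a : ℕ → E₀ := fun n => n.rec f fun _ x => x - D₁ (P x)
  have ha : ∀ n, a (n + 1) = a n - D₁ (P (a n)) := fun _ => rfl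
  have hcl : ∀ n, D₀ (a n) = 0 := by
    intro n
    induction n with
    | zero => exact hf
    | succ n ih => rw [ha, map_sub, ih, hD, sub_zero]
  have hmem : ∀ n, a n ∈ F₀ n := by
    intro n
    induction n with
    | zero => exact hF _
    | succ n ih => exact hstep n _ ih (hcl n)
  have hsum : ∀ n, f - D₁ (∑ k ∈ Finset.range n, P (a k)) = a n := by
    intro n
    induction n with
    | zero => exact (congrArg (f - ·) (map_zero D₁)).trans (sub_zero f)
    | succ n ih => rw [Finset.sum_range_succ, map_add, ← sub_sub, ih, ha]
  -- `P` may lose one filtration step, so the corrections satisfy `P (a (k + 1)) ∈ F₁ k`; this is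
  -- still enough for the series to converge.
  obtain ⟨u, hu⟩ := hcomplete (fun k => P (a k)) fun k => hP k _ (hmem (k + 1))
  refine ⟨u, sub_eq_zero.1 (hsep _ fun n => ?_)⟩
  -- Modulo `F₀ n` the solution `u` may be replaced by its partial sum, whose error `a (n + 1)` also
  -- lies in `F₀ n`; separatedness then concludes.
  have h₁ := hDF n _ (hu n)
  have h₂ : a (n + 1) ∈ F₀ n := hanti n (hmem (n + 1))
  have h₃ : D₁ u - f = D₁ (u - ∑ k ∈ Finset.range (n + 1), P (a k)) - a (n + 1) := by
    rw [← hsum (n + 1), map_sub]; abel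
  rw [h₃]
  exact sub_mem h₁ h₂

/-! ### Weight filtrations on pre-morphisms and their completeness -/

namespace Multi

variable {A : AInfCat.{u, v}} {B : AInfCat.{u', v'}}
  {V : A.Ob → B.Ob → ℤ → Type w} {W : A.Ob → B.Ob → ℤ → Type w'}
  [∀ X Y p, AddCommGroup (V X Y p)] [∀ X Y p, AddCommGroup (W X Y p)] {g : ℤ}

/-- The families vanishing on all inputs of weight less than `n`, where `ω k m` is the weight of an
input with `k` and `m` entries on the left and on the right. -/
def filtration (A : AInfCat.{u, v}) (B : AInfCat.{u', v'}) (V : A.Ob → B.Ob → ℤ → Type w)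
    (W : A.Ob → B.Ob → ℤ → Type w') [∀ X Y p, AddCommGroup (V X Y p)]
    [∀ X Y p, AddCommGroup (W X Y p)] (g : ℤ) (ω : ℕ → ℕ → ℕ) (n : ℕ) :
    AddSubgroup (Multi A B V W g) where
  carrier := {f | ∀ {X X' Y' Y} (s : Str A.Hom X X') (p : ℤ) (v : V X' Y' p) (t : Str B.Hom Y' Y)
    (q : ℤ), ω s.length t.length < n → f.app s p v t q = 0}
  zero_mem' := fun _ _ _ _ _ _ => rfl
  add_mem' := fun hf hh _ _ _ _ s p v t q hn => by
    rw [add_apply, hf s p v t q hn, hh s p v t q hn, add_zero]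
  neg_mem' := fun {f} hf _ _ _ _ s p v t q hn => by
    change -(f.app s p v t q) = 0
    rw [hf s p v t q hn, neg_zero]

/-- The infinite sum makes sense pointwise: on an input of given weight all but finitely many
summands vanish. No direct sum condition is imposed on pre-morphisms, so the result is again
admissible. -/
theorem exists_sum (ω : ℕ → ℕ → ℕ) (f : ℕ → Multi A B V W g)
    (hf : ∀ k, f (k + 1) ∈ filtration A B V W g ω k) :
    ∃ u, ∀ n, u - ∑ k ∈ Finset.range (n + 1), f k ∈ filtration A B V W g ω n := by
  -- A summand `f i` can be non-zero on an input of weight `ω` only if `i ≤ ω + 1`, which explains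
  -- the range `ω + 2`.
  refine ⟨⟨fun s p v t q => (∑ k ∈ Finset.range (ω s.length t.length + 2), f k).app s p v t q,
    fun p v t q P Q a r x x' b => ?_, fun s p v v' t q => Multi.mid _ s p v v' t q,
    fun s p v q P Q a r x x' b => ?_, fun s p v t q h => Multi.degree _ s p v t q h⟩,
    fun n _ _ _ _ s p v t q hn => ?_⟩
  · simp only [length_append, length_cons]
    exact Multi.left _ p v t q P Q a r x x' b
  · simp only [length_append, length_cons]
    exact Multi.right _ s p v q P Q a r x x' b
  · rw [sub_apply, sub_eq_zero]
    change (∑ k ∈ Finset.range (ω s.length t.length + 2), f k).app s p v t q = _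
    rw [sum_apply, sum_apply]
    refine Finset.sum_subset (Finset.range_mono (by omega)) fun k _ hk => ?_
    rw [Finset.mem_range, not_lt] at hk
    obtain ⟨k, rfl⟩ := Nat.exists_eq_add_of_le' (show 1 ≤ k by omega)
    exact hf k s p v t q (by omega)

end Multi

namespace HochDual

variable {A : AInfCat.{u, v}} {M : Bimodule.{u, u, v, v, w} A A} {n : ℤ}

/-- The functionals vanishing on all inputs of weight less than `k`. -/
def filtration (A : AInfCat.{u, v}) (M : Bimodule.{u, u, v, v, w} A A) (n : ℤ) (ω : ℕ → ℕ)
    (k : ℕ) : AddSubgroup (HochDual A M n) where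
  carrier := {σ | ∀ {X Y} (s : Str A.Hom X Y) (p : ℤ) (z : M.V Y X p),
    ω s.length < k → σ.app s p z = 0}
  zero_mem' := fun _ _ _ _ => rfl
  add_mem' := fun hf hh _ _ s p z hn => by
    rw [add_apply, hf s p z hn, hh s p z hn, add_zero]
  neg_mem' := fun hf => hf

theorem exists_sum (ω : ℕ → ℕ) (f : ℕ → HochDual A M n)
    (hf : ∀ k, f (k + 1) ∈ filtration A M n ω k) :
    ∃ u, ∀ k, u - ∑ i ∈ Finset.range (k + 1), f i ∈ filtration A M n ω k := by
  refine ⟨⟨fun s p z => (∑ k ∈ Finset.range (ω s.length + 2), f k).app s p z,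
    fun p z P Q a r x x' b => ?_, fun s p z z' => HochDual.right _ s p z z',
    fun s p z h => HochDual.degree _ s p z h⟩, fun n _ _ s p z hn => ?_⟩
  · simp only [length_append, length_cons]
    exact HochDual.left _ p z P Q a r x x' b
  · refine (map_sub (evalHom s p z) _ _).trans (sub_eq_zero.2 ?_)
    change (∑ k ∈ Finset.range (ω s.length + 2), f k).app s p z
      = (∑ k ∈ Finset.range (n + 1), f k).app s p z
    rw [sum_apply, sum_apply]
    refine Finset.sum_subset (Finset.range_mono (by omega)) fun k _ hk => ?_
    rw [Finset.mem_range, not_lt] at hk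
    obtain ⟨k, rfl⟩ := Nat.exists_eq_add_of_le' (show 1 ≤ k by omega)
    exact hf k s p z (by omega)

end HochDual

/-! ## Homology units act homotopically as the identity -/

namespace Bimodule

variable {A : AInfCat.{u, v}} {B : AInfCat.{u', v'}} (M : Bimodule.{u, u', v, v', w} A B)

theorem leibniz_left (X X' : A.Ob) (Y : B.Ob) (p r : ℤ) (x : A.Hom X X' p) (z : M.V X' Y r)
    (e q : ℤ) (he : e = p + (1 - A.N) + r - 1) :
    M.d X Y e q (M.μ.app (cons p x (nil X')) r z (nil Y) e)
      + M.μ.app (cons p x (nil X')) (r - 1) (M.d X' Y r (r - 1) z) (nil Y) q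
      + M.μ.app (cons (p - 1) (A.diag.d X X' p (p - 1) x) (nil X')) r z (nil Y) q = 0 := by
  have h := M.rel (cons p x (nil X')) r z (nil Y) q
  unfold Multi.barApp at h
  rw [A.bar_single p x (M.μ.left r z (nil Y) q), B.bar_nil (M.μ.right _ r z q), add_zero] at h
  refine Eq.trans ?_ h
  refine congrArg₂ _ ?_ rfl
  have h₁ : (cons p x (nil X')).rdeg A.N + r + (nil Y : Str B.Hom Y Y).rdeg B.N + -1 = e := by
    rw [he]; simp; ring
  have h₂ : (nil X' : Str A.Hom X' X').rdeg A.N + r + (nil Y : Str B.Hom Y Y).rdeg B.N + -1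
      = r - 1 := by simp; ring
  simp only [Multi.compApp, sumSplit_cons, sumSplit_nil, h₁, h₂]
  rfl

theorem d_d (X : A.Ob) (Y : B.Ob) (p q : ℤ) (z : M.V X Y p) :
    M.d X Y (p - 1) q (M.d X Y p (p - 1) z) = 0 := by
  have h := M.rel (nil X) p z (nil Y) q
  unfold Multi.barApp at h
  rw [A.bar_nil (M.μ.left p z (nil Y) q), B.bar_nil (M.μ.right _ p z q), add_zero, add_zero] at h
  have h₂ : (nil X : Str A.Hom X X).rdeg A.N + p + (nil Y : Str B.Hom Y Y).rdeg B.N + -1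
      = p - 1 := by simp; ring
  simp only [Multi.compApp, sumSplit_nil, h₂] at h
  exact h

theorem d_d' (X : A.Ob) (Y : B.Ob) (p q : ℤ) (z : M.V X Y (p + 1)) :
    M.d X Y p q (M.d X Y (p + 1) p z) = 0 := by
  have := fun r (h : r = p + 1 - 1) => (by subst h; exact M.d_d X Y (p + 1) q z :
    M.d X Y r q (M.d X Y (p + 1) r z) = 0)
  exact this p (by ring)

/-- Because `e` is a cycle, multiplication by `e` is a chain map. Its difference from the identity
vanishes on homology by hypothesis, hence is null-homotopic over a field. -/
theorem exists_unit_homotopy {X : A.Ob} {e : A.Hom X X A.N} (he : A.diag.d X X A.N (A.N - 1) e = 0)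
    (hM : ∀ (Y : B.Ob) (p : ℤ), ∀ z ∈ M.cycles X Y p,
      M.μ.app (cons A.N e (nil X)) p z (nil Y) p - z ∈ M.boundaries X Y p) :
    ∃ K : ∀ (Y : B.Ob) (p q : ℤ), M.V X Y p →ₗ[ZMod 2] M.V X Y q,
      ∀ Y p z,
        M.d X Y (p + 1) p (K Y p (p + 1) z) + K Y (p - 1) p (M.d X Y p (p - 1) z)
          = M.μ.app (cons A.N e (nil X)) p z (nil Y) p + z := by
  have key := fun Y => exists_homotopy_of_map_cycles_le_boundaries (M.d X Y)
    (fun p x => M.d_d' X Y p (p - 1) x)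
    (fun p => (M.μ.appHom (cons A.N e (nil X)) p (nil Y) p).toZModLinearMap 2 - LinearMap.id)
    (fun p x => by
      have h := M.leibniz_left X X Y A.N (p + 1) e x (p + 1) p (by ring)
      have h₀ := (M.μ.left (p + 1) x (nil Y) p).map_cons_zero (nil X) (A.N - 1) (nil X)
      rw [nil_append] at h₀
      rw [he, h₀, add_zero] at h
      have h₂ : M.μ.app (cons A.N e (nil X)) (p + 1 - 1) (M.d X Y (p + 1) (p + 1 - 1) x) (nil Y) p
          = M.μ.app (cons A.N e (nil X)) p (M.d X Y (p + 1) p x) (nil Y) p := by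
        rw [show p + 1 - 1 = p by ring]
      rw [h₂] at h
      rw [LinearMap.sub_apply, LinearMap.sub_apply, map_sub]
      exact congrArg₂ _ (eq_of_add_eq_zero_of_charTwo h).symm rfl)
    (fun p x hx => by exact hM Y p x hx)
  choose K hK using key
  refine ⟨K, fun Y p z => ?_⟩
  rw [hK, ← ZModModule.sub_eq_add]
  rfl

end Bimodule

/-! ## Quasi-isomorphisms of bimodules -/

/-- Transport between equal degrees. -/
def degCast {V : ℤ → Type w} [∀ p, AddCommGroup (V p)] {a b : ℤ} (h : a = b) : V a →+ V b :=
  match h with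
  | rfl => AddMonoidHom.id _

theorem degCast_apply {V : ℤ → Type w} [∀ p, AddCommGroup (V p)] {a b : ℤ} (h : a = b)
    (x : ∀ p, V p) : degCast h (x a) = x b := by
  subst h; rfl

namespace AInfCat

/-- The bar differential does not increase length: a non-empty block is replaced by one entry, and
the empty block contributes nothing because `μ` vanishes on it. Hence filtrations by length are
preserved. -/
theorem bar_eq_zero_of_length (A : AInfCat.{u, v}) {R : Type w} [AddCommGroup R] {X Y : A.Ob}
    (s : Str A.Hom X Y) {G : Str A.Hom X Y → R} (hG : IsMultilinear G)
    (h : ∀ r, r.length ≤ s.length → G r = 0) : A.bar s G = 0 := by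
  refine (sumSplit₃_congr s fun _ _ a b c hs => ?_).trans (sumSplit₃_zero s)
  cases b with
  | nil =>
    have h₀ : ∀ X, A.μ (nil X : Str A.Hom X X) = 0 := fun X => funext fun q => A.μ_nil X q
    rw [h₀]
    exact hG.map_cons_zero _ _ _
  | cons p x b =>
    refine h _ ?_
    subst hs
    simp [consAt]

end AInfCat

namespace Multi

variable {A : AInfCat.{u, v}} {B : AInfCat.{u', v'}} {U : A.Ob → B.Ob → ℤ → Type w''}
  {V : A.Ob → B.Ob → ℤ → Type w} {W : A.Ob → B.Ob → ℤ → Type w'}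
  [∀ X Y p, AddCommGroup (U X Y p)] [∀ X Y p, AddCommGroup (V X Y p)]
  [∀ X Y p, AddCommGroup (W X Y p)] {g g' : ℤ}

/-- The part of a composition on which the first family takes all arguments. -/
theorem compApp_eq_app_nil (f : Multi A B U V g) (h : Multi A B V W g') {X X' : A.Ob} {Y' Y : B.Ob}
    (s : Str A.Hom X X') (p : ℤ) (v : U X' Y' p) (t : Str B.Hom Y' Y)
    (hf : ∀ {Z : A.Ob} {Z' : B.Ob} (s' : Str A.Hom Z X') (t' : Str B.Hom Y' Z') (d : ℤ),
      s'.length + t'.length < s.length + t.length → f.app s' p v t' d = 0)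
    {d q : ℤ} (hq : q = d + g') :
    f.compApp h s p v t q = h.app (nil X) d (f.app s p v t d) (nil Y) q := by
  unfold compApp appAt
  rw [sumSplit_eq_right, sumSplit_eq_left]
  · by_cases hd : d = s.rdeg A.N + p + t.rdeg B.N + g
    · rw [hd]
    · rw [f.degree s p v t d hd, h.app_zero, h.degree _ _ _ _ _ (by simp only [rdeg_nil]; omega)]
  · intro Z a b hab hl
    rw [hf s a _ (by omega), h.app_zero]
  · intro Z a b hab hl
    refine (sumSplit_congr t fun _ t₁ t₂ ht => ?_).trans (sumSplit_zero t)
    subst ht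
    rw [hf b t₁ _ (by simp; omega), h.app_zero]

theorem compApp_nil (f : Multi A B U V g) (h : Multi A B V W g') {X : A.Ob} {Y : B.Ob}
    (p : ℤ) (v : U X Y p) {d q : ℤ} (hq : q = d + g') :
    f.compApp h (nil X) p v (nil Y) q = h.app (nil X) d (f.app (nil X) p v (nil Y) d) (nil Y) q :=
  f.compApp_eq_app_nil h _ p v _ (fun _ _ _ h => absurd h (by simp)) hq

theorem barApp_nil (f : Multi A B V W g) {X : A.Ob} {Y : B.Ob} (p : ℤ) (v : V X Y p) (q : ℤ) :
    f.barApp (nil X) p v (nil Y) q = 0 := by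
  unfold barApp
  rw [A.bar_nil (f.left p v _ q), B.bar_nil (f.right _ p v q), add_zero]

theorem compApp_eq_zero_of_filtration {f : Multi A B U V g} (h : Multi A B V W g') {n : ℕ}
    (hf : f ∈ filtration A B U V g (· + ·) n) {X X' : A.Ob} {Y' Y : B.Ob}
    (s : Str A.Hom X X') (p : ℤ) (v : U X' Y' p) (t : Str B.Hom Y' Y) (q : ℤ)
    (hn : s.length + t.length < n) : f.compApp h s p v t q = 0 := by
  refine (sumSplit_congr s fun _ s₁ s₂ hs => (sumSplit_congr t fun _ t₁ t₂ ht => ?_).trans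
    (sumSplit_zero t)).trans (sumSplit_zero s)
  unfold appAt
  rw [hf s₂ p v t₁ _ (by subst hs; subst ht; simp at hn ⊢; omega), h.app_zero]

theorem compApp_eq_zero_of_filtration_right (f : Multi A B U V g) {h : Multi A B V W g'} {n : ℕ}
    (hh : h ∈ filtration A B V W g' (· + ·) n) {X X' : A.Ob} {Y' Y : B.Ob}
    (s : Str A.Hom X X') (p : ℤ) (v : U X' Y' p) (t : Str B.Hom Y' Y) (q : ℤ)
    (hn : s.length + t.length < n) : f.compApp h s p v t q = 0 := by
  refine (sumSplit_congr s fun _ s₁ s₂ hs => (sumSplit_congr t fun _ t₁ t₂ ht => ?_).trans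
    (sumSplit_zero t)).trans (sumSplit_zero s)
  exact hh s₁ _ _ t₂ _ (by subst hs; subst ht; simp at hn ⊢; omega)

theorem barApp_eq_zero_of_filtration {f : Multi A B V W g} {n : ℕ}
    (hf : f ∈ filtration A B V W g (· + ·) n) {X X' : A.Ob} {Y' Y : B.Ob}
    (s : Str A.Hom X X') (p : ℤ) (v : V X' Y' p) (t : Str B.Hom Y' Y) (q : ℤ)
    (hn : s.length + t.length < n) : f.barApp s p v t q = 0 := by
  unfold barApp
  rw [A.bar_eq_zero_of_length s (f.left p v t q) fun r hr => hf r p v t q (by dsimp only; omega),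
    B.bar_eq_zero_of_length t (f.right s p v q) fun r hr => hf s p v r q (by dsimp only; omega), add_zero]

/-- Each term evaluates the identity on a string containing the inserted entry, and the identity
vanishes on non-empty strings. -/
theorem id_barApp {X X' : A.Ob} {Y' Y : B.Ob}
    (s : Str A.Hom X X') (p : ℤ) (v : V X' Y' p) (t : Str B.Hom Y' Y) (q : ℤ) :
    (id A B V).barApp s p v t q = 0 := by
  unfold barApp
  refine (congrArg₂ _ ((sumSplit₃_congr s fun _ _ a b c _ => ?_).trans (sumSplit₃_zero s))
    ((sumSplit₃_congr t fun _ _ a b c _ => ?_).trans (sumSplit₃_zero t))).trans (add_zero _)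
  · cases a <;> cases t <;> rfl
  · cases a <;> cases s <;> rfl

end Multi

namespace Bimodule

variable {A : AInfCat.{u, v}} {B : AInfCat.{u', v'}} (M : Bimodule.{u, u', v, v', w} A B)

theorem mem_boundaries_iff {X : A.Ob} {Y : B.Ob} {p p' : ℤ} (h : p' = p + 1) {x : M.V X Y p} :
    x ∈ M.boundaries X Y p ↔ ∃ y, M.d X Y p' p y = x := by
  subst h; rfl

theorem mem_cycles_iff {X : A.Ob} {Y : B.Ob} {p p' : ℤ} (h : p' = p - 1) {x : M.V X Y p} :
    x ∈ M.cycles X Y p ↔ M.d X Y p p' x = 0 := by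
  subst h; rfl

end Bimodule

/-! ### The cone of composition with a bimodule morphism -/

namespace PreMor

variable {A : AInfCat.{u, v}} {B : AInfCat.{u', v'}} {K : Bimodule.{u, u', v, v', w} A B}
  {L : Bimodule.{u, u', v, v', w'} A B} {Q : Bimodule.{u, u', v, v', w''} A B} {g c c' e e' : ℤ}

/-- The component `K(X,Y)_p → L(X,Y)_q` of `ν_{0|1|0}`. -/
def lin (ν : PreMor K L g) (X : A.Ob) (Y : B.Ob) (p q : ℤ) : K.V X Y p →ₗ[ZMod 2] L.V X Y q :=
  (ν.appHom (nil X) p (nil Y) q).toZModLinearMap 2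

theorem diffApp_nil (ν : PreMor K L g) {X : A.Ob} {Y : B.Ob} {p p' q r : ℤ} (x : K.V X Y p)
    (hr : r = q + 1) (hq : q = p' + g) :
    diffApp ν (nil X) p x (nil Y) q
      = L.d X Y r q (lin ν X Y p r x) + lin ν X Y p' q (K.d X Y p p' x) := by
  unfold diffApp
  rw [ν.barApp_nil, add_zero, ν.compApp_nil L.μ p x (d := r) (by omega),
    K.μ.compApp_nil ν p x hq]
  rfl

theorem IsClosed.lin_d {ν : PreMor K L g} (hν : IsClosed ν) {X : A.Ob} {Y : B.Ob} {p p' q r : ℤ}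
    (x : K.V X Y p) (hr : r = q + 1) (hq : q = p' + g) :
    lin ν X Y p' q (K.d X Y p p' x) = L.d X Y r q (lin ν X Y p r x) := by
  have h := hν (nil X) p x (nil Y) q
  rw [diffApp_nil ν x hr hq] at h
  exact (eq_of_add_eq_zero_of_charTwo h).symm

/-- `ν_{0|1|0}` induces isomorphisms on homology. -/
def IsLinQuasiIso (ν : PreMor K L g) : Prop :=
  ∀ (X : A.Ob) (Y : B.Ob) (p q : ℤ), q = p + g →
    (∀ x ∈ K.cycles X Y p, lin ν X Y p q x ∈ L.boundaries X Y q → x ∈ K.boundaries X Y p) ∧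
    (∀ y ∈ L.cycles X Y q, ∃ x ∈ K.cycles X Y p, lin ν X Y p q x + y ∈ L.boundaries X Y q)

/-- The mapping cone of `ν_{0|1|0}` is contractible if `ν_{0|1|0}` is a quasi-isomorphism. -/
theorem IsLinQuasiIso.exists_contraction {ν : PreMor K L g} (h : IsLinQuasiIso ν)
    (hν : IsClosed ν) (X : A.Ob) (Y : B.Ob) :
    ∃ H : ∀ p q, (K.V X Y p × L.V X Y (p + g + 1)) →ₗ[ZMod 2] (K.V X Y q × L.V X Y (q + g + 1)),
      ∀ p x,
        (K.d X Y (p + 1) p (H p (p + 1) x).1,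
            lin ν X Y (p + 1) (p + g + 1) (H p (p + 1) x).1
              + L.d X Y (p + 1 + g + 1) (p + g + 1) (H p (p + 1) x).2)
          + H (p - 1) p (K.d X Y p (p - 1) x.1,
            lin ν X Y p (p - 1 + g + 1) x.1
              + L.d X Y (p + g + 1) (p - 1 + g + 1) x.2) = x := by
  -- The cone in degree `p` is `K_p × L_{p+g+1}`. It is enough to see that it is acyclic: the
  -- homotopy criterion is then applied to its identity map.
  refine exists_homotopy_of_map_cycles_le_boundaries
    (C := fun p => K.V X Y p × L.V X Y (p + g + 1))
    (fun p q => (K.d X Y p q ∘ₗ LinearMap.fst _ _ _).prod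
      (lin ν X Y p (q + g + 1) ∘ₗ LinearMap.fst _ _ _
        + L.d X Y (p + g + 1) (q + g + 1) ∘ₗ LinearMap.snd _ _ _))
    ?_ (fun _ => LinearMap.id) (fun _ _ => rfl) ?_
  · rintro p ⟨x, y⟩
    refine Prod.ext (K.d_d' X Y p (p - 1) x) ?_
    change lin ν X Y p (p - 1 + g + 1) (K.d X Y (p + 1) p x)
      + L.d X Y (p + g + 1) (p - 1 + g + 1) (lin ν X Y (p + 1) (p + g + 1) x
        + L.d X Y (p + 1 + g + 1) (p + g + 1) y) = 0
    have h₁ : L.d X Y (p + g + 1) (p - 1 + g + 1) (L.d X Y (p + 1 + g + 1) (p + g + 1) y) = 0 := by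
      have := fun r r' (e₁ : r' = r - 1) (y : L.V X Y r) => (by
        subst e₁; exact L.d_d X Y r (p - 1 + g + 1) y :
          L.d X Y r' (p - 1 + g + 1) (L.d X Y r r' y) = 0)
      exact this _ _ (by ring) y
    rw [map_add, h₁, add_zero, hν.lin_d x (p' := p) (r := p + g + 1) (by ring) (by ring)]
    exact ZModModule.add_self _
  · rintro p ⟨x, y⟩ hxy
    obtain ⟨hx, hy⟩ := Prod.ext_iff.1 hxy
    change K.d X Y p (p - 1) x = 0 at hx
    change lin ν X Y p (p - 1 + g + 1) x + L.d X Y (p + g + 1) (p - 1 + g + 1) y = 0 at hy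
    have hy' := eq_of_add_eq_zero_of_charTwo hy
    -- The second cycle equation makes `ν x` a boundary, so injectivity on homology yields a
    -- primitive `x₁` of `x`.
    obtain ⟨x₁, hx₁⟩ := (h X Y p (p - 1 + g + 1) (by ring)).1 x hx
      ((L.mem_boundaries_iff (by ring)).2 ⟨y, hy'.symm⟩)
    -- The error `y + ν x₁` is a cycle. By surjectivity on homology it becomes a boundary after
    -- changing `x₁` by a cycle `x₂`.
    obtain ⟨x₂, hx₂, hb⟩ := (h X Y (p + 1) (p + g + 1) (by ring)).2
      (y + lin ν X Y (p + 1) (p + g + 1) x₁) (by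
        rw [L.mem_cycles_iff (p' := p - 1 + g + 1) (by ring), map_add,
          ← hν.lin_d x₁ (p' := p) (by ring) (by ring), hx₁, hy']
        exact ZModModule.add_self _)
    obtain ⟨y', hy₁⟩ := (L.mem_boundaries_iff (p' := p + 1 + g + 1) (by ring)).1 hb
    rw [K.mem_cycles_iff (p' := p) (by ring)] at hx₂
    refine ⟨(x₁ + x₂, y'), Prod.ext ?_ ?_⟩
    · change K.d X Y (p + 1) p (x₁ + x₂) = x
      rw [map_add, hx₂, hx₁, add_zero]
    · change lin ν X Y (p + 1) (p + g + 1) (x₁ + x₂)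
        + L.d X Y (p + 1 + g + 1) (p + g + 1) y' = y
      rw [hy₁, map_add]
      have h₁ := ZModModule.add_self (lin ν X Y (p + 1) (p + g + 1) x₁)
      have h₂ := ZModModule.add_self (lin ν X Y (p + 1) (p + g + 1) x₂)
      calc _ = (lin ν X Y (p + 1) (p + g + 1) x₁ + lin ν X Y (p + 1) (p + g + 1) x₁)
          + (lin ν X Y (p + 1) (p + g + 1) x₂ + lin ν X Y (p + 1) (p + g + 1) x₂) + y := by abel
        _ = y := by rw [h₁, h₂, zero_add, zero_add]

/-- The part `Φ ∘ μ^Q + Φ ∘ (μ^A, μ^B)` of the differential, for functions `Φ` with values in any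
group. -/
def inner {G : Type*} [AddCommGroup G] (Q : Bimodule.{u, u', v, v', w''} A B) {X : A.Ob} {Y : B.Ob}
    (Φ : ∀ {X' : A.Ob} {Y' : B.Ob}, Str A.Hom X X' → ∀ p : ℤ, Q.V X' Y' p → Str B.Hom Y' Y → G)
    {X' : A.Ob} {Y' : B.Ob} (s : Str A.Hom X X') (p : ℤ) (v : Q.V X' Y' p) (t : Str B.Hom Y' Y) :
    G :=
  (s.sumSplit fun _ s₁ s₂ => t.sumSplit fun _ t₁ t₂ =>
    Φ s₁ (s₂.rdeg A.N + p + t₁.rdeg B.N + -1)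
      (Q.μ.app s₂ p v t₁ (s₂.rdeg A.N + p + t₁.rdeg B.N + -1)) t₂)
  + (A.bar s (fun s' => Φ s' p v t) + B.bar t (fun t' => Φ s p v t'))

theorem map_inner {G G' : Type*} [AddCommGroup G] [AddCommGroup G'] (φ : G →+ G')
    {X : A.Ob} {Y : B.Ob}
    (Φ : ∀ {X' : A.Ob} {Y' : B.Ob}, Str A.Hom X X' → ∀ p : ℤ, Q.V X' Y' p → Str B.Hom Y' Y → G)
    {X' : A.Ob} {Y' : B.Ob} (s : Str A.Hom X X') (p : ℤ) (v : Q.V X' Y' p) (t : Str B.Hom Y' Y) :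
    φ (inner Q Φ s p v t) = inner Q (fun s p v t => φ (Φ s p v t)) s p v t := by
  unfold inner
  simp only [map_add, map_sumSplit, AInfCat.map_bar]

theorem diffApp_eq_inner (a : PreMor Q K c) {X X' : A.Ob} {Y' Y : B.Ob} (s : Str A.Hom X X') (p : ℤ)
    (v : Q.V X' Y' p) (t : Str B.Hom Y' Y) (q : ℤ) :
    diffApp a s p v t q = a.compApp K.μ s p v t q
      + inner Q (fun s p v t => a.app s p v t q) s p v t :=
  add_assoc _ _ _

/-- The differential of the cone of `ν ∘ · : Hom(Q,K) → Hom(Q,L)`. -/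
def coneDiff (Q : Bimodule.{u, u', v, v', w''} A B) (ν : PreMor K L g) (hc : c' = c + -1)
    (he : e = c + g + 1) (he' : e' = c + g) :
    (PreMor Q K c × PreMor Q L e) →+ (PreMor Q K c' × PreMor Q L e') :=
  AddMonoidHom.mk' (fun f => ((diff f.1).cast hc.symm,
      (f.1.comp ν).cast he'.symm + (diff f.2).cast (by omega)))
    (fun f h => Prod.ext (by
        rw [Prod.fst_add, diff_add]; rfl) (by
        change ((f.1 + h.1).comp ν).cast _ + (diff (f.2 + h.2)).cast _
          = ((f.1.comp ν).cast _ + (diff f.2).cast _) + ((h.1.comp ν).cast _ + (diff h.2).cast _)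
        rw [diff_add]
        ext X X' Y' Y s p v t q
        change (f.1 + h.1).compApp ν s p v t q + ((diff f.2).app s p v t q + (diff h.2).app s p v t q)
          = (f.1.compApp ν s p v t q + (diff f.2).app s p v t q)
            + (h.1.compApp ν s p v t q + (diff h.2).app s p v t q)
        rw [Multi.add_compApp]
        abel))

theorem coneDiff_fst (ν : PreMor K L g) (hc : c' = c + -1) (he : e = c + g + 1) (he' : e' = c + g)
    (f : PreMor Q K c × PreMor Q L e) {X X' : A.Ob} {Y' Y : B.Ob} (s : Str A.Hom X X') (p : ℤ)
    (v : Q.V X' Y' p) (t : Str B.Hom Y' Y) (q : ℤ) :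
    (coneDiff Q ν hc he he' f).1.app s p v t q = diffApp f.1 s p v t q := rfl

theorem coneDiff_snd (ν : PreMor K L g) (hc : c' = c + -1) (he : e = c + g + 1) (he' : e' = c + g)
    (f : PreMor Q K c × PreMor Q L e) {X X' : A.Ob} {Y' Y : B.Ob} (s : Str A.Hom X X') (p : ℤ)
    (v : Q.V X' Y' p) (t : Str B.Hom Y' Y) (q : ℤ) :
    (coneDiff Q ν hc he he' f).2.app s p v t q
      = f.1.compApp ν s p v t q + diffApp f.2 s p v t q := rfl

/-- Besides `d² = 0`, this is the Leibniz rule for `f₁` followed by `ν`: the term involving `d f₁`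
appears twice, and the term involving `d ν` vanishes because `ν` is closed. -/
theorem coneDiff_coneDiff {ν : PreMor K L g} (hν : IsClosed ν) {c'' e'' : ℤ} (hc : c' = c + -1)
    (he : e = c + g + 1) (he' : e' = c + g) (hc' : c'' = c' + -1) (he₂ : e' = c' + g + 1)
    (he'' : e'' = c' + g) (f : PreMor Q K c × PreMor Q L e) :
    coneDiff Q ν hc' he₂ he'' (coneDiff Q ν hc he he' f) = 0 := by
  refine Prod.ext (Multi.ext fun s p v t q => ?_) (Multi.ext fun s p v t q => ?_)
  · rw [coneDiff_fst]
    change diffApp (K := Q) (L := K) ((diff f.1).cast hc.symm) s p v t q = 0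
    rw [diffApp_cast, diffApp_diff]
  · rw [coneDiff_snd, ← diff_apply]
    change ((diff f.1).cast hc.symm).compApp ν s p v t q + (diff (K := Q) (L := L)
      ((f.1.comp ν).cast he'.symm + (diff f.2).cast (by omega))).app s p v t q = 0
    rw [diff_add, Multi.add_apply, diff_apply, diff_apply, diffApp_cast, diffApp_cast, diffApp_diff,
      diffApp_comp, Multi.cast_compApp, add_zero, ← add_assoc, ZModModule.add_self, zero_add,
      Multi.compApp_of_app_eq_zero _ _ _ _ _ _ _ fun s p v t => hν s p v t q]

/-- Postcomposition with a contraction of the cone of `ν_{0|1|0}`. -/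
def conePrimitive (g : ℤ) (H : ∀ (X : A.Ob) (Y : B.Ob) (p q : ℤ),
      (K.V X Y p × L.V X Y (p + g + 1)) →ₗ[ZMod 2] (K.V X Y q × L.V X Y (q + g + 1)))
    (he : e = c + g + 1) (f : PreMor Q K c × PreMor Q L e) : PreMor Q K (c + 1) × PreMor Q L (e + 1) :=
  -- The components of `f` in degrees `q - 1` and `(q - 1) + g + 1` form one element of the cone of
  -- `ν_{0|1|0}`, on which the contraction acts. For the `L`-component in degree `q` this is used at
  -- `q - g - 1`, so a transport of degrees is needed below.
  let F : ∀ {X X' Y' Y}, Str A.Hom X X' → ∀ p, Q.V X' Y' p → Str B.Hom Y' Y → ∀ q,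
      K.V X Y q × L.V X Y (q + g + 1) :=
    fun {X _ _ Y} s p v t q => H X Y (q - 1) q (f.1.app s p v t (q - 1), f.2.app s p v t (q - 1 + g + 1))
  have hl : ∀ {X X' Y' Y} (p) (v : Q.V X' Y' p) (t : Str B.Hom Y' Y) (q : ℤ),
      IsMultilinear (fun s : Str A.Hom X X' => F s p v t q) := fun p v t q P R a r x x' b => by
    simp only [F, f.1.left p v t _ P R a r x x' b, f.2.left p v t _ P R a r x x' b, ← map_add,
      Prod.mk_add_mk]
  have hm : ∀ {X X' Y' Y} (s : Str A.Hom X X') (p) (v v' : Q.V X' Y' p) (t : Str B.Hom Y' Y) (q : ℤ),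
      F s p (v + v') t q = F s p v t q + F s p v' t q := fun s p v v' t q => by
    simp only [F, Multi.mid, ← map_add, Prod.mk_add_mk]
  have hr : ∀ {X X' Y' Y} (s : Str A.Hom X X') (p) (v : Q.V X' Y' p) (q : ℤ),
      IsMultilinear (fun t : Str B.Hom Y' Y => F s p v t q) := fun s p v q P R a r x x' b => by
    simp only [F, f.1.right s p v _ P R a r x x' b, f.2.right s p v _ P R a r x x' b, ← map_add,
      Prod.mk_add_mk]
  have hd : ∀ {X X' Y' Y} (s : Str A.Hom X X') (p) (v : Q.V X' Y' p) (t : Str B.Hom Y' Y) (q : ℤ),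
      q ≠ s.rdeg A.N + p + t.rdeg B.N + (c + 1) → F s p v t q = 0 := fun s p v t q hq => by
    simp only [F]
    rw [f.1.degree _ _ _ _ _ (by omega), f.2.degree _ _ _ _ _ (by omega)]
    exact map_zero _
  (⟨fun s p v t q => (F s p v t q).1,
    fun p v t q => (hl p v t q).map (AddMonoidHom.fst _ _),
    fun s p v v' t q => congrArg Prod.fst (hm s p v v' t q),
    fun s p v q => (hr s p v q).map (AddMonoidHom.fst _ _),
    fun s p v t q hq => congrArg Prod.fst (hd s p v t q hq)⟩,
   ⟨fun {X X' Y' Y} s p v t q => degCast (V := fun q => L.V X Y q)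
      (show q - g - 1 + g + 1 = q by ring) (F s p v t (q - g - 1)).2,
    fun {X X' Y' Y} p v t q => ((hl p v t (q - g - 1)).map (AddMonoidHom.snd _ _)).map
      (degCast (V := fun q => L.V X Y q) _),
    fun s p v v' t q => by rw [hm, Prod.snd_add, map_add],
    fun {X X' Y' Y} s p v q => ((hr s p v (q - g - 1)).map (AddMonoidHom.snd _ _)).map
      (degCast (V := fun q => L.V X Y q) _),
    fun s p v t q hq => by rw [hd s p v t _ (by omega)]; exact map_zero _⟩)

end PreMor

/-! ### Acyclicity of the cone and inversion of bimodule morphisms -/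

namespace PreMor

variable {A : AInfCat.{u, v}} {B : AInfCat.{u', v'}} {K : Bimodule.{u, u', v, v', w} A B}
  {L : Bimodule.{u, u', v, v', w'} A B} {Q : Bimodule.{u, u', v, v', w''} A B} {g c c' e e' : ℤ}

theorem diffApp_eq_zero_of_filtration {a : PreMor Q K c} {n : ℕ}
    (ha : a ∈ Multi.filtration A B Q.V K.V c (· + ·) n) {X X' : A.Ob} {Y' Y : B.Ob}
    (s : Str A.Hom X X') (p : ℤ) (v : Q.V X' Y' p) (t : Str B.Hom Y' Y) (q : ℤ)
    (hn : s.length + t.length < n) : diffApp a s p v t q = 0 := by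
  unfold diffApp
  rw [Multi.compApp_eq_zero_of_filtration K.μ ha s p v t q hn,
    Multi.compApp_eq_zero_of_filtration_right Q.μ ha s p v t q hn,
    Multi.barApp_eq_zero_of_filtration ha s p v t q hn, add_zero, add_zero]

theorem conePrimitive_fst (H : ∀ (X : A.Ob) (Y : B.Ob) (p q : ℤ),
      (K.V X Y p × L.V X Y (p + g + 1)) →ₗ[ZMod 2] (K.V X Y q × L.V X Y (q + g + 1)))
    (he : e = c + g + 1) (f : PreMor Q K c × PreMor Q L e) {X X' : A.Ob} {Y' Y : B.Ob}
    (s : Str A.Hom X X') (p : ℤ) (v : Q.V X' Y' p) (t : Str B.Hom Y' Y) {q q' : ℤ} (hq : q = q' + 1) :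
    (conePrimitive g H he f).1.app s p v t q
      = (H X Y q' q (f.1.app s p v t q', f.2.app s p v t (q' + g + 1))).1 := by
  obtain rfl : q' = q - 1 := by omega
  rfl

theorem conePrimitive_snd (H : ∀ (X : A.Ob) (Y : B.Ob) (p q : ℤ),
      (K.V X Y p × L.V X Y (p + g + 1)) →ₗ[ZMod 2] (K.V X Y q × L.V X Y (q + g + 1)))
    (he : e = c + g + 1) (f : PreMor Q K c × PreMor Q L e) {X X' : A.Ob} {Y' Y : B.Ob}
    (s : Str A.Hom X X') (p : ℤ) (v : Q.V X' Y' p) (t : Str B.Hom Y' Y) {q q' : ℤ} (hq : q = q' + 1) :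
    (conePrimitive g H he f).2.app s p v t (q + g + 1)
      = (H X Y q' q (f.1.app s p v t q', f.2.app s p v t (q' + g + 1))).2 := by
  obtain rfl : q' = q - 1 := by omega
  have key : ∀ (r : ℤ) (hr : r = q) (h : r + g + 1 = q + g + 1),
      degCast (V := fun q => L.V X Y q) h
        (H X Y (r - 1) r (f.1.app s p v t (r - 1), f.2.app s p v t (r - 1 + g + 1))).2
      = (H X Y (q - 1) q (f.1.app s p v t (q - 1), f.2.app s p v t (q - 1 + g + 1))).2 := by
    rintro r rfl h; rfl
  exact key _ (by ring) (by ring)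

theorem conePrimitive_mem {H : ∀ (X : A.Ob) (Y : B.Ob) (p q : ℤ),
      (K.V X Y p × L.V X Y (p + g + 1)) →ₗ[ZMod 2] (K.V X Y q × L.V X Y (q + g + 1))}
    (he : e = c + g + 1) {f : PreMor Q K c × PreMor Q L e} {n : ℕ}
    (hf : f ∈ (Multi.filtration A B Q.V K.V c (· + ·) n).prod
      (Multi.filtration A B Q.V L.V e (· + ·) n)) :
    conePrimitive g H he f ∈ (Multi.filtration A B Q.V K.V (c + 1) (· + ·) n).prod
      (Multi.filtration A B Q.V L.V (e + 1) (· + ·) n) := by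
  constructor
  · intro X X' Y' Y s p v t q hn
    rw [conePrimitive_fst H he f s p v t (q' := q - 1) (by ring), hf.1 s p v t _ hn,
      hf.2 s p v t _ hn]
    exact congrArg Prod.fst (map_zero _)
  · intro X X' Y' Y s p v t q hn
    obtain ⟨q, rfl⟩ : ∃ q', q = q' + g + 1 := ⟨q - g - 1, by ring⟩
    rw [conePrimitive_snd H he f s p v t (q' := q - 1) (by ring), hf.1 s p v t _ hn,
      hf.2 s p v t _ hn]
    exact congrArg Prod.snd (map_zero _)

/-- The leading term of the differential of the cone. -/
theorem coneDiff_leading {ν : PreMor K L g} (hc : c' = c + -1)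
    (he : e = c + g + 1) (he' : e' = c + g) {f : PreMor Q K c × PreMor Q L e} {n : ℕ}
    (hf : f ∈ (Multi.filtration A B Q.V K.V c (· + ·) n).prod
      (Multi.filtration A B Q.V L.V e (· + ·) n)) {X X' : A.Ob} {Y' Y : B.Ob}
    (s : Str A.Hom X X') (p : ℤ) (v : Q.V X' Y' p) (t : Str B.Hom Y' Y) {q q' : ℤ}
    (hq : q = q' + 1) (hn : s.length + t.length ≤ n) :
    ((coneDiff Q ν hc he he' f).1.app s p v t q',
        (coneDiff Q ν hc he he' f).2.app s p v t (q' + g + 1))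
      = (K.d X Y q q' (f.1.app s p v t q),
          lin ν X Y q (q' + g + 1) (f.1.app s p v t q)
            + L.d X Y (q + g + 1) (q' + g + 1) (f.2.app s p v t (q + g + 1)))
        + inner Q (fun s p v t => (f.1.app s p v t q', f.2.app s p v t (q' + g + 1))) s p v t := by
  have h₁ : f.1.compApp K.μ s p v t q' = K.d X Y q q' (f.1.app s p v t q) :=
    f.1.compApp_eq_app_nil K.μ s p v t (fun s' t' d hl => hf.1 s' p v t' d (by dsimp only; omega))
      (by omega)
  have h₂ : f.1.compApp ν s p v t (q' + g + 1)
      = lin ν X Y q (q' + g + 1) (f.1.app s p v t q) :=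
    f.1.compApp_eq_app_nil ν s p v t (fun s' t' d hl => hf.1 s' p v t' d (by dsimp only; omega))
      (by omega)
  have h₃ : f.2.compApp L.μ s p v t (q' + g + 1)
      = L.d X Y (q + g + 1) (q' + g + 1) (f.2.app s p v t (q + g + 1)) :=
    f.2.compApp_eq_app_nil L.μ s p v t (fun s' t' d hl => hf.2 s' p v t' d (by dsimp only; omega))
      (by omega)
  refine Prod.ext ?_ ?_
  · refine Eq.trans ?_ (congrArg₂ _ rfl (map_inner (Q := Q)
      (AddMonoidHom.fst (K.V X Y q') (L.V X Y (q' + g + 1)))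
      (fun s p v t => (f.1.app s p v t q', f.2.app s p v t (q' + g + 1))) s p v t).symm)
    dsimp only
    rw [coneDiff_fst, diffApp_eq_inner, h₁]
    rfl
  · refine Eq.trans ?_ (congrArg₂ _ rfl (map_inner (Q := Q)
      (AddMonoidHom.snd (K.V X Y q') (L.V X Y (q' + g + 1)))
      (fun s p v t => (f.1.app s p v t q', f.2.app s p v t (q' + g + 1))) s p v t).symm)
    dsimp only
    rw [coneDiff_snd, diffApp_eq_inner, h₂, h₃, ← add_assoc]
    rfl

/-- The cone of `ν ∘ · : Hom(Q,K) → Hom(Q,L)` is acyclic if `ν_{0|1|0}` is a quasi-isomorphism. -/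
theorem IsLinQuasiIso.cone_acyclic {ν : PreMor K L g} (h : IsLinQuasiIso ν) (hν : IsClosed ν)
    (he : e = c + g + 1) (f : PreMor Q K c × PreMor Q L e)
    (hf : coneDiff Q ν (c' := c + -1) rfl he (e' := c + g) rfl f = 0) :
    ∃ u : PreMor Q K (c + 1) × PreMor Q L (e + 1),
      coneDiff Q ν (by ring) (by omega) (by omega) u = f := by
  choose H hH using h.exists_contraction hν
  refine exists_preimage_of_filtration (coneDiff Q ν (by ring) (by omega) (by omega))
    (coneDiff Q ν (c' := c + -1) rfl he (e' := c + g) rfl)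
    (fun x => coneDiff_coneDiff hν _ _ _ _ _ _ x)
    (fun n => (Multi.filtration A B Q.V K.V (c + 1) (· + ·) n).prod
      (Multi.filtration A B Q.V L.V (e + 1) (· + ·) n))
    (fun n => (Multi.filtration A B Q.V K.V c (· + ·) n).prod
      (Multi.filtration A B Q.V L.V e (· + ·) n))
    (conePrimitive g H he) ?_ ?_ ?_ ?_ ?_ ?_ ?_ f hf
  · exact fun x => ⟨fun _ _ _ _ _ h => absurd h (Nat.not_lt_zero _),
      fun _ _ _ _ _ h => absurd h (Nat.not_lt_zero _)⟩
  · exact fun n f hf => ⟨fun s p v t q hn => hf.1 s p v t q (Nat.lt_succ_of_lt hn),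
      fun s p v t q hn => hf.2 s p v t q (Nat.lt_succ_of_lt hn)⟩
  · exact fun f hf => Prod.ext (Multi.ext fun s p v t q => (hf _).1 s p v t q (Nat.lt_succ_self _))
      (Multi.ext fun s p v t q => (hf _).2 s p v t q (Nat.lt_succ_self _))
  · intro n f hf
    refine ⟨fun s p v t q hn => ?_, fun s p v t q hn => ?_⟩
    · rw [coneDiff_fst, diffApp_eq_zero_of_filtration hf.1 s p v t q hn]
    · rw [coneDiff_snd, diffApp_eq_zero_of_filtration hf.2 s p v t q hn,
        Multi.compApp_eq_zero_of_filtration ν hf.1 s p v t q hn, add_zero]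
  · exact fun n f hf => conePrimitive_mem he
      ⟨fun s p v t q hn => hf.1 s p v t q (Nat.lt_succ_of_lt hn),
      fun s p v t q hn => hf.2 s p v t q (Nat.lt_succ_of_lt hn)⟩
  · intro n f hf hcl
    have key : ∀ {X X' : A.Ob} {Y' Y : B.Ob} (s : Str A.Hom X X') (p : ℤ) (v : Q.V X' Y' p)
        (t : Str B.Hom Y' Y) (q : ℤ), s.length + t.length < n + 1 →
        ((coneDiff Q ν (c' := c) (e' := e) (by ring) (by omega) (by omega)
            (conePrimitive g H he f)).1.app s p v t q,
          (coneDiff Q ν (c' := c) (e' := e) (by ring) (by omega) (by omega)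
            (conePrimitive g H he f)).2.app s p v t (q + g + 1))
        = (f.1.app s p v t q, f.2.app s p v t (q + g + 1)) := by
      intro X X' Y' Y s p v t q hn
      -- In lowest length the differential of the primitive is the linear cone differential of `H
      -- f`, plus the terms in which operations act on the inputs first; `H` commutes with the
      -- latter since it acts on outputs.
      rw [coneDiff_leading _ _ _ (conePrimitive_mem he hf) s p v t (q := q + 1) rfl (by omega),
        conePrimitive_fst H he f s p v t (q := q + 1) rfl,
        conePrimitive_snd H he f s p v t (q := q + 1) rfl]
      refine Eq.trans (congrArg₂ _ rfl ?_) (hH X Y q (f.1.app s p v t q, f.2.app s p v t (q + g + 1)))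
      have h₁ := coneDiff_leading (ν := ν) (c' := c + -1) rfl he (e' := c + g) rfl hf s p v t
        (q := q) (q' := q - 1) (by ring) (by omega)
      rw [hcl] at h₁
      -- Closedness of `f` identifies the inner terms with the linear cone differential of `f`. What
      -- is left to prove is the identity `dH + Hd = id` of the contraction.
      rw [eq_of_add_eq_zero_of_charTwo h₁.symm]
      refine Eq.trans ?_ (map_inner (H X Y (q - 1) q).toAddMonoidHom _ s p v t).symm
      congr 1
      funext X' Y' s p v t
      refine Prod.ext ?_ ?_
      · exact conePrimitive_fst H he f s p v t (by ring)
      · exact conePrimitive_snd H he f s p v t (by ring)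
    refine ⟨fun s p v t q hn => ?_, fun s p v t q hn => ?_⟩
    · rw [Prod.fst_sub, Multi.sub_apply]
      exact sub_eq_zero.2 (congrArg Prod.fst (key s p v t q hn)).symm
    · obtain ⟨q, rfl⟩ : ∃ q', q = q' + g + 1 := ⟨q - g - 1, by ring⟩
      rw [Prod.snd_sub, Multi.sub_apply]
      exact sub_eq_zero.2 (congrArg Prod.snd (key s p v t q hn)).symm
  · intro p hp
    obtain ⟨a, ha⟩ := Multi.exists_sum _ (fun k => (p k).1) fun k => (hp k).1
    obtain ⟨b, hb⟩ := Multi.exists_sum _ (fun k => (p k).2) fun k => (hp k).2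
    refine ⟨(a, b), fun n => ⟨?_, ?_⟩⟩
    · rw [Prod.fst_sub, Prod.fst_sum]; exact ha n
    · rw [Prod.snd_sub, Prod.snd_sum]; exact hb n

theorem diff_zero : diff (0 : PreMor K L g) = 0 :=
  (AddMonoidHom.mk' (diff (K := K) (L := L) (g := g)) diff_add).map_zero

theorem isClosed_id : IsClosed (K := K) (L := K) (Multi.id A B K.V) := by
  intro X X' Y' Y s p v t q
  unfold diffApp
  rw [Multi.id_compApp, Multi.compApp_id, Multi.id_barApp, add_zero, ZModModule.add_self]

/-- A bimodule morphism over a field is invertible up to homotopy if it induces isomorphisms on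
homology. -/
theorem IsLinQuasiIso.isQuasiIso {ν : PreMor K L g} (h : IsLinQuasiIso ν) (hν : IsClosed ν) :
    IsQuasiIso ν := by
  refine ⟨hν, ?_⟩
  -- The pair `(0, id_L)` is a cycle in the cone of `Hom(L,K) → Hom(L,L)`. A primitive `(ψ, η)`
  -- consists of a closed `ψ` and a homotopy from `ν ∘ ψ` to the identity.
  obtain ⟨⟨ψ, η⟩, hu⟩ := h.cone_acyclic (Q := L) hν (c := -g - 1) (e := 0) (by ring)
    (0, Multi.id A B L.V) (Prod.ext (Multi.ext fun s p v t q => by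
      rw [coneDiff_fst, ← diff_apply, diff_zero]; rfl)
      (Multi.ext fun s p v t q => by
        rw [coneDiff_snd, isClosed_id s p v t q, add_zero]
        exact Multi.compApp_of_left_eq_zero _ _ _ _ _ _ _ fun _ _ _ _ _ => rfl))
  have hψ : ∀ {X X' : A.Ob} {Y' Y : B.Ob} (s : Str A.Hom X X') (p : ℤ) (v : L.V X' Y' p)
      (t : Str B.Hom Y' Y) (q : ℤ), diffApp ψ s p v t q = 0 := fun s p v t q => by
    have := congrArg (fun f => f.1.app s p v t q) hu
    exact this
  have hη : ∀ {X X' : A.Ob} {Y' Y : B.Ob} (s : Str A.Hom X X') (p : ℤ) (v : L.V X' Y' p)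
      (t : Str B.Hom Y' Y) (q : ℤ), ψ.compApp ν s p v t q + diffApp η s p v t q
        = (Multi.id A B L.V).app s p v t q := fun s p v t q => by
    have := congrArg (fun f => f.2.app s p v t q) hu
    exact this
  have e₁ : -g - 1 + 1 = -g := by ring
  have hψ' : IsClosed (K := L) (L := K) (ψ.cast e₁) := (isClosed_cast e₁).2 hψ
  refine ⟨ψ.cast e₁, hψ', ?_, η, fun s p v t q => ?_⟩
  -- For the other composite, `(ψ ∘ ν + id, η ∘ ν)` is a cycle in the cone of `Hom(K,K) → Hom(K,L)`:
  -- by the choice of `η` its second component of the differential is `ν + ν`. The first component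
  -- of a primitive is the required homotopy.
  · obtain ⟨⟨κ, κ'⟩, hκ⟩ := h.cone_acyclic (Q := K) hν (c := 0) (e := g + 1) (by ring)
      ((ν.comp (ψ.cast e₁)).cast (add_neg_cancel g) + Multi.id A B K.V,
        (ν.comp η).cast (by ring)) (Prod.ext (Multi.ext fun s p v t q => by
        rw [coneDiff_fst, ← diff_apply]
        dsimp only
        rw [diff_add, Multi.add_apply, diff_apply, diff_apply, isClosed_id, diffApp_cast,
          (hν.comp hψ') s p v t q, add_zero]
        rfl) (Multi.ext fun s p v t q => by
        rw [coneDiff_snd]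
        dsimp only
        have h₁ : ν.compApp ((ψ.cast e₁).comp ν) s p v t q + ν.compApp (diff η) s p v t q
            = ν.app s p v t q := by
          have e₀ : ((ψ.cast e₁).comp ν).cast (neg_add_cancel g) + (diff η).cast (by ring)
              = Multi.id A B L.V := Multi.ext fun s p v t q => by
            rw [← hη]
            change (ψ.cast e₁).compApp ν s p v t q + _ = _
            rw [Multi.cast_compApp]
            rfl
          rw [← Multi.compApp_id s p t q ν v, ← e₀, Multi.compApp_add]
          rfl
        rw [Multi.add_compApp, Multi.cast_compApp, Multi.comp_compApp, Multi.id_compApp,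
          diffApp_cast, diffApp_comp,
          Multi.compApp_of_left_eq_zero _ _ _ _ (diff ν) _ _ fun s p v t q => hν s p v t q,
          zero_add, add_right_comm, h₁, ZModModule.add_self]
        rfl))
    refine ⟨κ, fun s p v t q => ?_⟩
    have := congrArg (fun f => f.1.app s p v t q) hκ
    rw [ZModModule.sub_eq_add]
    exact this.symm
  · rw [ZModModule.sub_eq_add, ← hη]
    change (ψ.cast e₁).compApp ν s p v t q + _ = _
    rw [Multi.cast_compApp, ← add_assoc, ZModModule.add_self, zero_add]

end PreMor

/-! ## The map `T^∨` is a chain map -/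

namespace HochDual

variable {A : AInfCat.{u, v}} {M : Bimodule.{u, u, v, v, w} A A}
  {M' : Bimodule.{u, u, v, v, w'} A A} {n g : ℤ}

/-- `∑ σ(s₂ ⊗ ν(s₃ ⊗ w ⊗ t, z, s₁))`, the sum over all `s = s₁ ⊗ s₂ ⊗ s₃`. -/
def twoApp (ν : PreMor M M' g) (σ : HochDual A M' n) {X X' Y' Y : A.Ob} (s : Str A.Hom X X') (p : ℤ)
    (w : A.Hom X' Y' p) (t : Str A.Hom Y' Y) (r : ℤ) (z : M.V Y X r) : ZMod 2 :=
  s.sumSplit₃ fun _ _ s₁ s₂ s₃ =>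
    σ.appAt s₂ ((s₃.append (cons p w t)).rdeg A.N + r + s₁.rdeg A.N + g)
      (ν.app (s₃.append (cons p w t)) r z s₁)

theorem twoApp_add (ν : PreMor M M' g) (σ τ : HochDual A M' n) {X X' Y' Y : A.Ob}
    (s : Str A.Hom X X') (p : ℤ) (w : A.Hom X' Y' p) (t : Str A.Hom Y' Y) (r : ℤ) (z : M.V Y X r) :
    twoApp ν (σ + τ) s p w t r z = twoApp ν σ s p w t r z + twoApp ν τ s p w t r z :=
  sumSplit₃_add s _ _

theorem appAt_congr (σ : HochDual A M n) {X Y : A.Ob} (s : Str A.Hom X Y) {d d' : ℤ} (h : d = d')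
    (f : ∀ d, M.V Y X d) : σ.appAt s d f = σ.appAt s d' f := by
  rw [h]

/-- Every application of `μ^A` is sorted by position: inside `s₂` it acts on an argument of `σ`; in
all other positions, including blocks that absorb `w`, it acts on the arguments of `ν`. -/
theorem bar_twoApp (ν : PreMor M M' g) (σ : HochDual A M' n) {X X' Y' Y : A.Ob}
    (s : Str A.Hom X X') (p : ℤ) (w : A.Hom X' Y' p) (t : Str A.Hom Y' Y) (r : ℤ) (z : M.V Y X r) :
    (s.sumSplit fun _ s₁ s₂ => t.sumSplit fun _ t₁ t₂ =>
      twoApp ν σ s₁ (s₂.rdeg A.N + p + t₁.rdeg A.N + -1)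
        (A.μ (s₂.append (cons p w t₁)) (s₂.rdeg A.N + p + t₁.rdeg A.N + -1)) t₂ r z)
      + (A.bar s (fun s' => twoApp ν σ s' p w t r z) + A.bar t (fun t' => twoApp ν σ s p w t' r z))
    = twoApp (M := M) (M' := M') ν.bar σ s p w t r z + twoApp ν σ.barDual s p w t r z := by
  -- On the string `s₃ ⊗ w ⊗ t` a block either contains `w`, or lies in `s₃`, or lies in `t`.
  have e : ∀ {X₁ X₂ : A.Ob} (s₁ : Str A.Hom X X₁) (s₃ : Str A.Hom X₂ X') (d : ℤ),
      ν.bar.app (s₃.append (cons p w t)) r z s₁ d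
        = (s₃.sumSplit fun _ c e => t.sumSplit fun _ t₁ t₂ =>
            ν.app (c.append (cons (e.rdeg A.N + p + t₁.rdeg A.N + -1)
              (A.μ (e.append (cons p w t₁)) (e.rdeg A.N + p + t₁.rdeg A.N + -1)) t₂)) r z s₁ d)
          + (A.bar s₃ (fun s' => ν.app (s'.append (cons p w t)) r z s₁ d)
            + A.bar t (fun t' => ν.app (s₃.append (cons p w t')) r z s₁ d))
          + A.bar s₁ (fun s' => ν.app (s₃.append (cons p w t)) r z s' d) := by
    intro X₁ X₂ s₁ s₃ d
    refine congrArg₂ _ ((A.bar_append_cons s₃ p w t _).trans (congrArg₂ _ ?_ rfl)) rfl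
    refine sumSplit_congr _ fun _ c e _ => sumSplit_congr _ fun _ t₁ t₂ _ => ?_
    rw [show (e.append (cons p w t₁)).rdeg A.N - 2 + A.N
      = e.rdeg A.N + p + t₁.rdeg A.N + -1 by simp; ring]
    rfl
  have h₁ : (s.sumSplit fun _ s₁ s₂ => t.sumSplit fun _ t₁ t₂ =>
      twoApp ν σ s₁ (s₂.rdeg A.N + p + t₁.rdeg A.N + -1)
        (A.μ (s₂.append (cons p w t₁)) (s₂.rdeg A.N + p + t₁.rdeg A.N + -1)) t₂ r z)
      = s.sumSplit₃ fun _ _ s₁ s₂ s₃ =>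
        σ.app s₂ ((s₃.append (cons p w t)).rdeg A.N + r + s₁.rdeg A.N + (g + -1))
          (s₃.sumSplit fun _ c e => t.sumSplit fun _ t₁ t₂ =>
            ν.app (c.append (cons (e.rdeg A.N + p + t₁.rdeg A.N + -1)
              (A.μ (e.append (cons p w t₁)) (e.rdeg A.N + p + t₁.rdeg A.N + -1)) t₂)) r z s₁
              ((s₃.append (cons p w t)).rdeg A.N + r + s₁.rdeg A.N + (g + -1))) := by
    let H : ∀ U₁ U₂ U₃, Str A.Hom X U₁ → Str A.Hom U₁ U₂ → Str A.Hom U₂ U₃ → Str A.Hom U₃ X' →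
        ∀ U, Str A.Hom Y' U → Str A.Hom U Y → ZMod 2 := fun _ _ _ s₁ s₂ c e _ t₁ t₂ =>
      σ.appAt s₂ ((c.append (cons (e.rdeg A.N + p + t₁.rdeg A.N + -1)
          (A.μ (e.append (cons p w t₁)) (e.rdeg A.N + p + t₁.rdeg A.N + -1)) t₂)).rdeg A.N
          + r + s₁.rdeg A.N + g)
        (ν.app (c.append (cons (e.rdeg A.N + p + t₁.rdeg A.N + -1)
          (A.μ (e.append (cons p w t₁)) (e.rdeg A.N + p + t₁.rdeg A.N + -1)) t₂)) r z s₁)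
    have l : ∀ (U : A.Ob) (a : Str A.Hom X U) (e : Str A.Hom U X'),
        (t.sumSplit fun _ t₁ t₂ => twoApp ν σ a (e.rdeg A.N + p + t₁.rdeg A.N + -1)
          (A.μ (e.append (cons p w t₁)) (e.rdeg A.N + p + t₁.rdeg A.N + -1)) t₂ r z)
        = a.sumSplit fun U₁ s₁ b => b.sumSplit fun U₂ s₂ c => t.sumSplit fun V t₁ t₂ =>
          H U₁ U₂ U s₁ s₂ c e V t₁ t₂ := by
      intro U a e
      unfold twoApp sumSplit₃
      rw [sumSplit_comm]
      exact sumSplit_congr _ fun _ _ _ _ => sumSplit_comm _ _ _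
    simp only [l]
    refine (sumSplit_assoc s fun U₁ U s₁ b e => b.sumSplit fun U₂ s₂ c => t.sumSplit fun V t₁ t₂ =>
      H U₁ U₂ U s₁ s₂ c e V t₁ t₂).trans ?_
    refine sumSplit_congr s fun U₁ s₁ b _ => ?_
    refine (sumSplit_assoc b fun U₂ U s₂ c e => t.sumSplit fun V t₁ t₂ =>
      H U₁ U₂ U s₁ s₂ c e V t₁ t₂).trans ?_
    refine sumSplit_congr b fun U₂ s₂ s₃ _ => ?_
    refine Eq.trans ?_ (map_sumSplit (σ.appHom s₂ _) s₃ _).symm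
    refine sumSplit_congr _ fun _ c e hce => ?_
    refine Eq.trans ?_ (map_sumSplit (σ.appHom s₂ _) t _).symm
    refine sumSplit_congr _ fun _ t₁ t₂ ht => ?_
    refine σ.appAt_congr s₂ ?_ _
    subst hce; subst ht; simp; ring
  have h₂ : A.bar s (fun s' => twoApp ν σ s' p w t r z)
      = s.sumSplit₃ fun _ _ s₁ s₂ s₃ =>
        σ.app s₂ ((s₃.append (cons p w t)).rdeg A.N + r + s₁.rdeg A.N + (g + -1))
          (A.bar s₁ fun s' => ν.app (s₃.append (cons p w t)) r z s'
            ((s₃.append (cons p w t)).rdeg A.N + r + s₁.rdeg A.N + (g + -1)))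
        + σ.barDual.appAt s₂ ((s₃.append (cons p w t)).rdeg A.N + r + s₁.rdeg A.N + g)
          (ν.app (s₃.append (cons p w t)) r z s₁)
        + σ.app s₂ ((s₃.append (cons p w t)).rdeg A.N + r + s₁.rdeg A.N + (g + -1))
          (A.bar s₃ fun s' => ν.app (s'.append (cons p w t)) r z s₁
            ((s₃.append (cons p w t)).rdeg A.N + r + s₁.rdeg A.N + (g + -1))) := by
    unfold twoApp
    rw [A.bar_sumSplit₃]
    refine sumSplit₃_congr s fun _ _ s₁ s₂ s₃ _ => congrArg₂ _ (congrArg₂ _ ?_ rfl) ?_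
    · refine Eq.trans ?_ (A.map_bar (σ.appHom s₂ _) s₁ _).symm
      refine A.bar_congr s₁ fun a ha => σ.appAt_congr s₂ ?_ _
      rw [ha]; ring
    · refine Eq.trans ?_ (A.map_bar (σ.appHom s₂ _) s₃ _).symm
      refine A.bar_congr s₃ fun a ha => σ.appAt_congr s₂ ?_ _
      rw [rdeg_append, rdeg_append, ha]; ring
  have h₃ : A.bar t (fun t' => twoApp ν σ s p w t' r z)
      = s.sumSplit₃ fun _ _ s₁ s₂ s₃ =>
        σ.app s₂ ((s₃.append (cons p w t)).rdeg A.N + r + s₁.rdeg A.N + (g + -1))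
          (A.bar t fun t' => ν.app (s₃.append (cons p w t')) r z s₁
            ((s₃.append (cons p w t)).rdeg A.N + r + s₁.rdeg A.N + (g + -1))) := by
    unfold twoApp sumSplit₃
    rw [A.bar_sumSplit_comm]
    refine sumSplit_congr _ fun _ s₁ b _ => ?_
    rw [A.bar_sumSplit_comm]
    refine sumSplit_congr _ fun _ s₂ s₃ _ => ?_
    refine Eq.trans ?_ (A.map_bar (σ.appHom s₂ _) t _).symm
    refine A.bar_congr t fun a ha => σ.appAt_congr s₂ ?_ _
    rw [rdeg_append, rdeg_append, rdeg_cons, rdeg_cons, ha]; ring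
  rw [h₁, h₂, h₃]
  unfold twoApp
  rw [← sumSplit₃_add, ← sumSplit₃_add, ← sumSplit₃_add]
  refine sumSplit₃_congr s fun _ _ s₁ s₂ s₃ _ => ?_
  conv_rhs => unfold appAt
  rw [e, σ.right, σ.right, σ.right]
  unfold appAt
  abel

/-- The inner map `f` takes a terminal piece of `s₃ ⊗ w ⊗ t`. If this piece contains `w`, then `h`
merely transforms the functional; if it lies inside `t`, then `f` acts on `z` first and `w` is left
to `h`. -/
theorem twoApp_comp {M'' : Bimodule.{u, u, v, v, w''} A A} {g' : ℤ} (f : PreMor M M' g)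
    (h : PreMor M' M'' g') (σ : HochDual A M'' n) {X X' Y' Y : A.Ob}
    (s : Str A.Hom X X') (p : ℤ) (w : A.Hom X' Y' p) (t : Str A.Hom Y' Y) (r : ℤ) (z : M.V Y X r) :
    twoApp (M := M) (M' := M'') (f.comp h) σ s p w t r z
      = twoApp f (mapDual h σ) s p w t r z
        + s.sumSplit (fun _ s₁ s₂ => t.sumSplit fun _ t₁ t₂ =>
          twoApp h σ s₂ p w t₁ (t₂.rdeg A.N + r + s₁.rdeg A.N + g)
            (f.app t₂ r z s₁ (t₂.rdeg A.N + r + s₁.rdeg A.N + g))) := by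
  have e : ∀ {X₁ X₂ : A.Ob} (s₁ : Str A.Hom X X₁) (s₃ : Str A.Hom X₂ X') (d : ℤ),
      (f.comp h).app (s₃.append (cons p w t)) r z s₁ d
        = (s₁.sumSplit fun _ a b => s₃.sumSplit fun _ c e =>
            h.app c ((e.append (cons p w t)).rdeg A.N + r + a.rdeg A.N + g)
              (f.app (e.append (cons p w t)) r z a
                ((e.append (cons p w t)).rdeg A.N + r + a.rdeg A.N + g)) b d)
          + (s₁.sumSplit fun _ a b => t.sumSplit fun _ t₁ t₂ =>
            h.app (s₃.append (cons p w t₁)) (t₂.rdeg A.N + r + a.rdeg A.N + g)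
              (f.app t₂ r z a (t₂.rdeg A.N + r + a.rdeg A.N + g)) b d) := by
    intro X₁ X₂ s₁ s₃ d
    change ((s₃.append (cons p w t)).sumSplit fun _ c e => s₁.sumSplit fun _ a b =>
      h.app c (e.rdeg A.N + r + a.rdeg A.N + g) (f.app e r z a (e.rdeg A.N + r + a.rdeg A.N + g))
        b d) = _
    rw [sumSplit_append_cons]
    exact congrArg₂ _ (sumSplit_comm _ _ _) (sumSplit_comm _ _ _)
  have h₁ : twoApp f (mapDual h σ) s p w t r z = s.sumSplit₃ fun _ _ s₁ s₂ s₃ =>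
      σ.app s₂ ((s₃.append (cons p w t)).rdeg A.N + r + s₁.rdeg A.N + (g + g'))
        (s₁.sumSplit fun _ a b => s₃.sumSplit fun _ c e =>
            h.app c ((e.append (cons p w t)).rdeg A.N + r + a.rdeg A.N + g)
              (f.app (e.append (cons p w t)) r z a
                ((e.append (cons p w t)).rdeg A.N + r + a.rdeg A.N + g)) b
                ((s₃.append (cons p w t)).rdeg A.N + r + s₁.rdeg A.N + (g + g'))) := by
    let H : ∀ U₁ U₂ U₃ U₄, Str A.Hom X U₁ → Str A.Hom U₁ U₂ → Str A.Hom U₂ U₃ → Str A.Hom U₃ U₄ →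
        Str A.Hom U₄ X' → ZMod 2 := fun _ _ _ _ a b s₂ c e =>
      σ.appAt s₂ (c.rdeg A.N + ((e.append (cons p w t)).rdeg A.N + r + a.rdeg A.N + g)
          + b.rdeg A.N + g')
        (h.app c ((e.append (cons p w t)).rdeg A.N + r + a.rdeg A.N + g)
              (f.app (e.append (cons p w t)) r z a
                ((e.append (cons p w t)).rdeg A.N + r + a.rdeg A.N + g)) b)
    have hL : twoApp f (mapDual h σ) s p w t r z = s.sumSplit fun U₁ a q => q.sumSplit fun U₂ b q =>
        q.sumSplit fun U₃ s₂ q => q.sumSplit fun U₄ c e => H U₁ U₂ U₃ U₄ a b s₂ c e := by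
      refine sumSplit_congr s fun U₁ a q _ => ?_
      refine (sumSplit_assoc q fun U₂ U₄ b k e => k.sumSplit fun U₃ s₂ c =>
        H U₁ U₂ U₃ U₄ a b s₂ c e).trans ?_
      exact sumSplit_congr q fun U₂ b q _ =>
        sumSplit_assoc q fun U₃ U₄ s₂ c e => H U₁ U₂ U₃ U₄ a b s₂ c e
    have hR : (s.sumSplit₃ fun _ _ s₁ s₂ s₃ =>
      σ.app s₂ ((s₃.append (cons p w t)).rdeg A.N + r + s₁.rdeg A.N + (g + g'))
        (s₁.sumSplit fun _ a b => s₃.sumSplit fun _ c e =>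
            h.app c ((e.append (cons p w t)).rdeg A.N + r + a.rdeg A.N + g)
              (f.app (e.append (cons p w t)) r z a
                ((e.append (cons p w t)).rdeg A.N + r + a.rdeg A.N + g)) b
                ((s₃.append (cons p w t)).rdeg A.N + r + s₁.rdeg A.N + (g + g'))))
        = s.sumSplit fun U₂ s₁ q => q.sumSplit fun U₃ s₂ s₃ => s₁.sumSplit fun U₁ a b =>
          s₃.sumSplit fun U₄ c e => H U₁ U₂ U₃ U₄ a b s₂ c e := by
      refine sumSplit₃_congr s fun _ _ s₁ s₂ s₃ _ => ?_
      refine (map_sumSplit (σ.appHom s₂ _) s₁ _).trans ?_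
      refine sumSplit_congr _ fun _ a b hab => ?_
      refine (map_sumSplit (σ.appHom s₂ _) s₃ _).trans ?_
      refine sumSplit_congr _ fun _ c e hce => ?_
      refine σ.appAt_congr s₂ ?_ _
      subst hab; subst hce; simp; ring
    rw [hL, hR]
    refine Eq.trans ?_ (sumSplit_congr s fun U₂ s₁ q _ => sumSplit_comm q s₁ _).symm
    exact (sumSplit_assoc s fun U₁ U₂ a b q => q.sumSplit fun U₃ s₂ s₃ =>
      s₃.sumSplit fun U₄ c e => H U₁ U₂ U₃ U₄ a b s₂ c e).symm
  have h₂ : (s.sumSplit (fun _ s₁ s₂ => t.sumSplit fun _ t₁ t₂ =>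
          twoApp h σ s₂ p w t₁ (t₂.rdeg A.N + r + s₁.rdeg A.N + g)
            (f.app t₂ r z s₁ (t₂.rdeg A.N + r + s₁.rdeg A.N + g))))
      = s.sumSplit₃ fun _ _ s₁ s₂ s₃ =>
      σ.app s₂ ((s₃.append (cons p w t)).rdeg A.N + r + s₁.rdeg A.N + (g + g'))
        (s₁.sumSplit fun _ a b => t.sumSplit fun _ t₁ t₂ =>
            h.app (s₃.append (cons p w t₁)) (t₂.rdeg A.N + r + a.rdeg A.N + g)
              (f.app t₂ r z a (t₂.rdeg A.N + r + a.rdeg A.N + g)) b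
                ((s₃.append (cons p w t)).rdeg A.N + r + s₁.rdeg A.N + (g + g'))) := by
    let H : ∀ U₁ U₂ U₃, Str A.Hom X U₁ → Str A.Hom U₁ U₂ → Str A.Hom U₂ U₃ → Str A.Hom U₃ X' →
        ∀ U, Str A.Hom Y' U → Str A.Hom U Y → ZMod 2 := fun _ _ _ a b s₂ s₃ _ t₁ t₂ =>
      σ.appAt s₂ ((s₃.append (cons p w t₁)).rdeg A.N + (t₂.rdeg A.N + r + a.rdeg A.N + g)
          + b.rdeg A.N + g')
        (h.app (s₃.append (cons p w t₁)) (t₂.rdeg A.N + r + a.rdeg A.N + g)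
              (f.app t₂ r z a (t₂.rdeg A.N + r + a.rdeg A.N + g)) b)
    have hR : (s.sumSplit₃ fun _ _ s₁ s₂ s₃ =>
      σ.app s₂ ((s₃.append (cons p w t)).rdeg A.N + r + s₁.rdeg A.N + (g + g'))
        (s₁.sumSplit fun _ a b => t.sumSplit fun _ t₁ t₂ =>
            h.app (s₃.append (cons p w t₁)) (t₂.rdeg A.N + r + a.rdeg A.N + g)
              (f.app t₂ r z a (t₂.rdeg A.N + r + a.rdeg A.N + g)) b
                ((s₃.append (cons p w t)).rdeg A.N + r + s₁.rdeg A.N + (g + g'))))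
        = s.sumSplit fun U₂ s₁ q => q.sumSplit fun U₃ s₂ s₃ => s₁.sumSplit fun U₁ a b =>
          t.sumSplit fun U t₁ t₂ => H U₁ U₂ U₃ a b s₂ s₃ U t₁ t₂ := by
      refine sumSplit₃_congr s fun _ _ s₁ s₂ s₃ _ => ?_
      refine (map_sumSplit (σ.appHom s₂ _) s₁ _).trans ?_
      refine sumSplit_congr _ fun _ a b hab => ?_
      refine (map_sumSplit (σ.appHom s₂ _) t _).trans ?_
      refine sumSplit_congr _ fun _ t₁ t₂ ht => ?_
      refine σ.appAt_congr s₂ ?_ _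
      subst hab; subst ht; simp; ring
    rw [hR]
    refine Eq.trans ?_ (sumSplit_congr s fun U₂ s₁ q _ => sumSplit_comm q s₁ _).symm
    refine Eq.trans ?_ (sumSplit_assoc s fun U₁ U₂ a b q => q.sumSplit fun U₃ s₂ s₃ =>
      t.sumSplit fun U t₁ t₂ => H U₁ U₂ U₃ a b s₂ s₃ U t₁ t₂).symm
    refine sumSplit_congr s fun U₁ a q _ => ?_
    unfold twoApp sumSplit₃
    rw [sumSplit_comm]
    exact sumSplit_congr q fun U₂ b q _ => sumSplit_comm _ _ _
  rw [h₁, h₂]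
  unfold twoApp
  rw [← sumSplit₃_add]
  refine sumSplit₃_congr s fun _ _ s₁ s₂ s₃ _ => ?_
  unfold appAt
  rw [e, σ.right]

end HochDual

/-! ## Pre-morphisms from the diagonal bimodule to a dual bimodule -/

namespace PreMor

variable {A : AInfCat.{u, v}} {M : Bimodule.{u, u, v, v, w} A A} {g : ℤ}

/-- `⟨α(s, w, t), z⟩` for `z` of any degree. -/
def ev (α : PreMor A.diag M.dual g) {X X' Y' Y : A.Ob} (s : Str A.Hom X X') (p : ℤ)
    (w : A.Hom X' Y' p) (t : Str A.Hom Y' Y) (r : ℤ) (z : M.V Y X r) : ZMod 2 :=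
  (α.app s p w t (-r) : Module.Dual (ZMod 2) (M.V Y X (- -r)))
    (degCast (V := fun r => M.V Y X r) (neg_neg r).symm z)

section

variable {X X' Y' Y : A.Ob} (s : Str A.Hom X X') (p : ℤ) (t : Str A.Hom Y' Y) (r : ℤ)

theorem ev_neg (α : PreMor A.diag M.dual g) (w : A.Hom X' Y' p) (q : ℤ) (z : M.V Y X (-q)) :
    ev α s p w t (-q) z = (α.app s p w t q : Module.Dual (ZMod 2) (M.V Y X (-q))) z := by
  have key : ∀ (q' : ℤ) (h : q' = q) (h' : -q = -q'),
      (α.app s p w t q' : Module.Dual (ZMod 2) (M.V Y X (-q')))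
        (degCast (V := fun r => M.V Y X r) h' z)
      = (α.app s p w t q : Module.Dual (ZMod 2) (M.V Y X (-q))) z := by
    rintro q' rfl h'; rfl
  exact key _ (neg_neg q) _

theorem eq_of_ev {α β : PreMor A.diag M.dual g} {w : A.Hom X' Y' p} {q : ℤ}
    (h : ∀ r z, ev α s p w t r z = ev β s p w t r z) : α.app s p w t q = β.app s p w t q :=
  LinearMap.ext fun z => by rw [← ev_neg, ← ev_neg]; exact h _ z

theorem ev_left (α : PreMor A.diag M.dual g) (w : A.Hom X' Y' p) (z : M.V Y X r) :
    IsMultilinear (fun s : Str A.Hom X X' => ev α s p w t r z) := fun P Q a d x x' b =>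
  LinearMap.congr_fun (α.left p w t (-r) P Q a d x x' b) _

theorem ev_mid (α : PreMor A.diag M.dual g) (w w' : A.Hom X' Y' p) (z : M.V Y X r) :
    ev α s p (w + w') t r z = ev α s p w t r z + ev α s p w' t r z :=
  LinearMap.congr_fun (α.mid s p w w' t (-r)) _

theorem ev_right (α : PreMor A.diag M.dual g) (w : A.Hom X' Y' p) (z : M.V Y X r) :
    IsMultilinear (fun t : Str A.Hom Y' Y => ev α s p w t r z) := fun P Q a d x x' b =>
  LinearMap.congr_fun (α.right s p w (-r) P Q a d x x' b) _

theorem ev_add_right (α : PreMor A.diag M.dual g) (w : A.Hom X' Y' p) (z z' : M.V Y X r) :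
    ev α s p w t r (z + z') = ev α s p w t r z + ev α s p w t r z' :=
  (congrArg _ (map_add (degCast (V := fun r => M.V Y X r) (neg_neg r).symm) z z')).trans
    (map_add (α.app s p w t (-r) : Module.Dual (ZMod 2) (M.V Y X (- -r))) _ _)

theorem ev_zero (α : PreMor A.diag M.dual g) (z : M.V Y X r) :
    ev α s p (0 : A.Hom X' Y' p) t r z = 0 :=
  LinearMap.congr_fun (α.app_zero s p t (-r)) _

theorem ev_zero_right (α : PreMor A.diag M.dual g) (w : A.Hom X' Y' p) :
    ev α s p w t r (0 : M.V Y X r) = 0 :=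
  (AddMonoidHom.mk' (ev α s p w t r) (ev_add_right s p t r α w)).map_zero

theorem ev_degree (α : PreMor A.diag M.dual g) (w : A.Hom X' Y' p) (z : M.V Y X r)
    (h : s.rdeg A.N + p + t.rdeg A.N + r ≠ -g) : ev α s p w t r z = 0 :=
  LinearMap.congr_fun (α.degree s p w t (-r) (by omega)) _

theorem ev_add (α β : PreMor A.diag M.dual g) (w : A.Hom X' Y' p) (z : M.V Y X r) :
    ev (α + β) s p w t r z = ev α s p w t r z + ev β s p w t r z := rfl

theorem ev_of_app_eq_zero {α : PreMor A.diag M.dual g} {w : A.Hom X' Y' p}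
    (h : ∀ q, α.app s p w t q = 0) (z : M.V Y X r) : ev α s p w t r z = 0 :=
  LinearMap.congr_fun (h (-r)) _

/-- Evaluation at `z` as a homomorphism. -/
def evalDual {r : ℤ} (z : M.V Y X r) : Module.Dual (ZMod 2) (M.V Y X r) →+ ZMod 2 :=
  AddMonoidHom.mk' (fun ψ => ψ z) (fun _ _ => rfl)

/-- The three groups of terms are the structure map of `M^∨`, seen as an operation on `z`, the
structure map of `A_Δ` absorbing `w`, and the bar differentials of the two strings. -/
theorem ev_diff (α : PreMor A.diag M.dual g) (w : A.Hom X' Y' p) (z : M.V Y X r) :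
    ev (diff α) s p w t r z
      = (s.sumSplit fun _ s₁ s₂ => t.sumSplit fun _ t₁ t₂ =>
          ev α s₂ p w t₁ (t₂.rdeg A.N + r + s₁.rdeg A.N + -1)
            (M.μ.app t₂ r z s₁ (t₂.rdeg A.N + r + s₁.rdeg A.N + -1)))
        + (s.sumSplit fun _ s₁ s₂ => t.sumSplit fun _ t₁ t₂ =>
          ev α s₁ (s₂.rdeg A.N + p + t₁.rdeg A.N + -1)
            (A.μ (s₂.append (cons p w t₁)) (s₂.rdeg A.N + p + t₁.rdeg A.N + -1)) t₂ r z)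
        + (A.bar s (fun s' => ev α s' p w t r z) + A.bar t (fun t' => ev α s p w t' r z)) := by
  obtain ⟨q, rfl⟩ : ∃ q, r = -q := ⟨-r, (neg_neg r).symm⟩
  rw [ev_neg]
  change evalDual z ((diff α).app s p w t q) = _
  change evalDual z (α.compApp M.dual.μ s p w t q + A.diag.μ.compApp α s p w t q
    + (A.bar s (fun s' => α.app s' p w t q) + A.bar t (fun t' => α.app s p w t' q))) = _
  rw [map_add, map_add, map_add, A.map_bar, A.map_bar]
  refine congrArg₂ _ (congrArg₂ _ ?_ ?_) (congrArg₂ _ ?_ ?_)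
  · unfold Multi.compApp
    rw [map_sumSplit]
    refine sumSplit_congr s fun _ s₁ s₂ _ => ?_
    rw [map_sumSplit]
    refine sumSplit_congr t fun _ t₁ t₂ _ => ?_
    change (α.app s₂ p w t₁ (s₂.rdeg A.N + p + t₁.rdeg A.N + g) : Module.Dual (ZMod 2) _)
      (M.μ.app t₂ (-q) z s₁ (-(s₂.rdeg A.N + p + t₁.rdeg A.N + g))) = _
    rw [← ev_neg]
    -- The two sides read the structure map of `M` in degrees that need not agree formally. When
    -- they differ, both terms vanish for degree reasons.
    by_cases h : -(s₂.rdeg A.N + p + t₁.rdeg A.N + g) = t₂.rdeg A.N + -q + s₁.rdeg A.N + -1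
    · rw [h]
    · rw [M.μ.degree _ _ _ _ _ h, ev_zero_right, ev_degree _ _ _ _ _ _ _ (by omega)]
  · unfold Multi.compApp
    rw [map_sumSplit]
    refine sumSplit_congr s fun _ s₁ s₂ _ => ?_
    rw [map_sumSplit]
    refine sumSplit_congr t fun _ t₁ t₂ _ => ?_
    exact (ev_neg _ _ _ _ _ _ _).symm
  · exact congrArg _ (funext fun s' => (ev_neg _ _ _ _ _ _ _).symm)
  · exact congrArg _ (funext fun t' => (ev_neg _ _ _ _ _ _ _).symm)

end

end PreMor

namespace HochDual

variable {A : AInfCat.{u, v}} {M : Bimodule.{u, u, v, v, w} A A} {n : ℤ}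

theorem ev_Tdual (σ : HochDual A M n) {X X' Y' Y : A.Ob} (s : Str A.Hom X X') (p : ℤ)
    (w : A.Hom X' Y' p) (t : Str A.Hom Y' Y) (r : ℤ) (z : M.V Y X r) :
    PreMor.ev σ.Tdual.Γ s p w t r z = twoApp M.μ σ s p w t r z := by
  obtain ⟨q, rfl⟩ : ∃ q, r = -q := ⟨-r, (neg_neg r).symm⟩
  exact PreMor.ev_neg _ _ _ _ _ _ _

/-- `Γ ∘ T^∨` is a chain map. -/
theorem diffApp_Tdual (σ : HochDual A M n) {X X' Y' Y : A.Ob} (s : Str A.Hom X X') (p : ℤ)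
    (w : A.Hom X' Y' p) (t : Str A.Hom Y' Y) (q : ℤ) :
    PreMor.diffApp (σ.Tdual.Γ) s p w t q = σ.diff.Tdual.Γ.app s p w t q := by
  rw [← PreMor.diff_apply]
  refine LinearMap.ext fun z => ?_
  have h₁ := PreMor.ev_neg s p t (PreMor.diff σ.Tdual.Γ) w q z
  have h₂ := PreMor.ev_neg s p t σ.diff.Tdual.Γ w q z
  refine h₁.symm.trans (Eq.trans ?_ h₂)
  rw [PreMor.ev_diff]
  simp only [ev_Tdual]
  have h₃ := bar_twoApp M.μ σ s p w t (-q) z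
  have h₄ := twoApp_comp M.μ M.μ σ s p w t (-q) z
  rw [PreMor.mu_comp_mu] at h₄
  rw [add_assoc, h₃, h₄]
  change _ = twoApp M.μ (σ.barDual + mapDual M.μ σ) s p w t (-q) z
  rw [twoApp_add]
  -- `x` collects the terms in which `μ^M` acts on `z` before meeting `w`. They occur in the
  -- differential of the pre-morphism and again in the expansion of `μ^M ∘ μ^M`, hence cancel.
  generalize (s.sumSplit fun _ s₁ s₂ => t.sumSplit fun _ t₁ t₂ => twoApp M.μ σ s₂ p w t₁ _ _) = x
  calc _ = x + x + (twoApp M.μ σ.barDual s p w t (-q) z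
        + twoApp M.μ (mapDual M.μ σ) s p w t (-q) z) := by abel
    _ = _ := by rw [ZModModule.add_self, zero_add]

end HochDual

/-! ## Every bimodule morphism `A_Δ → M^∨` comes from a closed functional -/

/-- The leading term of a functional evaluated on the middle piece: if it vanishes on shorter
strings, the middle piece is the whole string. -/
theorem Str.sumSplit₃_eq_mid {Ob : Type u} {V : Ob → Ob → ℤ → Type v} {R : Type w} [AddCommMonoid R]
    {X Z : Ob} (s : Str V X Z) (F : ∀ Y Y', Str V X Y → Str V Y Y' → Str V Y' Z → R)
    (h : ∀ Y Y' a b c, b.length < s.length → F Y Y' a b c = 0) :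
    s.sumSplit₃ F = F X Z (nil X) s (nil Z) := by
  unfold sumSplit₃
  rw [sumSplit_eq_right, sumSplit_eq_left]
  · exact fun Y a b _ hl => h _ _ _ _ _ hl
  · intro Y a r hr hl
    refine (sumSplit_congr r fun Y' b c hb => ?_).trans (sumSplit_zero r)
    refine h _ _ _ _ _ (lt_of_le_of_lt ?_ hl)
    subst hb; simp

/-! ### Insertion of a unit and its differential -/

namespace PreMor

variable {A : AInfCat.{u, v}} {M : Bimodule.{u, u, v, v, w} A A} {g m : ℤ}

/-- `(s, w, t) ↦ α(s, e, w ⊗ t)`. -/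
def insertUnit (e : ∀ X, A.Hom X X A.N) (α : PreMor A.diag M.dual m) : PreMor A.diag M.dual (m + 1) where
  app := fun s p w t q => α.app s A.N (e _) (cons p w t) q
  left := fun p w t q => α.left A.N (e _) (cons p w t) q
  mid := fun s p w w' t q => α.right s A.N (e _) q _ _ (nil _) p w w' t
  right := fun s p w q => (α.right s A.N (e _) q).cons p w
  degree := fun s p w t q h => α.degree _ _ _ _ _ (by rw [rdeg_cons]; omega)

/-- `(s, w, t) ↦ α(s, K w, t)`. -/
def precomp (K : ∀ X Y p q, A.Hom X Y p →ₗ[ZMod 2] A.Hom X Y q) (α : PreMor A.diag M.dual m) :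
    PreMor A.diag M.dual (m + 1) where
  app := fun s p w t q => α.app s (p + 1) (K _ _ p (p + 1) w) t q
  left := fun p w t q => α.left (p + 1) (K _ _ p (p + 1) w) t q
  mid := fun s p w w' t q => by
    rw [map_add]
    exact α.mid s (p + 1) _ _ t q
  right := fun s p w q => α.right s (p + 1) (K _ _ p (p + 1) w) q
  degree := fun s p w t q h => α.degree _ _ _ _ _ (by omega)

variable {X X' Y' Y : A.Ob} (s : Str A.Hom X X') (p : ℤ) (t : Str A.Hom Y' Y) (r : ℤ)

theorem ev_congr (α : PreMor A.diag M.dual m) {p p' : ℤ} (h : p = p') (w : ∀ p, A.Hom X' Y' p)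
    (z : M.V Y X r) : ev α s p (w p) t r z = ev α s p' (w p') t r z := by
  rw [h]

theorem ev_congr_right (α : PreMor A.diag M.dual m) {r r' : ℤ} (h : r = r') (w : A.Hom X' Y' p)
    (z : ∀ r, M.V Y X r) : ev α s p w t r (z r) = ev α s p w t r' (z r') := by
  rw [h]

theorem ev_sub (α β : PreMor A.diag M.dual m) (w : A.Hom X' Y' p) (z : M.V Y X r) :
    ev (α - β) s p w t r z = ev α s p w t r z - ev β s p w t r z :=
  map_sub (AddMonoidHom.mk' (fun α : PreMor A.diag M.dual m => ev α s p w t r z) fun _ _ => rfl) α β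

/-- The differential at `w` is compared with that of `α` at `K w`, which vanishes by hypothesis. In
leading weight they differ only in the terms where `μ^A` absorbs the central entry, and there only
`μ₁` survives: `α(s, K d w, t)` replaces `α(s, d K w, t)`. -/
theorem ev_diff_precomp {K : ∀ X Y p q, A.Hom X Y p →ₗ[ZMod 2] A.Hom X Y q}
    {α : PreMor A.diag M.dual m} {k : ℕ}
    (hα : ∀ {X X' Y' Y : A.Ob} (s : Str A.Hom X X') (p : ℤ) (w : A.Hom X' Y' p)
      (t : Str A.Hom Y' Y) (r : ℤ) (z : M.V Y X r), 2 * s.length + 1 + t.length < k →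
      ev α s p w t r z = 0)
    (w : A.Hom X' Y' p) (z : M.V Y X r) (hk : 2 * s.length + 1 + t.length ≤ k)
    (hd : ev (diff α) s (p + 1) (K X' Y' p (p + 1) w) t r z = 0) :
    ev (diff (precomp K α)) s p w t r z
      = ev α s p (A.diag.d X' Y' (p + 1) p (K X' Y' p (p + 1) w)
          + K X' Y' (p - 1) p (A.diag.d X' Y' p (p - 1) w)) t r z := by
  -- Any cut that shortens `s` or `t` brings the weight strictly below `k`, where `α` vanishes.
  have lead : ∀ F : (∀ U U₁, Str A.Hom X U → Str A.Hom U X' → Str A.Hom Y' U₁ →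
      Str A.Hom U₁ Y → ZMod 2),
      (∀ U U₁ s₁ s₂ t₁ t₂, 2 * s₁.length + 1 + t₂.length < k → F U U₁ s₁ s₂ t₁ t₂ = 0) →
      (s.sumSplit fun _ s₁ s₂ => t.sumSplit fun _ t₁ t₂ => F _ _ s₁ s₂ t₁ t₂)
        = F _ _ s (nil _) (nil _) t := by
    intro F hF
    rw [sumSplit_eq_left, sumSplit_eq_right]
    · exact fun Y a b _ hl => hF _ _ _ _ _ _ (by omega)
    · intro Z a b hab hl
      refine (sumSplit_congr t fun _ t₁ t₂ ht => ?_).trans (sumSplit_zero t)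
      subst ht
      exact hF _ _ _ _ _ _ (by simp only [length_append] at hk; omega)
  rw [ev_diff] at hd ⊢
  rw [lead _ fun _ _ s₁ s₂ t₁ t₂ h => hα _ _ _ _ _ _ h] at hd
  rw [lead (fun _ _ s₁ s₂ t₁ t₂ => ev (precomp K α) s₁ (s₂.rdeg A.N + p + t₁.rdeg A.N + -1)
    (A.μ (s₂.append (cons p w t₁)) (s₂.rdeg A.N + p + t₁.rdeg A.N + -1)) t₂ r z)
    fun _ _ s₁ s₂ t₁ t₂ h => hα _ _ _ _ _ _ h, ev_mid]
  have h₁ : ev (precomp K α) s ((nil X' : Str A.Hom X' X').rdeg A.N + p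
        + (nil Y' : Str A.Hom Y' Y').rdeg A.N + -1)
        (A.μ ((nil X').append (cons p w (nil Y'))) ((nil X' : Str A.Hom X' X').rdeg A.N + p
        + (nil Y' : Str A.Hom Y' Y').rdeg A.N + -1)) t r z
      = ev α s p (K X' Y' (p - 1) p (A.diag.d X' Y' p (p - 1) w)) t r z := by
    have : (nil X' : Str A.Hom X' X').rdeg A.N + p
        + (nil Y' : Str A.Hom Y' Y').rdeg A.N + -1 = p - 1 := by simp; ring
    rw [this]
    exact ev_congr s t r α (show p - 1 + 1 = p by ring)
      (fun q => K X' Y' (p - 1) q (A.diag.d X' Y' p (p - 1) w)) z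
  have h₂ : ev α s ((nil X' : Str A.Hom X' X').rdeg A.N + (p + 1)
        + (nil Y' : Str A.Hom Y' Y').rdeg A.N + -1)
        (A.μ ((nil X').append (cons (p + 1) (K X' Y' p (p + 1) w) (nil Y')))
          ((nil X' : Str A.Hom X' X').rdeg A.N + (p + 1)
        + (nil Y' : Str A.Hom Y' Y').rdeg A.N + -1)) t r z
      = ev α s p (A.diag.d X' Y' (p + 1) p (K X' Y' p (p + 1) w)) t r z := by
    have : (nil X' : Str A.Hom X' X').rdeg A.N + (p + 1)
        + (nil Y' : Str A.Hom Y' Y').rdeg A.N + -1 = p := by simp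
    rw [this]
    rfl
  rw [h₁]
  rw [h₂] at hd
  generalize ev α s p (A.diag.d X' Y' (p + 1) p (K X' Y' p (p + 1) w)) t r z = a at hd ⊢
  generalize ev α s p (K X' Y' (p - 1) p (A.diag.d X' Y' p (p - 1) w)) t r z = b
  have h₃ : ∀ x y z : ZMod 2, a + b + (x + b + (y + z)) = x + a + (y + z) + (b + b) := by
    intros; abel
  exact (eq_of_add_eq_zero_of_charTwo ((h₃ _ _ _).trans
    (by rw [ZModModule.add_self, add_zero]; exact hd))).symm

/-- The differential at `(s, w, t)` is compared with the vanishing differential of `α` at `(s, e, w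
⊗ t)`. The latter has two further surviving terms: `μ^M` consumes all of `w ⊗ t`, or `μ₂` multiplies
`e` by `w`. The term containing `μ₁(e)` vanishes because `e` is a cycle. -/
theorem ev_diff_insertUnit {e : ∀ X, A.Hom X X A.N}
    (he : ∀ X, A.diag.d X X A.N (A.N - 1) (e X) = 0) {α : PreMor A.diag M.dual m} {k : ℕ}
    (hα : ∀ {X X' Y' Y : A.Ob} (s : Str A.Hom X X') (p : ℤ) (w : A.Hom X' Y' p)
      (t : Str A.Hom Y' Y) (r : ℤ) (z : M.V Y X r), 2 * s.length + 1 + t.length < k →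
      ev α s p w t r z = 0)
    (w : A.Hom X' Y' p) (z : M.V Y X r) {r' : ℤ} (hr : r' = (cons p w t).rdeg A.N + r - 1)
    (hk : 2 * s.length + 1 + t.length ≤ k)
    (hd : ev (diff α) s A.N (e X') (cons p w t) r z = 0) :
    ev (diff (insertUnit e α)) s p w t r z
      = ev α s A.N (e X') (nil X') r' (M.μ.app (cons p w t) r z (nil X) r')
        + ev α s p (A.μ (cons A.N (e X') (cons p w (nil Y'))) p) t r z := by
  have hμ : (A.μ (cons A.N (e X') (nil X')) (A.N - 1)) = 0 := he X'
  rw [ev_diff] at hd ⊢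
  simp only [sumSplit_cons, sumSplit_add] at hd
  have h₁ : (s.sumSplit fun _ s₁ s₂ =>
      ev α s₂ A.N (e X') (nil X') ((cons p w t).rdeg A.N + r + s₁.rdeg A.N + -1)
        (M.μ.app (cons p w t) r z s₁ ((cons p w t).rdeg A.N + r + s₁.rdeg A.N + -1)))
      = ev α s A.N (e X') (nil X') r' (M.μ.app (cons p w t) r z (nil X) r') := by
    rw [sumSplit_eq_right]
    · exact ev_congr_right s A.N _ α (by rw [hr, rdeg_nil]; ring) (e X')
        fun r' => M.μ.app (cons p w t) r z (nil X) r'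
    · exact fun _ a b _ hl => hα _ _ _ _ _ _ (by rw [length_nil]; omega)
  have h₂ : (s.sumSplit fun _ s₁ s₂ =>
      ev α s₁ (s₂.rdeg A.N + A.N + (nil X' : Str A.Hom X' X').rdeg A.N + -1)
        (A.μ (s₂.append (cons A.N (e X') (nil X')))
          (s₂.rdeg A.N + A.N + (nil X' : Str A.Hom X' X').rdeg A.N + -1)) (cons p w t) r z) = 0 := by
    rw [sumSplit_eq_left]
    · rw [show (nil X' : Str A.Hom X' X').rdeg A.N + A.N + (nil X' : Str A.Hom X' X').rdeg A.N + -1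
        = A.N - 1 by simp; ring, nil_append, hμ, ev_zero]
    · exact fun _ a b _ hl => hα _ _ _ _ _ _ (by rw [length_cons]; omega)
  have h₃ : (s.sumSplit fun _ s₁ s₂ => t.sumSplit fun _ t₁ t₂ =>
      ev α s₁ (s₂.rdeg A.N + A.N + (cons p w t₁).rdeg A.N + -1)
        (A.μ (s₂.append (cons A.N (e X') (cons p w t₁)))
          (s₂.rdeg A.N + A.N + (cons p w t₁).rdeg A.N + -1)) t₂ r z)
      = ev α s p (A.μ (cons A.N (e X') (cons p w (nil Y'))) p) t r z := by
    rw [sumSplit_eq_left, sumSplit_eq_right]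
    · rw [show (nil X' : Str A.Hom X' X').rdeg A.N + A.N + (cons p w (nil Y')).rdeg A.N + -1 = p by
        simp; ring]
      rfl
    · exact fun Y a b _ hl => hα _ _ _ _ _ _ (by omega)
    · intro Z a b hab hl
      refine (sumSplit_congr t fun _ t₁ t₂ ht => ?_).trans (sumSplit_zero t)
      subst ht
      exact hα _ _ _ _ _ _ (by simp only [length_append] at hk; omega)
  -- In leading weight the blocks absorbing `w` use no entry of `s`; they are precisely the bar
  -- terms on `w ⊗ t` whose block starts at `w`, as isolated in the following claim.
  have h₄ : (s.sumSplit fun _ s₁ s₂ => t.sumSplit fun _ t₁ t₂ =>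
      ev (insertUnit e α) s₁ (s₂.rdeg A.N + p + t₁.rdeg A.N + -1)
        (A.μ (s₂.append (cons p w t₁)) (s₂.rdeg A.N + p + t₁.rdeg A.N + -1)) t₂ r z)
      = t.sumSplit fun _ t₁ t₂ => ev α s A.N (e X') (consAt ((cons p w t₁).rdeg A.N - 2 + A.N)
          (A.μ (cons p w t₁)) t₂) r z := by
    rw [sumSplit_eq_left]
    · refine sumSplit_congr t fun _ t₁ t₂ _ => ?_
      rw [show (cons p w t₁).rdeg A.N - 2 + A.N
        = (nil X' : Str A.Hom X' X').rdeg A.N + p + t₁.rdeg A.N + -1 by simp; ring]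
      rfl
    · intro Z a b hab hl
      refine (sumSplit_congr t fun _ t₁ t₂ ht => ?_).trans (sumSplit_zero t)
      subst ht
      exact hα _ _ _ _ _ _ (by simp only [length_append, length_cons] at hk ⊢; omega)
  have h₅ : A.bar (cons p w t) (fun t' => ev α s A.N (e X') t' r z)
      = (t.sumSplit fun _ t₁ t₂ => ev α s A.N (e X') (consAt ((cons p w t₁).rdeg A.N - 2 + A.N)
          (A.μ (cons p w t₁)) t₂) r z)
        + A.bar t (fun t' => ev α s A.N (e X') (cons p w t') r z) := by
    have h := A.bar_append_cons (nil X') p w t (fun t' => ev α s A.N (e X') t' r z)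
    rw [A.bar_nil ((ev_right s A.N r α (e X') z).appendRight (cons p w t)), zero_add] at h
    exact h
  rw [h₄]
  rw [h₁, h₂, h₃, h₅, zero_add] at hd
  generalize ev α s A.N (e X') (nil X') r' (M.μ.app (cons p w t) r z (nil X) r') = a at hd ⊢
  generalize ev α s p (A.μ (cons A.N (e X') (cons p w (nil Y'))) p) t r z = b at hd ⊢
  generalize (t.sumSplit fun _ t₁ t₂ => ev α s A.N (e X') (consAt ((cons p w t₁).rdeg A.N - 2 + A.N)
          (A.μ (cons p w t₁)) t₂) r z) = c at hd ⊢
  have h₆ : ∀ x u v : ZMod 2, a + b + (x + c + (u + v)) = a + x + b + (u + (c + v)) := by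
    intros; abel
  exact (eq_of_add_eq_zero_of_charTwo ((h₆ _ _ _).trans hd)).symm

end PreMor

/-! ### The cone of `Γ ∘ T^∨` -/

namespace HochDual

variable {A : AInfCat.{u, v}} {M : Bimodule.{u, u, v, v, w} A A} {n n' m m' : ℤ}

theorem mapApp_leading (σ : HochDual A M n) {X Y : A.Ob} (s : Str A.Hom X Y) (p : ℤ)
    (hσ : ∀ {X' Y' : A.Ob} (s' : Str A.Hom X' Y') (p : ℤ) (z : M.V Y' X' p),
      s'.length < s.length → σ.app s' p z = 0) (z : M.V Y X p) :
    mapApp s p M.μ σ z = σ.app s (p - 1) (M.d Y X p (p - 1) z) := by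
  refine (sumSplit₃_eq_mid s _ fun _ _ a b c h => hσ b _ _ h).trans ?_
  exact σ.appAt_congr s (by simp; ring) (M.μ.app (nil Y) p z (nil X))

theorem twoApp_leading (σ : HochDual A M n) {X X' Y' Y : A.Ob} (s : Str A.Hom X X') (p : ℤ)
    (w : A.Hom X' Y' p) (t : Str A.Hom Y' Y) (r : ℤ)
    (hσ : ∀ {U U' : A.Ob} (s' : Str A.Hom U U') (p : ℤ) (z : M.V U' U p),
      s'.length < s.length → σ.app s' p z = 0) (z : M.V Y X r) {r' : ℤ}
    (hr : r' = (cons p w t).rdeg A.N + r - 1) :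
    twoApp M.μ σ s p w t r z = σ.app s r' (M.μ.app (cons p w t) r z (nil X) r') := by
  refine (sumSplit₃_eq_mid s _ fun _ _ a b c h => hσ b _ _ h).trans ?_
  exact σ.appAt_congr s (by rw [hr, nil_append, rdeg_nil]; ring) (M.μ.app (cons p w t) r z (nil X))

/-- The functional `(s, z) ↦ ⟨α(s, e), z⟩ + σ(s, K z)`. -/
def primitive (e : ∀ X, A.Hom X X A.N)
    (K : ∀ (X Y : A.Ob) (p q : ℤ), M.V X Y p →ₗ[ZMod 2] M.V X Y q) (hm : m = n + 1 - 2 * A.N)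
    (σ : HochDual A M n) (α : PreMor A.diag M.dual m) : HochDual A M (n + 1) where
  app := fun s p z => PreMor.ev α s A.N (e _) (nil _) p z + σ.app s (p + 1) (K _ _ p (p + 1) z)
  left := fun p z => (PreMor.ev_left A.N (nil _) p α (e _) z).add (σ.left (p + 1) _)
  right := fun s p z z' => by
    rw [PreMor.ev_add_right, map_add, σ.right]
    abel
  degree := fun s p z h => by
    rw [PreMor.ev_degree _ _ _ _ _ _ _ (by rw [rdeg_nil]; omega), σ.degree _ _ _ (by omega),
      add_zero]

/-- The differential of the cone of `Γ ∘ T^∨`. -/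
def coneDiff (hn : n' = n + -1) (hm : m = n + 1 - 2 * A.N) (hm' : m' = n - 2 * A.N) :
    (HochDual A M n × PreMor A.diag M.dual m) →+ (HochDual A M n' × PreMor A.diag M.dual m') :=
  AddMonoidHom.mk' (fun f => (f.1.diff.cast hn.symm,
      f.1.Tdual.Γ.cast hm'.symm + (PreMor.diff f.2).cast (by omega)))
    (fun f h => Prod.ext (by
        rw [Prod.fst_add, diff_add]; rfl) (by
        change (f.1 + h.1).Tdual.Γ.cast _ + (PreMor.diff (f.2 + h.2)).cast _
          = (f.1.Tdual.Γ.cast _ + (PreMor.diff f.2).cast _)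
            + (h.1.Tdual.Γ.cast _ + (PreMor.diff h.2).cast _)
        rw [PreMor.diff_add]
        refine Multi.ext fun s p w t q => PreMor.eq_of_ev s p t fun r z => ?_
        change PreMor.ev (f.1 + h.1).Tdual.Γ s p w t r z
            + (PreMor.ev (PreMor.diff f.2) s p w t r z + PreMor.ev (PreMor.diff h.2) s p w t r z)
          = PreMor.ev f.1.Tdual.Γ s p w t r z + PreMor.ev (PreMor.diff f.2) s p w t r z
            + (PreMor.ev h.1.Tdual.Γ s p w t r z + PreMor.ev (PreMor.diff h.2) s p w t r z)
        rw [ev_Tdual, ev_Tdual, ev_Tdual, twoApp_add]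
        abel))

theorem coneDiff_fst (hn : n' = n + -1) (hm : m = n + 1 - 2 * A.N) (hm' : m' = n - 2 * A.N)
    (f : HochDual A M n × PreMor A.diag M.dual m) {X Y : A.Ob} (s : Str A.Hom X Y) (p : ℤ)
    (z : M.V Y X p) : (coneDiff hn hm hm' f).1.app s p z = f.1.diff.app s p z := rfl

theorem coneDiff_snd (hn : n' = n + -1) (hm : m = n + 1 - 2 * A.N) (hm' : m' = n - 2 * A.N)
    (f : HochDual A M n × PreMor A.diag M.dual m) {X X' Y' Y : A.Ob} (s : Str A.Hom X X') (p : ℤ)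
    (w : A.Hom X' Y' p) (t : Str A.Hom Y' Y) (r : ℤ) (z : M.V Y X r) :
    PreMor.ev (coneDiff hn hm hm' f).2 s p w t r z
      = twoApp M.μ f.1 s p w t r z + PreMor.ev (PreMor.diff f.2) s p w t r z := by
  rw [← ev_Tdual]
  rfl

theorem coneDiff_coneDiff {n'' m'' : ℤ} (hn : n' = n + -1) (hm : m = n + 1 - 2 * A.N)
    (hm' : m' = n - 2 * A.N) (hn' : n'' = n' + -1) (hm₂ : m' = n' + 1 - 2 * A.N)
    (hm'' : m'' = n' - 2 * A.N) (f : HochDual A M n × PreMor A.diag M.dual m) :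
    coneDiff hn' hm₂ hm'' (coneDiff hn hm hm' f) = 0 := by
  subst hn
  refine Prod.ext (HochDual.ext fun s p z => ?_) (Multi.ext fun s p w t q => ?_)
  · change f.1.diff.diff.app s p z = 0
    rw [diff_diff]; rfl
  · change f.1.diff.Tdual.Γ.app s p w t q + PreMor.diffApp (K := A.diag) (L := M.dual)
      (f.1.Tdual.Γ.cast hm'.symm + (PreMor.diff f.2).cast (by omega)) s p w t q = 0
    rw [← PreMor.diff_apply, PreMor.diff_add, Multi.add_apply, PreMor.diff_apply,
      PreMor.diff_apply, PreMor.diffApp_cast, PreMor.diffApp_cast, diffApp_Tdual,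
      PreMor.diffApp_diff, add_zero]
    exact ZModModule.add_self _

/-- In leading weight, closedness at `(s, K z)` and at `(s, e; z)` turns the differential of the
primitive into `σ(s, dKz + Kdz + e z)`. The homotopy relation for `K` reduces this to `σ(s, z)`. -/
theorem diff_primitive {e : ∀ X, A.Hom X X A.N}
    (he : ∀ X, A.diag.d X X A.N (A.N - 1) (e X) = 0)
    {K : ∀ (X Y : A.Ob) (p q : ℤ), M.V X Y p →ₗ[ZMod 2] M.V X Y q}
    (hK : ∀ X Y p z, M.d X Y (p + 1) p (K X Y p (p + 1) z) + K X Y (p - 1) p (M.d X Y p (p - 1) z)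
      = M.μ.app (cons A.N (e X) (nil X)) p z (nil Y) p + z)
    (hm : m = n + 1 - 2 * A.N) {σ : HochDual A M n} {α : PreMor A.diag M.dual m} {k : ℕ}
    (hσ : ∀ {X Y : A.Ob} (s : Str A.Hom X Y) (p : ℤ) (z : M.V Y X p), 2 * s.length < k →
      σ.app s p z = 0)
    (hα : ∀ {X X' Y' Y : A.Ob} (s : Str A.Hom X X') (p : ℤ) (w : A.Hom X' Y' p)
      (t : Str A.Hom Y' Y) (r : ℤ) (z : M.V Y X r), 2 * s.length + 1 + t.length < k →
      PreMor.ev α s p w t r z = 0) {X Y : A.Ob} (s : Str A.Hom X Y) (p : ℤ) (z : M.V Y X p)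
    (hk : 2 * s.length ≤ k) (hd₁ : σ.diff.app s (p + 1) (K Y X p (p + 1) z) = 0)
    (hd₂ : twoApp M.μ σ s A.N (e Y) (nil Y) p z
      + PreMor.ev (PreMor.diff α) s A.N (e Y) (nil Y) p z = 0) :
    (primitive e K hm σ α).diff.app s p z = σ.app s p z := by
  have hμ : (A.μ (cons A.N (e Y) (nil Y)) (A.N - 1)) = 0 := he Y
  rw [diff_apply, mapApp_leading _ _ _ (fun s' p z h => by
    change PreMor.ev α s' A.N (e _) (nil _) p z + σ.app s' (p + 1) _ = 0
    rw [hα _ _ _ _ _ _ (by rw [length_nil]; omega), hσ _ _ _ (by omega), add_zero])]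
  rw [diff_apply, mapApp_leading _ _ _ (fun s' p z h => hσ _ _ _ (by omega))] at hd₁
  rw [twoApp_leading _ _ _ _ _ _ (fun s' p z h => hσ _ _ _ (by omega)) z (r' := p) (by simp),
    PreMor.ev_diff] at hd₂
  simp only [sumSplit_nil] at hd₂
  rw [sumSplit_eq_right s _ fun _ a b _ hl => hα _ _ _ _ _ _ (by rw [length_nil]; omega),
    sumSplit_eq_left s _ fun _ a b _ hl => hα _ _ _ _ _ _ (by rw [length_nil]; omega),
    A.bar_nil (PreMor.ev_right s A.N p α (e Y) z), add_zero] at hd₂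
  rw [show (nil Y : Str A.Hom Y Y).rdeg A.N + A.N + (nil Y : Str A.Hom Y Y).rdeg A.N + -1
        = A.N - 1 by simp; ring, nil_append, hμ, PreMor.ev_zero, add_zero] at hd₂
  have h₁ : PreMor.ev α s A.N (e Y) (nil Y)
      ((nil Y : Str A.Hom Y Y).rdeg A.N + p + (nil X : Str A.Hom X X).rdeg A.N + -1)
      (M.μ.app (nil Y) p z (nil X)
        ((nil Y : Str A.Hom Y Y).rdeg A.N + p + (nil X : Str A.Hom X X).rdeg A.N + -1))
      = PreMor.ev α s A.N (e Y) (nil Y) (p - 1) (M.d Y X p (p - 1) z) :=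
    PreMor.ev_congr_right s A.N _ α (by simp; ring) (e Y) (M.μ.app (nil Y) p z (nil X))
  rw [h₁] at hd₂
  have h₂ : σ.app s (p + 1 - 1) (M.d Y X (p + 1) (p + 1 - 1) (K Y X p (p + 1) z))
      = σ.app s p (M.d Y X (p + 1) p (K Y X p (p + 1) z)) :=
    σ.appAt_congr s (by ring) fun q => M.d Y X (p + 1) q (K Y X p (p + 1) z)
  rw [h₂] at hd₁
  have h₃ : (primitive e K hm σ α).app s (p - 1) (M.d Y X p (p - 1) z)
      = PreMor.ev α s A.N (e Y) (nil Y) (p - 1) (M.d Y X p (p - 1) z)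
        + σ.app s p (K Y X (p - 1) p (M.d Y X p (p - 1) z)) :=
    congrArg (PreMor.ev α s A.N (e Y) (nil Y) (p - 1) (M.d Y X p (p - 1) z) + ·)
      (σ.appAt_congr s (show p - 1 + 1 = p by ring) fun q => K Y X (p - 1) q (M.d Y X p (p - 1) z))
  have h₄ : A.bar s (fun r => (primitive e K hm σ α).app r p z)
      = A.bar s (fun r => PreMor.ev α r A.N (e Y) (nil Y) p z)
        + A.bar s (fun r => σ.app r (p + 1) (K Y X p (p + 1) z)) := A.bar_add s _ _
  have h₅ := congrArg (σ.appHom s p) (hK Y X p z)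
  rw [map_add, map_add] at h₅
  change σ.app _ _ _ + σ.app _ _ _ = σ.app _ _ _ + σ.app _ _ _ at h₅
  rw [h₃, h₄]
  generalize σ.app s p (K Y X (p - 1) p (M.d Y X p (p - 1) z)) = a at h₅ ⊢
  generalize σ.app s p (M.d Y X (p + 1) p (K Y X p (p + 1) z)) = b at h₅ hd₁
  generalize σ.app s p (M.μ.app (cons A.N (e Y) (nil Y)) p z (nil X) p) = c at h₅ hd₂
  generalize PreMor.ev α s A.N (e Y) (nil Y) (p - 1) (M.d Y X p (p - 1) z) = f at hd₂ ⊢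
  generalize A.bar s (fun r => σ.app r (p + 1) (K Y X p (p + 1) z)) = x at hd₁ ⊢
  generalize A.bar s (fun r => PreMor.ev α r A.N (e Y) (nil Y) p z) = y at hd₂ ⊢
  generalize σ.app s p z = o at h₅ ⊢
  -- The remaining claim is a linear identity between seven elements of `ZMod 2`, checked by
  -- exhaustion.
  revert a b c f x y o
  decide

/-- The term `α(s, e; μ^M(w, t, z))` produced by `T^∨` cancels the one from the differential of
`insertUnit`. There remain `α(s, e w, t)` and, from `precomp`, `α(s, e w + w, t)`, whose sum is
`α(s, w, t)`. -/
theorem twoApp_primitive {e : ∀ X, A.Hom X X A.N}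
    (he : ∀ X, A.diag.d X X A.N (A.N - 1) (e X) = 0)
    {K : ∀ (X Y : A.Ob) (p q : ℤ), M.V X Y p →ₗ[ZMod 2] M.V X Y q}
    {H : ∀ (X Y : A.Ob) (p q : ℤ), A.Hom X Y p →ₗ[ZMod 2] A.Hom X Y q}
    (hH : ∀ X Y p z, A.diag.d X Y (p + 1) p (H X Y p (p + 1) z)
      + H X Y (p - 1) p (A.diag.d X Y p (p - 1) z)
      = A.μ (cons A.N (e X) (cons p z (nil Y))) p + z)
    (hm : m = n + 1 - 2 * A.N) {σ : HochDual A M n} {α : PreMor A.diag M.dual m} {k : ℕ}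
    (hσ : ∀ {X Y : A.Ob} (s : Str A.Hom X Y) (p : ℤ) (z : M.V Y X p), 2 * s.length < k →
      σ.app s p z = 0)
    (hα : ∀ {X X' Y' Y : A.Ob} (s : Str A.Hom X X') (p : ℤ) (w : A.Hom X' Y' p)
      (t : Str A.Hom Y' Y) (r : ℤ) (z : M.V Y X r), 2 * s.length + 1 + t.length < k →
      PreMor.ev α s p w t r z = 0) {X X' Y' Y : A.Ob} (s : Str A.Hom X X') (p : ℤ)
    (w : A.Hom X' Y' p) (t : Str A.Hom Y' Y) (r : ℤ) (z : M.V Y X r)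
    (hk : 2 * s.length + 1 + t.length ≤ k)
    (hd₁ : twoApp M.μ σ s A.N (e X') (cons p w t) r z
      + PreMor.ev (PreMor.diff α) s A.N (e X') (cons p w t) r z = 0)
    (hd₂ : twoApp M.μ σ s (p + 1) (H X' Y' p (p + 1) w) t r z
      + PreMor.ev (PreMor.diff α) s (p + 1) (H X' Y' p (p + 1) w) t r z = 0) :
    twoApp M.μ (primitive e K hm σ α) s p w t r z
      + PreMor.ev (PreMor.diff (PreMor.insertUnit e α + PreMor.precomp H α)) s p w t r z
      = PreMor.ev α s p w t r z := by
  -- An input `(s, w, t)` has weight at least `2 |s| + 1`, so in leading weight for pre-morphisms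
  -- `σ` vanishes on strings as long as `s`: the component `T^∨(σ)` does not interfere.
  have hz : ∀ {X' Y' Y : A.Ob} (s : Str A.Hom X X') (p : ℤ) (w : A.Hom X' Y' p)
      (t : Str A.Hom Y' Y) (r : ℤ) (z : M.V Y X r), 2 * s.length < k →
      twoApp M.μ σ s p w t r z = 0 := fun s p w t r z h => by
    refine (sumSplit₃_congr s fun _ _ a b c hs => hσ b _ _ ?_).trans (sumSplit₃_zero s)
    subst hs
    simp only [length_append] at h
    omega
  rw [hz _ _ _ _ _ _ (by omega), zero_add] at hd₁ hd₂
  rw [PreMor.diff_add, PreMor.ev_add, PreMor.ev_diff_precomp s p t r hα w z hk hd₂,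
    PreMor.ev_diff_insertUnit s p t r he hα w z rfl hk hd₁, hH, PreMor.ev_mid,
    twoApp_leading (primitive e K hm σ α) s p w t r _ z rfl]
  · have h₁ : (primitive e K hm σ α).app s ((cons p w t).rdeg A.N + r - 1)
        (M.μ.app (cons p w t) r z (nil X) ((cons p w t).rdeg A.N + r - 1))
        = PreMor.ev α s A.N (e X') (nil X') ((cons p w t).rdeg A.N + r - 1)
        (M.μ.app (cons p w t) r z (nil X) ((cons p w t).rdeg A.N + r - 1)) := by
      change _ + σ.app _ _ _ = _
      rw [hσ s _ _ (by omega), add_zero]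
    rw [h₁]
    generalize PreMor.ev α s A.N (e X') (nil X') _ _ = a
    generalize PreMor.ev α s p _ t r z = b
    generalize PreMor.ev α s p _ t r z = c
    revert a b c
    decide
  · intro U U' s' p z hl
    change PreMor.ev α s' A.N (e _) (nil _) p z + σ.app s' (p + 1) _ = 0
    rw [hα _ _ _ _ _ _ (by rw [length_nil]; omega), hσ _ _ _ (by omega), add_zero]

/-- The cone of `Γ ∘ T^∨` is acyclic. -/
theorem cone_acyclic (hA : A.IsHUnital) (hM : M.IsHUnital) (hm : m = n + 1 - 2 * A.N)
    (f : HochDual A M n × PreMor A.diag M.dual m)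
    (hf : coneDiff (n' := n + -1) rfl hm (m' := n - 2 * A.N) rfl f = 0) :
    ∃ u : HochDual A M (n + 1) × PreMor A.diag M.dual (m + 1),
      coneDiff (by ring) (by omega) (by omega) u = f := by
  choose e he using hA
  have he' : ∀ X, A.diag.d X X A.N (A.N - 1) (e X) = 0 := fun X => (he X).1
  -- `K` and `H` contract `e · - id` on the left of `M` and of the diagonal bimodule. Only left
  -- units are needed here.
  choose K hK using fun X => M.exists_unit_homotopy (he' X) (hM.1 X (e X) (he X))
  choose H hH using fun X => A.diag.exists_unit_homotopy (he' X) (he X).2.1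
  -- Inserting the unit makes the right-hand string one entry longer. Entries of `s` therefore count
  -- twice, so that losing one of them still lowers the weight; the extra `1` places the output of
  -- `T^∨` in strictly higher weight than its argument.
  let F₁ : ∀ n m : ℤ, ℕ → AddSubgroup (HochDual A M n × PreMor A.diag M.dual m) := fun n m k =>
    (filtration A M n (fun l => 2 * l) k).prod
      (Multi.filtration A A A.Hom M.dual.V m (fun l l' => 2 * l + 1 + l') k)
  have hα : ∀ {n m : ℤ} {k : ℕ} {f : HochDual A M n × PreMor A.diag M.dual m}, f ∈ F₁ n m k →
      ∀ {X X' Y' Y : A.Ob} (s : Str A.Hom X X') (p : ℤ) (w : A.Hom X' Y' p)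
      (t : Str A.Hom Y' Y) (r : ℤ) (z : M.V Y X r), 2 * s.length + 1 + t.length < k →
      PreMor.ev f.2 s p w t r z = 0 := fun hf _ _ _ _ s p w t r z h =>
    PreMor.ev_of_app_eq_zero _ _ _ _ (fun q => hf.2 s p w t q h) z
  have hmem : ∀ {n m : ℤ} {k : ℕ} {f : HochDual A M n × PreMor A.diag M.dual m},
      (∀ {X Y : A.Ob} (s : Str A.Hom X Y) (p : ℤ) (z : M.V Y X p), 2 * s.length < k →
        f.1.app s p z = 0) →
      (∀ {X X' Y' Y : A.Ob} (s : Str A.Hom X X') (p : ℤ) (w : A.Hom X' Y' p)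
        (t : Str A.Hom Y' Y) (r : ℤ) (z : M.V Y X r), 2 * s.length + 1 + t.length < k →
        PreMor.ev f.2 s p w t r z = 0) → f ∈ F₁ n m k := fun h₁ h₂ =>
    ⟨fun s p z h => h₁ s p z h, fun s p w t q h => PreMor.eq_of_ev (β := 0) s p t
      fun r z => h₂ s p w t r z h⟩
  refine exists_preimage_of_filtration (coneDiff (by ring) (by omega) (by omega))
    (coneDiff (n' := n + -1) rfl hm (m' := n - 2 * A.N) rfl)
    (fun x => coneDiff_coneDiff _ _ _ _ _ _ x) (F₁ (n + 1) (m + 1)) (F₁ n m)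
    (fun f => (primitive e (fun X => K X) hm f.1 f.2,
      PreMor.insertUnit e f.2 + PreMor.precomp (fun X => H X) f.2)) ?_ ?_ ?_ ?_ ?_ ?_ ?_ f hf
  · exact fun x => ⟨fun _ _ _ h => absurd h (Nat.not_lt_zero _),
      fun _ _ _ _ _ h => absurd h (Nat.not_lt_zero _)⟩
  · exact fun k f hf => ⟨fun s p z hn => hf.1 s p z (Nat.lt_succ_of_lt hn),
      fun s p v t q hn => hf.2 s p v t q (Nat.lt_succ_of_lt hn)⟩
  · exact fun f hf => Prod.ext (HochDual.ext fun s p z => (hf _).1 s p z (Nat.lt_succ_self _))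
      (Multi.ext fun s p v t q => (hf _).2 s p v t q (Nat.lt_succ_self _))
  · intro k f hf
    refine hmem (fun s p z h => ?_) (fun s p w t r z h => ?_)
    · rw [coneDiff_fst, diff_apply]
      refine (congrArg₂ _ (A.bar_eq_zero_of_length s (f.1.left p z) fun r hr =>
        hf.1 r p z (by dsimp only; omega)) ((sumSplit₃_congr s fun _ _ a b c hs =>
          hf.1 b _ _ ?_).trans (sumSplit₃_zero s))).trans (add_zero _)
      subst hs
      simp only [length_append] at h
      dsimp only
      omega
    · rw [coneDiff_snd, PreMor.ev_diff]
      have h₁ : twoApp M.μ f.1 s p w t r z = 0 := by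
        refine (sumSplit₃_congr s fun _ _ a b c hs => hf.1 b _ _ ?_).trans (sumSplit₃_zero s)
        subst hs
        simp only [length_append] at h
        dsimp only
        omega
      rw [h₁, A.bar_eq_zero_of_length s (PreMor.ev_left p t r f.2 w z) fun s' hs' =>
          hα hf _ _ _ _ _ _ (by omega),
        A.bar_eq_zero_of_length t (PreMor.ev_right s p r f.2 w z) fun s' hs' =>
          hα hf _ _ _ _ _ _ (by omega), add_zero, add_zero, zero_add]
      refine (congrArg₂ _ ((sumSplit_congr s fun _ s₁ s₂ hs => (sumSplit_congr t fun _ t₁ t₂ ht =>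
        hα hf _ _ _ _ _ _ ?_).trans (sumSplit_zero t)).trans (sumSplit_zero s))
        ((sumSplit_congr s fun _ s₁ s₂ hs => (sumSplit_congr t fun _ t₁ t₂ ht =>
        hα hf _ _ _ _ _ _ ?_).trans (sumSplit_zero t)).trans (sumSplit_zero s))).trans (add_zero _)
      all_goals
        subst hs
        subst ht
        simp only [length_append] at h
        dsimp only
        omega
  · intro k f hf
    refine hmem (fun s p z h => ?_) (fun s p w t r z h => ?_)
    · change PreMor.ev f.2 s A.N (e _) (nil _) p z + f.1.app s (p + 1) _ = 0
      rw [hα hf _ _ _ _ _ _ (by rw [length_nil]; omega), hf.1 _ _ _ (by dsimp only; omega), add_zero]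
    · change PreMor.ev f.2 s A.N (e _) (cons p w t) r z + PreMor.ev f.2 s (p + 1) _ t r z = 0
      rw [hα hf _ _ _ _ _ _ (by rw [length_cons]; omega), hα hf _ _ _ _ _ _ (by omega), add_zero]
  · intro k f hf hcl
    have h₁ : ∀ {X Y : A.Ob} (s : Str A.Hom X Y) (p : ℤ) (z : M.V Y X p), f.1.diff.app s p z = 0 :=
      fun s p z => congrArg (fun f => f.1.app s p z) hcl
    have h₂ : ∀ {X X' Y' Y : A.Ob} (s : Str A.Hom X X') (p : ℤ) (w : A.Hom X' Y' p)
        (t : Str A.Hom Y' Y) (r : ℤ) (z : M.V Y X r),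
        twoApp M.μ f.1 s p w t r z + PreMor.ev (PreMor.diff f.2) s p w t r z = 0 :=
      fun s p w t r z => (coneDiff_snd _ _ _ f s p w t r z).symm.trans
        (congrArg (fun f => PreMor.ev f.2 s p w t r z) hcl)
    refine hmem (fun s p z h => ?_) (fun s p w t r z h => ?_)
    · refine (map_sub (evalHom s p z) _ _).trans (sub_eq_zero.2 ?_)
      exact (diff_primitive he' (fun X => hK X) hm (fun s p z h => hf.1 s p z h) (hα hf) s p z
        (by omega) (h₁ _ _ _) (h₂ _ _ _ _ _ _)).symm
    · have h₃ := twoApp_primitive (K := fun X => K X) he' (fun X => hH X) hm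
        (fun s p z h => hf.1 s p z h) (hα hf) s p w t r z (by omega) (h₂ _ _ _ _ _ _)
        (h₂ _ _ _ _ _ _)
      rw [← coneDiff_snd (n' := n) (m' := m) (by ring) (by omega) (by omega)
        (primitive e (fun X => K X) hm f.1 f.2,
          PreMor.insertUnit e f.2 + PreMor.precomp (fun X => H X) f.2)] at h₃
      exact (PreMor.ev_sub s p t r _ _ w z).trans (sub_eq_zero.2 h₃.symm)
  · intro p hp
    obtain ⟨a, ha⟩ := exists_sum _ (fun k => (p k).1) fun k => (hp k).1
    obtain ⟨b, hb⟩ := Multi.exists_sum (fun l l' => 2 * l + 1 + l') (fun k => (p k).2) fun k => (hp k).2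
    refine ⟨(a, b), fun n => ⟨?_, ?_⟩⟩
    · rw [Prod.fst_sub, Prod.fst_sum]; exact ha n
    · rw [Prod.snd_sub, Prod.snd_sum]; exact hb n

/-- Every bimodule morphism `A_Δ → M^∨` is homologous to `Γ T^∨(σ)` for some closed `σ`. -/
theorem exists_homologous_toPreMor (hA : A.IsHUnital) (hM : M.IsHUnital)
    (φ : PreMor A.diag M.dual (-A.N)) (hφ : PreMor.IsClosed φ) :
    ∃ σ : HochDual A M A.N, σ.IsClosed ∧ PreMor.Homologous σ.toPreMor φ := by
  -- Since `φ` is closed, `(0, φ)` is a cycle in the cone. The components of a primitive are a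
  -- closed `σ` and a homotopy `η` from `ΓT^∨(σ)` to `φ`.
  obtain ⟨⟨σ, η⟩, hu⟩ := cone_acyclic hA hM (n := A.N - 1) (m := -A.N) (by ring) (0, φ) (by
    refine Prod.ext (HochDual.ext fun s p z => ?_)
      (Multi.ext fun s p w t q => PreMor.eq_of_ev s p t fun r z => ?_)
    · rw [coneDiff_fst, diff_apply]
      exact (congrArg₂ _ (sumSplit₃_zero s) (mapApp_of_eq_zero s p _ _ z fun _ _ _ => rfl)).trans
        (add_zero _)
    · rw [coneDiff_snd]
      dsimp only
      rw [PreMor.isClosed_iff.1 hφ]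
      exact (congrArg₂ _ (sumSplit₃_zero s) rfl).trans (add_zero _))
  have h₁ : ∀ {X Y : A.Ob} (s : Str A.Hom X Y) (p : ℤ) (z : M.V Y X p), σ.diff.app s p z = 0 :=
    fun s p z => congrArg (fun f => f.1.app s p z) hu
  have hN : A.N - 1 + 1 = A.N := by ring
  refine ⟨σ.cast hN, fun s p z => h₁ s p z, η, fun s p w t q => ?_⟩
  have h₂ : σ.Tdual.Γ.app s p w t q + PreMor.diffApp η s p w t q = φ.app s p w t q :=
    congrArg (fun f => f.2.app s p w t q) hu
  rw [← h₂, ZModModule.sub_eq_add]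
  change σ.Tdual.Γ.app s p w t q + (σ.Tdual.Γ.app s p w t q + _) = _
  rw [← add_assoc, ZModModule.add_self, zero_add]

end HochDual

/-! ## Pairings on homology -/

namespace Bimodule

variable {A : AInfCat.{u, v}} {B : AInfCat.{u', v'}}

/-- `β` induces an isomorphism from `H_p(K(X,Y))` to the dual of `H_r(L(Y,X))`. -/
def IsPerfectPairing (K : Bimodule.{u, u', v, v', w} A B) (L : Bimodule.{u', u, v', v, w'} B A)
    (X : A.Ob) (Y : B.Ob) (p r : ℤ) (β : K.V X Y p → L.V Y X r → ZMod 2) : Prop :=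
  (∀ x ∈ K.cycles X Y p, (∀ z ∈ L.cycles Y X r, β x z = 0) → x ∈ K.boundaries X Y p) ∧
  (∀ l : Module.Dual (ZMod 2) (L.V Y X r), (∀ z ∈ L.boundaries Y X r, l z = 0) →
    ∃ x ∈ K.cycles X Y p, ∀ z ∈ L.cycles Y X r, β x z = l z)

theorem isPerfectPairing_congr {K : Bimodule.{u, u', v, v', w} A B}
    {L : Bimodule.{u', u, v', v, w'} B A} {X : A.Ob} {Y : B.Ob} {p r : ℤ}
    {β β' : K.V X Y p → L.V Y X r → ZMod 2}
    (h : ∀ x ∈ K.cycles X Y p, ∀ z ∈ L.cycles Y X r, β x z = β' x z) :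
    IsPerfectPairing K L X Y p r β ↔ IsPerfectPairing K L X Y p r β' := by
  refine and_congr (forall₂_congr fun x hx => ?_) (forall₂_congr fun l hl => ?_)
  · exact imp_congr_left (forall₂_congr fun z hz => by rw [h x hx z hz])
  · exact exists_congr fun x => and_congr_right fun hx => forall₂_congr fun z hz => by
      rw [h x hx z hz]

theorem boundaries_le_cycles (M : Bimodule.{u, u', v, v', w} A B) (X : A.Ob) (Y : B.Ob) (p : ℤ) :
    M.boundaries X Y p ≤ M.cycles X Y p := by
  rintro _ ⟨x, rfl⟩
  exact M.d_d' X Y p (p - 1) x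

/-- Together with `mem_dual_boundaries_iff` this identifies the homology of the dual bimodule with
the dual of the homology. -/
theorem mem_dual_cycles_iff (M : Bimodule.{u, u', v, v', w} A B) {X : A.Ob} {Y : B.Ob} {q : ℤ}
    {ψ : M.dual.V Y X q} : ψ ∈ M.dual.cycles Y X q
      ↔ ∀ z ∈ M.boundaries X Y (-q), (ψ : Module.Dual (ZMod 2) (M.V X Y (-q))) z = 0 := by
  constructor
  · intro h z hz
    obtain ⟨y, rfl⟩ := (M.mem_boundaries_iff (p' := -(q - 1)) (by ring)).1 hz
    exact LinearMap.congr_fun h y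
  · intro h
    exact LinearMap.ext fun y => h _ ((M.mem_boundaries_iff (p' := -(q - 1)) (by ring)).2 ⟨y, rfl⟩)

/-- Over a field the range of the transpose of `d` is the annihilator of the kernel of `d`. -/
theorem mem_dual_boundaries_iff (M : Bimodule.{u, u', v, v', w} A B) {X : A.Ob} {Y : B.Ob} {q : ℤ}
    {ψ : M.dual.V Y X q} : ψ ∈ M.dual.boundaries Y X q
      ↔ ∀ z ∈ M.cycles X Y (-q), (ψ : Module.Dual (ZMod 2) (M.V X Y (-q))) z = 0 := by
  have h₁ : ψ ∈ M.dual.boundaries Y X q ↔ ψ ∈ LinearMap.range (M.d X Y (-q) (-(q + 1))).dualMap :=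
    Iff.rfl
  rw [h₁, LinearMap.range_dualMap_eq_dualAnnihilator_ker, Submodule.mem_dualAnnihilator]
  exact forall_congr' fun z => imp_congr_left (M.mem_cycles_iff (by ring)).symm

end Bimodule

namespace PreMor

section

variable {A : AInfCat.{u, v}} {B : AInfCat.{u', v'}} {K : Bimodule.{u, u', v, v', w} A B}
  {L : Bimodule.{u, u', v, v', w'} A B} {g : ℤ}

theorem IsClosed.lin_mem_cycles {ν : PreMor K L g} (hν : IsClosed ν) {X : A.Ob} {Y : B.Ob}
    {p q : ℤ} (hq : q = p + g) {x : K.V X Y p} (hx : x ∈ K.cycles X Y p) :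
    lin ν X Y p q x ∈ L.cycles X Y q := by
  rw [L.mem_cycles_iff rfl, ← hν.lin_d x (p' := p - 1) (by ring) (by rw [hq]; ring),
    (K.mem_cycles_iff rfl).1 hx, map_zero]

theorem IsClosed.lin_mem_boundaries {ν : PreMor K L g} (hν : IsClosed ν) {X : A.Ob} {Y : B.Ob}
    {p q : ℤ} (hq : q = p + g) {x : K.V X Y p} (hx : x ∈ K.boundaries X Y p) :
    lin ν X Y p q x ∈ L.boundaries X Y q := by
  obtain ⟨y, rfl⟩ := hx
  rw [L.mem_boundaries_iff rfl, hν.lin_d y (r := q + 1) rfl hq]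
  exact ⟨_, rfl⟩

theorem Homologous.lin_sub_mem_boundaries {ν ν' : PreMor K L g} (h : Homologous ν ν') {X : A.Ob}
    {Y : B.Ob} {p q : ℤ} (hq : q = p + g) {x : K.V X Y p} (hx : x ∈ K.cycles X Y p) :
    lin ν X Y p q x - lin ν' X Y p q x ∈ L.boundaries X Y q := by
  obtain ⟨η, hη⟩ := h
  have h := hη (nil X) p x (nil Y) q
  rw [diffApp_nil η x (r := q + 1) (p' := p - 1) rfl (by rw [hq]; ring),
    (K.mem_cycles_iff rfl).1 hx, map_zero, add_zero] at h
  exact (L.mem_boundaries_iff rfl).2 ⟨_, h.symm⟩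

/-- On empty strings the composition of pre-morphisms is the composition of their `0|1|0`
components, so the homotopy inverse induces an inverse on homology. -/
theorem IsQuasiIso.isLinQuasiIso {ν : PreMor K L g} (h : IsQuasiIso ν) : IsLinQuasiIso ν := by
  obtain ⟨hν, ψ, hψ, h₁, h₂⟩ := h
  intro X Y p q hq
  have hp : p = q + -g := by rw [hq]; ring
  refine ⟨fun x hx hb => ?_, fun y hy => ⟨lin ψ X Y q p y, hψ.lin_mem_cycles hp hy, ?_⟩⟩
  · have h := h₁.lin_sub_mem_boundaries (q := p) (by ring) hx
    have e₁ : lin (K := K) (L := K) ((ν.comp ψ).cast (add_neg_cancel g)) X Y p p x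
        = lin ψ X Y q p (lin ν X Y p q x) := ν.compApp_nil ψ p x hp
    have e₂ : lin (K := K) (L := K) (Multi.id A B K.V) X Y p p x = x :=
      Pi.single_eq_same (M := fun q => K.V X Y q) p x
    rw [e₁, e₂] at h
    have h' := Submodule.sub_mem _ (hψ.lin_mem_boundaries hp hb) h
    rwa [sub_sub_cancel] at h'
  · have h := h₂.lin_sub_mem_boundaries (q := q) (by ring) hy
    have e₁ : lin (K := L) (L := L) ((ψ.comp ν).cast (neg_add_cancel g)) X Y q q y
        = lin ν X Y p q (lin ψ X Y q p y) := ψ.compApp_nil ν q y hq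
    have e₂ : lin (K := L) (L := L) (Multi.id A B L.V) X Y q q y = y :=
      Pi.single_eq_same (M := fun q => L.V X Y q) q y
    rwa [e₁, e₂, ZModModule.sub_eq_add] at h

theorem isQuasiIso_iff {ν : PreMor K L g} (hν : IsClosed ν) : IsQuasiIso ν ↔ IsLinQuasiIso ν :=
  ⟨fun h => h.isLinQuasiIso, fun h => h.isQuasiIso hν⟩

end

variable {A : AInfCat.{u, v}} {M : Bimodule.{u, u, v, v, w} A A} {g : ℤ}

/-- Injectivity and surjectivity on homology become the two halves of perfectness once cycles and
boundaries of `M^∨` are described as annihilators. -/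
theorem isLinQuasiIso_iff_isPerfectPairing {φ : PreMor A.diag M.dual g} :
    IsLinQuasiIso φ ↔ ∀ X Y p r, r = -(p + g) →
      A.diag.IsPerfectPairing M X Y p r (fun x z => ev φ (nil X) p x (nil Y) r z) := by
  have key : ∀ X Y p q, ((∀ x ∈ A.diag.cycles X Y p,
        lin φ X Y p q x ∈ M.dual.boundaries X Y q → x ∈ A.diag.boundaries X Y p) ∧
      (∀ y ∈ M.dual.cycles X Y q, ∃ x ∈ A.diag.cycles X Y p,
        lin φ X Y p q x + y ∈ M.dual.boundaries X Y q)) ↔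
      A.diag.IsPerfectPairing M X Y p (-q) (fun x z => ev φ (nil X) p x (nil Y) (-q) z) := by
    intro X Y p q
    simp only [ev_neg, M.mem_dual_boundaries_iff, M.mem_dual_cycles_iff]
    refine and_congr Iff.rfl (forall₂_congr fun y hy => exists_congr fun x =>
      and_congr_right fun hx => forall₂_congr fun z hz => ?_)
    exact ⟨fun h => eq_of_add_eq_zero_of_charTwo h, fun h =>
      (congrArg (· + (y : Module.Dual (ZMod 2) (M.V Y X (-q))) z) h).trans (ZModModule.add_self _)⟩
  constructor
  · rintro h X Y p r rfl
    exact (key X Y p _).1 (h X Y p _ rfl)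
  · rintro h X Y p q rfl
    exact (key X Y p _).2 (h X Y p _ rfl)

/-- The values on a cycle `x` differ by a boundary of the dual bimodule, and such a boundary
annihilates every cycle `z`. Thus the pairing depends only on the class of the morphism. -/
theorem Homologous.ev_eq {φ φ' : PreMor A.diag M.dual g} (h : Homologous φ φ') {X Y : A.Ob}
    {p r : ℤ} (hr : r = -(p + g)) {x : A.Hom X Y p} (hx : x ∈ A.diag.cycles X Y p) {z : M.V Y X r}
    (hz : z ∈ M.cycles Y X r) : ev φ (nil X) p x (nil Y) r z = ev φ' (nil X) p x (nil Y) r z := by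
  subst hr
  rw [ev_neg, ev_neg]
  exact sub_eq_zero.1 (M.mem_dual_boundaries_iff.1 (h.lin_sub_mem_boundaries rfl hx) z hz)

end PreMor

namespace HochDual

variable {A : AInfCat.{u, v}} {M : Bimodule.{u, u, v, v, w} A A} {n : ℤ}

/-- With empty strings the sum defining `T^∨` has one term, so the pairing of `ΓT^∨(σ)` is literally
the one in the definition of non-degeneracy. -/
theorem ev_toPreMor (σ : HochDual A M A.N) {X Y : A.Ob} {p r : ℤ} (hr : r = A.N - p)
    (x : A.Hom X Y p) (z : M.V Y X r) : PreMor.ev σ.toPreMor (nil X) p x (nil Y) r z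
      = σ.app (nil X) 0 (M.μ.app (cons p x (nil Y)) r z (nil X) 0) :=
  (σ.ev_Tdual _ _ _ _ _ _).trans (σ.twoApp_leading _ _ _ _ _ (fun _ _ _ h => absurd h (by simp)) z
    (by rw [hr]; simp; ring))

theorem bijective_homologyPairing_iff {σ : HochDual A M n} (hσ : σ.IsClosed) (X X' : A.Ob) (p : ℤ) :
    Function.Bijective (σ.homologyPairing hσ X X' p) ↔
      A.diag.IsPerfectPairing M X X' p (A.N - p) (fun x z => σ.pair X X' p x z) := by
  refine and_congr ?_ ?_
  · rw [injective_iff_map_eq_zero]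
    constructor
    · intro h x hx h₀
      have := h (Submodule.Quotient.mk ⟨x, hx⟩) (LinearMap.ext fun z => by
        obtain ⟨z, rfl⟩ := Submodule.Quotient.mk_surjective _ z
        exact h₀ z.1 z.2)
      exact (Submodule.Quotient.mk_eq_zero ((A.diag.boundaries X X' p).submoduleOf _)
        (x := ⟨x, hx⟩)).1 this
    · intro h x hx
      obtain ⟨x, rfl⟩ := Submodule.Quotient.mk_surjective _ x
      refine (Submodule.Quotient.mk_eq_zero _).2 (h x.1 x.2 fun z hz => ?_)
      exact LinearMap.congr_fun hx (Submodule.Quotient.mk ⟨z, hz⟩)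
  · constructor
    · intro h l hl
      obtain ⟨x, hx⟩ := h (Submodule.liftQ _ (l ∘ₗ (M.cycles X' X (A.N - p)).subtype)
        fun z hz => hl z.1 hz)
      obtain ⟨x, rfl⟩ := Submodule.Quotient.mk_surjective _ x
      exact ⟨x.1, x.2, fun z hz => LinearMap.congr_fun hx (Submodule.Quotient.mk ⟨z, hz⟩)⟩
    · intro h l
      -- A functional on homology is pulled back to the cycles and then extended to the whole graded
      -- piece, which is possible over a field.
      obtain ⟨l', hl'⟩ := (l ∘ₗ Submodule.mkQ _).exists_extend
      have hl : ∀ z : M.cycles X' X (A.N - p), l' z.1 = l (Submodule.Quotient.mk z) := fun z =>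
        LinearMap.congr_fun hl' z
      obtain ⟨x, hx, h'⟩ := h l' fun z hz => by
        have hz' := M.boundaries_le_cycles _ _ _ hz
        exact (hl ⟨z, hz'⟩).trans ((congrArg l ((Submodule.Quotient.mk_eq_zero
          ((M.boundaries X' X (A.N - p)).submoduleOf _)).2 hz)).trans (map_zero l))
      refine ⟨Submodule.Quotient.mk ⟨x, hx⟩, LinearMap.ext fun z => ?_⟩
      obtain ⟨z, rfl⟩ := Submodule.Quotient.mk_surjective _ z
      exact (h' z.1 z.2).trans (hl z)

theorem isHomNondegenerate_iff {σ : HochDual A M A.N} (hσ : σ.IsClosed) :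
    σ.IsHomNondegenerate ↔ ∀ X Y p r, r = A.N - p → A.diag.IsPerfectPairing M X Y p r
      (fun x z => σ.app (nil X) 0 (M.μ.app (cons p x (nil Y)) r z (nil X) 0)) := by
  constructor
  · rintro ⟨hσ, h⟩ X Y p r rfl
    exact (bijective_homologyPairing_iff hσ X Y p).1 (h X Y p)
  · exact fun h => ⟨hσ, fun X Y p => (bijective_homologyPairing_iff hσ X Y p).2 (h X Y p _ rfl)⟩

/-- Only agreement of the pairings on cycles is required, not a homotopy between `φ` and `ΓT^∨(σ)`.
This allows the same statement to serve for `φ` with `σ` and for `Ψ(φ)` with `(I^rel_*)^∨σ`. -/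
theorem isQuasiIso_iff_isHomNondegenerate {σ : HochDual A M A.N} (hσ : σ.IsClosed) {g : ℤ}
    (hg : g = -A.N) {φ : PreMor A.diag M.dual g} (hφ : PreMor.IsClosed φ)
    (h : ∀ X Y p r, r = A.N - p → ∀ x ∈ A.diag.cycles X Y p, ∀ z ∈ M.cycles Y X r,
      PreMor.ev φ (nil X) p x (nil Y) r z
        = σ.app (nil X) 0 (M.μ.app (cons p x (nil Y)) r z (nil X) 0)) :
    PreMor.IsQuasiIso φ ↔ σ.IsHomNondegenerate := by
  subst hg
  rw [PreMor.isQuasiIso_iff hφ, PreMor.isLinQuasiIso_iff_isPerfectPairing,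
    isHomNondegenerate_iff hσ]
  refine forall₄_congr fun X Y p r => ?_
  rw [show -(p + -A.N) = A.N - p by ring]
  exact forall_congr' fun hr => Bimodule.isPerfectPairing_congr fun x hx z hz => h X Y p r hr x hx z hz

end HochDual

/-! ## Constructions on bimodule morphisms -/

namespace PreMor

section

variable {A : AInfCat.{u, v}} {B : AInfCat.{u', v'}} {K : Bimodule.{u, u', v, v', w} A B}
  {L : Bimodule.{u, u', v, v', w'} A B} {g : ℤ} {ν : PreMor K L g}

theorem IsClosed.shift (hν : IsClosed ν) (j k : ℤ) :
    IsClosed (K := K.shift j k) (L := L.shift j k) (Multi.shift ν j k) := by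
  intro X X' Y' Y s p v t q
  have h := hν (unshift j s) (p + k) v (unshift j t) (q + k)
  unfold diffApp at h ⊢
  rw [← h]
  exact congrArg₂ _ (congrArg₂ _ (Multi.shift_compApp ν L.μ j k s p v t q)
    (Multi.shift_compApp K.μ ν j k s p v t q)) (Multi.shift_barApp ν j k s p v t q)

theorem IsClosed.dual (hν : IsClosed ν) :
    IsClosed (K := L.dual) (L := K.dual) (Multi.dual ν) := by
  intro Y Y' X X' t p ψ s q
  refine LinearMap.ext fun v => ?_
  have h := hν s (-q) v t (-p)
  unfold diffApp at h ⊢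
  have h' := congrArg (ψ : Module.Dual (ZMod 2) (L.V X Y' (-p))) h
  rw [map_add, map_add, map_zero] at h'
  change (ν.dual.compApp K.μ.dual t p ψ s q : Module.Dual _ _) v
    + (L.μ.dual.compApp ν.dual t p ψ s q : Module.Dual _ _) v
    + (ν.dual.barApp t p ψ s q : Module.Dual _ _) v = 0
  rw [Multi.dual_compApp, Multi.dual_compApp, Multi.dual_barApp, ← h']
  abel

theorem IsClosed.relabel (hν : IsClosed ν) (L' : Bimodule.{u, u', v, v', w'} A B)
    (e : ∀ X Y q, L.V X Y q ≃+ L'.V X Y q)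
    (he : ∀ {X X' : A.Ob} {Y' Y : B.Ob} (s : Str A.Hom X X') (p : ℤ) (v : L.V X' Y' p)
      (t : Str B.Hom Y' Y) (q : ℤ),
      e X Y q (L.μ.app s p v t q) = L'.μ.app s p (e X' Y' p v) t q) :
    IsClosed (K := K) (L := L') (Multi.relabel ν (W' := L'.V) e) := by
  intro X X' Y' Y s p v t q
  have h := congrArg (e X Y q).toAddMonoidHom (hν s p v t q)
  unfold diffApp Multi.compApp Multi.barApp at h ⊢
  simp only [map_add, map_zero, map_sumSplit, AInfCat.map_bar] at h
  rw [← h]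
  refine congrArg₂ _ (congrArg₂ _ ?_ rfl) rfl
  exact sumSplit_congr s fun _ s₁ s₂ _ => sumSplit_congr t fun _ t₁ t₂ _ => (he _ _ _ _ _).symm

/-- A bimodule morphism is compatible with the actions on homology. -/
theorem IsClosed.app_mu_add (hν : IsClosed ν) {X X' : A.Ob} {Y : B.Ob} {p r r' e q : ℤ}
    {x : A.Hom X X' p} (hx : x ∈ A.diag.cycles X X' p) {z : K.V X' Y r} (hz : z ∈ K.cycles X' Y r)
    (he : e = p + (1 - A.N) + r - 1) (hr : r' = r + g) (hq : q = e + g) :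
    ν.app (nil X) e (K.μ.app (cons p x (nil X')) r z (nil Y) e) (nil Y) q
      + L.μ.app (cons p x (nil X')) r' (ν.app (nil X') r z (nil Y) r') (nil Y) q
      ∈ L.boundaries X Y q := by
  have h := hν (cons p x (nil X')) r z (nil Y) q
  unfold diffApp Multi.barApp at h
  rw [A.bar_single p x (ν.left r z (nil Y) q), B.bar_nil (ν.right _ r z q), add_zero] at h
  have hx' : A.μ (cons p x (nil X')) (p - 1) = 0 := hx
  have h₀ := (ν.left r z (nil Y) q).map_cons_zero (nil X) (p - 1) (nil X')
  rw [nil_append] at h₀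
  rw [hx', h₀, add_zero] at h
  have e₁ : (cons p x (nil X')).rdeg A.N + r + (nil Y : Str B.Hom Y Y).rdeg B.N + g = q + 1 := by
    rw [hq, he]; simp; ring
  have e₂ : (nil X' : Str A.Hom X' X').rdeg A.N + r + (nil Y : Str B.Hom Y Y).rdeg B.N + g
      = r' := by rw [hr]; simp
  have e₃ : (cons p x (nil X')).rdeg A.N + r + (nil Y : Str B.Hom Y Y).rdeg B.N + -1 = e := by
    rw [he]; simp; ring
  have e₄ : (nil X' : Str A.Hom X' X').rdeg A.N + r + (nil Y : Str B.Hom Y Y).rdeg B.N + -1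
      = r - 1 := by simp; ring
  have hz' : K.μ.app (nil X') r z (nil Y) (r - 1) = 0 := hz
  simp only [Multi.compApp, sumSplit_cons, sumSplit_nil, e₁, e₂, e₃, e₄] at h
  have h₅ : ν.appAt (cons p x (nil X')) (r - 1) (K.μ.app (nil X') r z (nil Y)) (nil Y) q = 0 :=
    (congrArg (ν.appHom (cons p x (nil X')) (r - 1) (nil Y) q) hz').trans (map_zero _)
  have h₆ : ∀ a b c d : L.V X Y q, d = 0 → a + b + (c + d) = a + (c + b) := by
    rintro a b c d rfl; abel
  -- The component `ν_{1|1|0}(x, z)` is the homotopy: its differential is all that remains of the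
  -- closedness equation when `x` and `z` are cycles.
  refine (L.mem_boundaries_iff rfl).2
    ⟨ν.app (cons p x (nil X')) r z (nil Y) (q + 1), eq_of_add_eq_zero_of_charTwo ?_⟩
  exact (h₆ _ _ _ _ h₅).symm.trans h

end

theorem IsClosed.pullback {A : AInfCat.{u, v}} {B : AInfCat.{u', v'}} (F : AInfFunctor A B)
    {K : Bimodule.{u', u', v', v', w} B B} {L : Bimodule.{u', u', v', v', w'} B B} {g : ℤ}
    {ν : PreMor K L g} (hν : IsClosed ν) :
    IsClosed (K := K.pullback F) (L := L.pullback F) (Multi.pullback F ν) := by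
  intro X X' Y' Y s p v t q
  unfold diffApp
  refine (congrArg₂ _ (congrArg₂ _ (Multi.pullback_compApp F ν L.μ s p v t q)
    (Multi.pullback_compApp F K.μ ν s p v t q)) (Multi.pullback_barApp F ν s p v t q)).trans ?_
  simp only [← F.blocks_add]
  refine (F.blocks_congr s fun s' _ => (F.blocks_congr t fun t' _ => hν s' p v t' q).trans
    (F.blocks_zero t)).trans (F.blocks_zero s)

/-- The functor equation on the string `s ⊗ v ⊗ t`, sorted by the position of `v`. The image block
containing `v` is an output of `i`, which gives the target structure map; on the source side the
blocks that contain `v` and those that avoid it give the two remaining terms. -/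
theorem isClosed_diagMor {A : AInfCat.{u, v}} {B : AInfCat.{u', v'}} {j : ℤ} (hN : A.N = B.N + j)
    (I : AInfFunctor B (A.susp j)) : IsClosed (diagMor hN I) := by
  intro X X' Y' Y s p v t q
  have h := I.rel (s.append (cons p v t)) q
  rw [sumBlocks_append_cons, B.bar_append_cons] at h
  have h₁ : (diagMor hN I).compApp ((A.diag.shift j j).pullback I).μ s p v t q
      = s.sumSplit fun _ a b => t.sumSplit fun _ c d => I.blocks a fun a' => I.blocks d fun d' =>
        (A.susp j).μ (a'.append (consAt ((b.append (cons p v c)).rdeg B.N - 1 + (A.susp j).N)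
          (I.map _ _ (b.append (cons p v c))) d')) q := by
    refine sumSplit_congr s fun _ a b _ => sumSplit_congr t fun _ c d _ =>
      I.blocks_congr a fun a' _ => I.blocks_congr d fun d' _ => ?_
    have e : (b.append (cons p v c)).rdeg B.N - 1 + (A.susp j).N
        = b.rdeg B.N + p + c.rdeg B.N + 0 := by
      change _ - 1 + (A.N - j) = _
      rw [hN]; simp; ring
    rw [e]
    have e' := unshift_append (V := A.Hom) j a'
      (consAt (V := (A.susp j).Hom) (b.rdeg B.N + p + c.rdeg B.N + 0)
        (I.map _ _ (b.append (cons p v c))) d')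
    change A.μ ((unshift j a').append (unshift j (consAt (V := (A.susp j).Hom)
      (b.rdeg B.N + p + c.rdeg B.N + 0) (I.map _ _ (b.append (cons p v c))) d'))) (q + j)
      = A.μ (unshift j (a'.append _)) (q + j)
    exact congrArg (fun r => A.μ r (q + j)) e'.symm
  have h₂ : B.diag.μ.compApp (diagMor hN I) s p v t q
      = s.sumSplit fun _ s₁ s₂ => t.sumSplit fun _ t₁ t₂ => I.map _ _ (s₁.append
          (consAt ((s₂.append (cons p v t₁)).rdeg B.N - 2 + B.N)
            (B.μ (s₂.append (cons p v t₁))) t₂)) q := by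
    refine sumSplit_congr s fun _ a b _ => sumSplit_congr t fun _ c d _ => ?_
    have e : (b.append (cons p v c)).rdeg B.N - 2 + B.N
        = b.rdeg B.N + p + c.rdeg B.N + -1 := by
      simp; ring
    rw [e]
    rfl
  unfold diffApp
  rw [h₁, h₂]
  refine (congrArg (· + _ + _) h).trans ?_
  rw [add_assoc]
  exact ZModModule.add_self _

end PreMor

theorem dualCongr_apply {V : ℤ → Type w} [∀ p, AddCommGroup (V p)] [∀ p, Module (ZMod 2) (V p)]
    {a b : ℤ} (h : a = b) (ψ : Module.Dual (ZMod 2) (V a)) (z : V b) :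
    dualCongr h ψ z = ψ (degCast h.symm z) := by
  subst h; rfl

/-! ## Constructions on dual Hochschild chains -/

namespace HochDual

variable {A : AInfCat.{u, v}} {n : ℤ}

theorem IsClosed.shiftDual {M : Bimodule.{u, u, v, v, w} A A} {σ : HochDual A M n}
    (hσ : σ.IsClosed) (j k : ℤ) : (σ.shiftDual j k).IsClosed := by
  intro X Y s p z
  refine Eq.trans (congrArg₂ _ (A.bar_unshift j s fun r => σ.app r (p + k) z) ?_)
    (hσ (unshift j s) (p + k) z)
  refine Eq.trans ?_ (sumSplit₃_unshift j s _).symm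
  refine sumSplit₃_congr s fun _ _ a b c _ => ?_
  refine σ.appAt_congr (unshift j b) (d := c.rdeg (A.N - j) + p + a.rdeg (A.N - j) - 1 + k) ?_
    (M.μ.app (unshift j c) (p + k) z (unshift j a))
  rw [rdeg_unshift, rdeg_unshift]
  ring

/-- The closedness equation is summed over all block decompositions of `s`. The bar part is handled
by `AInfFunctor.blocks_bar`; in the cyclic part, cutting a string of images amounts to cutting `s`
and decomposing each piece separately. -/
theorem IsClosed.pullbackDual {B : AInfCat.{u', v'}} (F : AInfFunctor A B)
    {M : Bimodule.{u', u', v', v', w} B B} {σ : HochDual B M n} (hσ : σ.IsClosed) :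
    (σ.pullbackDual F).IsClosed := by
  intro X Y s p z
  have h : F.blocks s (fun r => B.bar r (fun r => σ.app r p z)
      + r.sumSplit₃ (fun _ _ s₁ s₂ s₃ =>
          σ.appAt s₂ (s₃.rdeg B.N + p + s₁.rdeg B.N - 1) (M.μ.app s₃ p z s₁))) = 0 :=
    (F.blocks_congr s fun r _ => hσ r p z).trans (F.blocks_zero s)
  rw [F.blocks_add, F.blocks_bar s (σ.left p z)] at h
  refine Eq.trans (congrArg₂ _ rfl ?_) h
  unfold sumSplit₃ AInfFunctor.blocks
  rw [sumBlocks_split]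
  refine sumSplit_congr s fun _ s₁ r _ => ?_
  simp only [sumBlocks_split]
  rw [sumBlocks_sumSplit]
  refine sumSplit_congr r fun _ s₂ s₃ _ => ?_
  change (F.blocks s₂ fun s₂' => σ.appHom s₂' (s₃.rdeg A.N + p + s₁.rdeg A.N - 1)
    (F.blocks s₃ fun s₃' => F.blocks s₁ fun s₁' => M.μ.app s₃' p z s₁' _))
    = F.blocks s₁ fun s₁' => F.blocks s₂ fun s₂' => F.blocks s₃ fun s₃' =>
      σ.appAt s₂' (s₃'.rdeg B.N + p + s₁'.rdeg B.N - 1) (M.μ.app s₃' p z s₁')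
  rw [F.blocks_comm s₁]
  refine F.blocks_congr s₂ fun s₂' _ => ?_
  refine ((F.map_blocks (σ.appHom s₂' _) s₃ _).trans (F.blocks_congr s₃ fun s₃' _ =>
    F.map_blocks (σ.appHom s₂' _) s₁ _)).trans ?_
  rw [F.blocks_comm s₁]
  refine F.blocks_congr s₃ fun s₃' h₃ => ?_
  refine F.blocks_congr s₁ fun s₁' h₁ => ?_
  rw [h₁, h₃]
  rfl

theorem IsClosed.app_nil_boundary {M : Bimodule.{u, u, v, v, w} A A} {σ : HochDual A M n}
    (hσ : σ.IsClosed) (X : A.Ob) (p : ℤ) (z : M.V X X p) (hz : z ∈ M.boundaries X X p) :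
    σ.app (nil X) p z = 0 := by
  obtain ⟨y, rfl⟩ := hz
  have h := hσ (nil X) (p + 1) y
  rw [A.bar_nil (σ.left (p + 1) y), zero_add] at h
  refine Eq.trans ?_ h
  exact σ.appAt_congr (nil X) (by simp) (M.μ.app (nil X) (p + 1) y (nil X))

end HochDual

/-! ## Relative pairings -/

section Relative

variable {A : AInfCat.{u, v}} {B : AInfCat.{u', v'}} {j : ℤ} {Arel : Bimodule.{u, u, v, v, w} A A}

theorem isClosed_Psi (hN : A.N = B.N + j) (I : AInfFunctor B (A.susp j))
    {irel : PreMor B.diag ((Arel.shift j (-j)).pullback I) j} (hirel : PreMor.IsClosed irel) {g : ℤ}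
    {α : PreMor A.diag Arel.dual g} (hα : PreMor.IsClosed α) :
    PreMor.IsClosed (Psi hN I irel α) := by
  have h₁ : PreMor.IsClosed (K := B.diag) (L := (Arel.dual.shift j j).pullback I)
      ((diagMor hN I).comp ((Multi.shift α j j).pullback I)) := PreMor.IsClosed.comp (PreMor.isClosed_diagMor hN I)
    (PreMor.IsClosed.pullback I (PreMor.IsClosed.shift hα j j))
  -- The identification of `I^*A_rel^∨[j]` with the dual of `I^*A_rel[-j]` only renames degrees; its
  -- compatibility with structure maps is an exchange of the two block sums.
  have h₂ : PreMor.IsClosed (K := B.diag) (L := ((Arel.shift j (-j)).pullback I).dual)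
      (((diagMor hN I).comp ((Multi.shift α j j).pullback I)).relabel
        (W' := ((Arel.shift j (-j)).pullback I).dual.V)
        (fun X Y q => dualCongr (V := fun p => Arel.V (I.obj Y) (I.obj X) p)
          (show -(q + j) = -q + -j by ring))) := PreMor.IsClosed.relabel h₁ ((Arel.shift j (-j)).pullback I).dual
    (fun X Y q => dualCongr (V := fun p => Arel.V (I.obj Y) (I.obj X) p)
      (show -(q + j) = -q + -j by ring)) (by
    intro X X' Y' Y s p v t q
    refine LinearMap.ext fun z => (dualCongr_apply _ _ _).trans ?_
    let ev : Module.Dual (ZMod 2) (Arel.V (I.obj Y) (I.obj X) (-(q + j))) →+ ZMod 2 :=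
      AddMonoidHom.mk' (fun ψ => ψ (degCast (V := fun p => Arel.V (I.obj Y) (I.obj X) p)
        (show -q + -j = -(q + j) by ring) z)) (fun _ _ => rfl)
    let ψ : Module.Dual (ZMod 2) (Arel.V (I.obj Y') (I.obj X') (-p + -j)) :=
      dualCongr (V := fun p => Arel.V (I.obj Y') (I.obj X') p) (show -(p + j) = -p + -j by ring) v
    change ev (I.blocks s fun s' => I.blocks t fun t' =>
        Arel.μ.dual.app (unshift j s') (p + j) v (unshift j t') (q + j))
      = ψ.toAddMonoidHom (I.blocks t fun t' => I.blocks s fun s' =>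
        Arel.μ.app (unshift j t') (-q + -j) z (unshift j s') (-p + -j))
    rw [I.map_blocks, I.map_blocks]
    simp only [I.map_blocks]
    rw [I.blocks_comm]
    refine I.blocks_congr t fun t' _ => I.blocks_congr s fun s' _ => ?_
    refine Eq.trans ?_ (dualCongr_apply _ _ _).symm
    rw [degCast_apply]
    change v _ = v _
    refine congrArg v ?_
    have key : ∀ (a b c : ℤ) (h : a = b) (z : Arel.V (I.obj Y) (I.obj X) a),
        Arel.μ.app (unshift j t') b (degCast (V := fun p => Arel.V (I.obj Y) (I.obj X) p) h z)
          (unshift j s') c = Arel.μ.app (unshift j t') a z (unshift j s') c := by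
      rintro a _ c rfl z; rfl
    exact key _ _ _ _ _)
  exact fun {_ _ _ _} => (PreMor.isClosed_cast _).2
    (PreMor.IsClosed.comp h₂ (PreMor.IsClosed.dual hirel))

theorem isClosed_IrelDual {I : AInfFunctor B (A.susp j)}
    {irel : PreMor B.diag ((Arel.shift j (-j)).pullback I) j} (hirel : PreMor.IsClosed irel)
    {σ : HochDual A Arel A.N} (hσ : σ.IsClosed) : (IrelDual I irel σ).IsClosed :=
  fun s p z => HochDual.IsClosed.mapDual (HochDual.IsClosed.pullbackDual I
    (HochDual.IsClosed.shiftDual hσ j (-j))) hirel s p z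

end Relative

section Relative

variable {A : AInfCat.{u, v}} {B : AInfCat.{u', v'}} {j : ℤ} {Arel : Bimodule.{u, u, v, v, w} A A}

theorem PreMor.dualCongr_app {M : Bimodule.{u, u, v, v, w} A A} {g : ℤ} (α : PreMor A.diag M.dual g)
    {X X' Y' Y : A.Ob} (s : Str A.Hom X X') (p : ℤ) (x : A.Hom X' Y' p) (t : Str A.Hom Y' Y)
    {q r : ℤ} (h : -q = r) (z : M.V Y X r) :
    dualCongr (V := fun p => M.V Y X p) h (α.app s p x t q) z = ev α s p x t r z := by
  subst h
  exact (ev_neg ..).symm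

/-- On empty strings each factor of `Ψ` contributes only its `0|1|0` component: `i` sends `x` to
`I₁(x)`, and `i_rel^∨` moves `i_rel` to the side of `z`. -/
theorem ev_Psi (hN : A.N = B.N + j) (I : AInfFunctor B (A.susp j))
    (irel : PreMor B.diag ((Arel.shift j (-j)).pullback I) j) {g : ℤ}
    (α : PreMor A.diag Arel.dual g) {X Y : B.Ob} {p q : ℤ} (hq : q = p + (g + j))
    (x : B.Hom X Y p) (z : B.Hom Y X (-q)) :
    PreMor.ev (Psi hN I irel α) (nil X) p x (nil Y) (-q) z
      = PreMor.ev α (nil (I.obj X)) (p + j) (I.map X Y (cons p x (nil Y)) p) (nil (I.obj Y))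
        (-(q - j) + -j) (irel.app (nil Y) (-q) z (nil X) (-(q - j))) := by
  rw [PreMor.ev_neg]
  have h₁ := Multi.compApp_nil (((diagMor hN I).comp ((Multi.shift α j j).pullback I)).relabel
    (W' := ((Arel.shift j (-j)).pullback I).dual.V)
    (fun X Y q => dualCongr (V := fun p => Arel.V (I.obj Y) (I.obj X) p)
      (show -(q + j) = -q + -j by ring))) (Multi.dual irel) (X := X) (Y := Y) p x
      (d := q - j) (q := q) (by ring)
  have h₂ := Multi.compApp_nil (diagMor hN I) ((Multi.shift α j j).pullback I) (X := X) (Y := Y) p x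
      (d := p) (q := q - j) (by rw [hq]; ring)
  refine (LinearMap.congr_fun h₁ z).trans ?_
  refine Eq.trans ?_ (PreMor.dualCongr_app α (nil (I.obj X)) (p + j)
    (I.map X Y (cons p x (nil Y)) p) (nil (I.obj Y)) (q := q - j + j) (by ring)
    (irel.app (nil Y) (-q) z (nil X) (-(q - j))))
  exact congrArg (fun ψ => dualCongr (V := fun p => Arel.V (I.obj Y) (I.obj X) p)
      (show -(q - j + j) = -(q - j) + -j by ring) ψ (irel.app (nil Y) (-q) z (nil X) (-(q - j)))) h₂

/-- On cycles `i_rel` respects left multiplication up to a boundary, and the induced closed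
functional on `I^*A_rel[-j]` vanishes on boundaries. -/
theorem IrelDual_app_mu (hN : A.N = B.N + j) (I : AInfFunctor B (A.susp j))
    {irel : PreMor B.diag ((Arel.shift j (-j)).pullback I) j} (hirel : PreMor.IsClosed irel)
    {σ : HochDual A Arel A.N} (hσ : σ.IsClosed) {X Y : B.Ob} {p r r' : ℤ} (hr : r = B.N - p)
    (hr' : r' = r + j)
    {x : B.Hom X Y p} (hx : x ∈ B.diag.cycles X Y p) {z : B.Hom Y X r}
    (hz : z ∈ B.diag.cycles Y X r) :
    (IrelDual I irel σ).app (nil X) 0 (B.diag.μ.app (cons p x (nil Y)) r z (nil X) 0)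
      = σ.app (nil (I.obj X)) 0 (Arel.μ.app (cons (p + j) (I.map X Y (cons p x (nil Y)) p)
        (nil (I.obj Y))) (r' + -j) (irel.app (nil Y) r z (nil X) r') (nil (I.obj X)) 0) := by
  have hτ : ((σ.shiftDual j (-j)).pullbackDual I).IsClosed :=
    HochDual.IsClosed.pullbackDual I (HochDual.IsClosed.shiftDual hσ j (-j))
  -- The degrees of `x` and `z` are complementary, so their product has degree `0` and its image
  -- under `i_rel` has degree `j`.
  have h₀ := HochDual.IsClosed.app_nil_boundary hτ X j _
    (PreMor.IsClosed.app_mu_add hirel (q := j) (e := 0) hx hz (by rw [hr]; ring) hr' (by ring))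
  have h₁ := (map_add (((σ.shiftDual j (-j)).pullbackDual I).appHom (nil X) j) _ _).symm.trans h₀
  have h₂ := eq_of_add_eq_zero_of_charTwo h₁
  refine Eq.trans (((σ.shiftDual j (-j)).pullbackDual I).appAt_congr (nil X)
    (d' := j) (by simp) (irel.app (nil X) 0 (B.diag.μ.app (cons p x (nil Y)) r z (nil X) 0) (nil X)))
    (h₂.trans ?_)
  have e₂ : (cons p x (nil Y)).rdeg B.N - 1 + (A.N - j) = p := by rw [hN]; simp; ring
  have h₃ : ((Arel.shift j (-j)).pullback I).μ.app (cons p x (nil Y)) r'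
        (irel.app (nil Y) r z (nil X) r') (nil X) j
      = Arel.μ.app (cons (p + j) (I.map X Y (cons p x (nil Y)) p)
        (nil (I.obj Y))) (r' + -j) (irel.app (nil Y) r z (nil X) r') (nil (I.obj X)) (j + -j) := by
    change Arel.μ.app (unshift j (consAt (V := (A.susp j).Hom)
      ((cons p x (nil Y)).rdeg B.N - 1 + (A.N - j)) (I.map X Y (cons p x (nil Y))) (nil (I.obj Y)))) 
      (r' + -j) (irel.app (nil Y) r z (nil X) r') (nil (I.obj X)) (j + -j) = _
    rw [e₂]
    rfl
  refine (congrArg (((σ.shiftDual j (-j)).pullbackDual I).appHom (nil X) j) h₃).trans ?_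
  exact σ.appAt_congr (nil (I.obj X)) (add_neg_cancel j) (Arel.μ.app
    (cons (p + j) (I.map X Y (cons p x (nil Y)) p)
        (nil (I.obj Y))) (r' + -j) (irel.app (nil Y) r z (nil X) r') (nil (I.obj X)))

/-- Both pairings reduce to `σ(μ(I₁x, i_rel z))`. Here `I₁x` and `i_rel z` are again cycles, which
is what permits replacing `φ` by the homologous `ΓT^∨(σ)`. -/
theorem ev_Psi_eq_IrelDual_app (hN : A.N = B.N + j) (I : AInfFunctor B (A.susp j))
    {irel : PreMor B.diag ((Arel.shift j (-j)).pullback I) j} (hirel : PreMor.IsClosed irel)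
    {φ : PreMor A.diag Arel.dual (-A.N)} {σ : HochDual A Arel A.N} (hσ : σ.IsClosed)
    (h : PreMor.Homologous σ.toPreMor φ) {X Y : B.Ob} {p r : ℤ} (hr : r = B.N - p)
    {x : B.Hom X Y p} (hx : x ∈ B.diag.cycles X Y p) {z : B.Hom Y X r}
    (hz : z ∈ B.diag.cycles Y X r) :
    PreMor.ev (Psi hN I irel φ) (nil X) p x (nil Y) r z
      = (IrelDual I irel σ).app (nil X) 0 (B.diag.μ.app (cons p x (nil Y)) r z (nil X) 0) := by
  obtain ⟨q, rfl⟩ : ∃ q, r = -q := ⟨-r, (neg_neg r).symm⟩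
  have hq : q = p + (-A.N + j) := by rw [hN]; linarith
  have hi : -(q - j) = -q + j := by ring
  have hx' : I.map X Y (cons p x (nil Y)) p ∈ A.diag.cycles (I.obj X) (I.obj Y) (p + j) :=
    (A.diag.mem_cycles_iff (by ring)).2 (PreMor.IsClosed.lin_mem_cycles
      (PreMor.isClosed_diagMor hN I) (q := p) (by ring) hx)
  have hz' : irel.app (nil Y) (-q) z (nil X) (-(q - j))
      ∈ Arel.cycles (I.obj Y) (I.obj X) (-(q - j) + -j) :=
    (Arel.mem_cycles_iff (by ring)).2 (PreMor.IsClosed.lin_mem_cycles hirel hi hz)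
  rw [ev_Psi hN I irel φ hq, IrelDual_app_mu hN I hirel hσ hr hi hx hz,
    ← h.ev_eq (by rw [hq]; ring) hx' hz', HochDual.ev_toPreMor σ (by rw [hq]; ring)]

theorem isQuasiIso_Psi_iff (hN : A.N = B.N + j) (I : AInfFunctor B (A.susp j))
    {irel : PreMor B.diag ((Arel.shift j (-j)).pullback I) j} (hirel : PreMor.IsClosed irel)
    {φ : PreMor A.diag Arel.dual (-A.N)} (hφ : PreMor.IsClosed φ) {σ : HochDual A Arel A.N}
    (hσ : σ.IsClosed) (h : PreMor.Homologous σ.toPreMor φ) :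
    PreMor.IsQuasiIso (Psi hN I irel φ) ↔ (IrelDual I irel σ).IsHomNondegenerate :=
  HochDual.isQuasiIso_iff_isHomNondegenerate (isClosed_IrelDual hirel hσ) (by rw [hN]; ring)
    (isClosed_Psi hN I hirel hφ) fun _ _ _ _ hr _ hx _ hz =>
      ev_Psi_eq_IrelDual_app hN I hirel hσ h hr hx hz

/-- Holds for each closed representative `σ` separately, and the left-hand side does not mention
`σ`. Non-degeneracy is therefore independent of the choice of representative. -/
theorem isRelWeakCYPairing_iff (hN : A.N = B.N + j) (I : AInfFunctor B (A.susp j))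
    {irel : PreMor B.diag ((Arel.shift j (-j)).pullback I) j} (hirel : PreMor.IsClosed irel)
    {φ : PreMor A.diag Arel.dual (-A.N)} (hφ : PreMor.IsClosed φ) {σ : HochDual A Arel A.N}
    (hσ : σ.IsClosed) (h : PreMor.Homologous σ.toPreMor φ) :
    IsRelWeakCYPairing hN I irel φ ↔
      σ.IsHomNondegenerate ∧ (IrelDual I irel σ).IsHomNondegenerate := by
  refine and_congr (HochDual.isQuasiIso_iff_isHomNondegenerate hσ rfl hφ
    fun X Y p r hr x hx z hz => ?_) (isQuasiIso_Psi_iff hN I hirel hφ hσ h)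
  rw [← h.ev_eq (by rw [hr]; ring) hx hz, σ.ev_toPreMor hr]

end Relative

theorem mainTheorem9 {A : AInfCat.{u, v}} {B : AInfCat.{u', v'}} (hA : A.IsHUnital)
    (hB : B.IsHUnital) {j : ℤ} (hN : A.N = B.N + j) (I : AInfFunctor B (A.susp j))
    (Arel : Bimodule.{u, u, v, v, w} A A) (hrel : Arel.IsHUnital)
    (irel : PreMor B.diag ((Arel.shift j (-j)).pullback I) j) (hirel : PreMor.IsClosed irel)
    (φ : PreMor A.diag Arel.dual (-A.N)) (hφ : PreMor.IsClosed φ) :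
    (IsRelWeakCYPairing hN I irel φ ↔
      ∀ σ : HochDual A Arel A.N, σ.IsClosed → PreMor.Homologous σ.toPreMor φ →
        σ.IsHomNondegenerate ∧ (IrelDual I irel σ).IsHomNondegenerate) ∧
    (IsRelWeakCYPairing hN I irel φ ↔
      ∃ σ : HochDual A Arel A.N, σ.IsClosed ∧ PreMor.Homologous σ.toPreMor φ ∧
        σ.IsHomNondegenerate ∧ (IrelDual I irel σ).IsHomNondegenerate) := by
  -- A representative is needed for passing from 2 to 1 and from 1 to 3; without one, condition 2
  -- would be vacuous.
  obtain ⟨σ, hσ, h⟩ := HochDual.exists_homologous_toPreMor hA hrel φ hφ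
  refine ⟨⟨fun hφ' τ hτ hτφ => (isRelWeakCYPairing_iff hN I hirel hφ hτ hτφ).1 hφ', fun hσ' =>
    (isRelWeakCYPairing_iff hN I hirel hφ hσ h).2 (hσ' σ hσ h)⟩, fun hφ' => ⟨σ, hσ, h,
    (isRelWeakCYPairing_iff hN I hirel hφ hσ h).1 hφ'⟩, ?_⟩
  rintro ⟨τ, hτ, hτφ, hτ'⟩
  exact (isRelWeakCYPairing_iff hN I hirel hφ hτ hτφ).2 hτ'
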